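/- Let $\mathbb{K}$ be a nontrivially normed field of characteristic $0$ (for example $\mathbb{C}$), let $t\in\mathbb{K}$ be nonzero and not a root of unity, and let $u_1,u_2\in\mathbb{K}$. For $s\neq 0$ put $p=s^2$ (so $s=p^{1/2}$) and $q=tp$; the limit $q\to0$ means $s\to0$ with $t,u_1,u_2$ fixed. **Fock module.** Let $\mathcal{F}_{\vec u}$ be the polynomial ring over $\mathbb{K}$ in the commuting creation operators $a^{(i)}_{-n}$ ($i=1,2$, $n\ge1$) acting on $|\vec u\rangle$. The annihilation operators $a^{(i)}_n=n\frac{1-q^n}{1-t^n}\,\partial/\partial a^{(i)}_{-n}$ ($n\geq 1$) satisfy $[a^{(i)}_n,a^{(j)}_m]=n\frac{1-q^{|n|}}{1-t^{|n|}}\delta_{i,j}\delta_{n+m,0}$ for nonzero $n,m$, and $U_i$ acts as the scalar $u_i$. Write $b^{(i)}_{-n}=a^{(i)}_{-n}$ and $b^{(i)}_n=\frac{n}{1-t^n}\,\partial/\partial a^{(i)}_{-n}$ ($n\geq 1$) for the bosons at $q=0$. Let $\langle\vec u|$ be the functional "constant term" on $\mathcal{F}_{\vec u}$; operators act on functionals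 from the right by composition. **Generators.** Set $$\eta^{(i)}(z)=\exp\Big(\sum_{n\ge1}\tfrac{1-t^{-n}}{n}z^na^{(i)}_{-n}\Big)\exp\Big(-\sum_{n\ge1}\tfrac{1-t^{n}}{n}z^{-n}a^{(i)}_{n}\Big),\qquad \varphi^{(i)}(z)=\exp\Big(\sum_{n\ge1}\tfrac{1-t^{-n}}{n}(1-p^{-n})z^na^{(i)}_{-n}\Big),$$ $$X^{(1)}(z)=\eta^{(1)}(p^{1/2}z)U_1+\varphi^{(1)}(p^{1/2}z)\,\eta^{(2)}(p^{-1/2}z)U_2,\qquad X^{(2)}(z)=X^{(1)}(pz)X^{(1)}(z),$$ and $X^{(i)}(z)=\sum_{n\in\mathbb{Z}}X^{(i)}_nz^{-n}$. Here the product $X^{(1)}(pz)X^{(1)}(z)$ is understood as usual: the matrix elements of the coefficients of $X^{(1)}(w)X^{(1)}(z)$, expanded in $|w|>|z|$, are rational functions of $z/w$, and these are evaluated at $w=pz$. **Crystallization.** Define, with limits taken matrix element by matrix element, $$\tilde X^{(1)}_n=\lim_{q\to0}p^{|n|/2}X^{(1)}_n,\qquad \tilde X^{(2)}_n=\lim_{q\to0}p^{n/2}X^{(2)}_n,$$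 and for partitions $\lambda,\mu$ set $$|\tilde X_{\lambda,\mu}\rangle=\tilde X^{(2)}_{-\mu_1}\tilde X^{(2)}_{-\mu_2}\cdots\tilde X^{(1)}_{-\lambda_1}\tilde X^{(1)}_{-\lambda_2}\cdots|\vec u\rangle,\qquad \langle\tilde X_{\lambda,\mu}|=\langle\vec u|\cdots\tilde X^{(1)}_{\lambda_2}\tilde X^{(1)}_{\lambda_1}\cdots\tilde X^{(2)}_{\mu_2}\tilde X^{(2)}_{\mu_1}.$$ **Hall–Littlewood functions.** For a parameter $\tau$ let $P_\lambda(p_n;\tau)$ be the Hall–Littlewood function written as a polynomial in the power sums $p_1,p_2,\dots$, i.e. for all $N\ge\ell(\lambda)$ and $p_n=\sum_{i=1}^Nx_i^n$, $$P_\lambda=\frac1{v_\lambda(\tau)}\sum_{w\in S_N}w\Big(x_1^{\lambda_1}\cdots x_N^{\lambda_N}\prod_{i<j}\frac{x_i-\tau x_j}{x_i-x_j}\Big),\qquad v_\lambda(\tau)=\prod_{i\ge0}\prod_{k=1}^{m_i}\frac{1-\tau^k}{1-\tau},$$ where $m_i$ is the multiplicity of $i$ in $\lambda$ and $m_0=N-\ell(\lambda)$.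 Put $Q_\lambda=b_\lambda(\tau)P_\lambda$ with $b_\lambda(\tau)=\prod_{i\ge1}\prod_{k=1}^{m_i}(1-\tau^k)$. For commuting operators $B_n$, $Q_\lambda(B_n;\tau)$ denotes the result of substituting $B_n$ for $p_n$. **Proposition.** The limits defining $\tilde X^{(1)}_n$ and $\tilde X^{(2)}_n$ exist for all $n\in\mathbb{Z}$, and for all partitions $\lambda,\mu$ $$|\tilde X_{\lambda,\mu}\rangle=(u_1u_2)^{\ell(\mu)}u_2^{\ell(\lambda)}\,Q_\mu(b^{(+)}_{-n};t^{-1})\,Q_\lambda(b^{(-)}_{-n};t^{-1})\,|\vec u\rangle,$$ $$\langle\tilde X_{\lambda,\mu}|=u_1^{\ell(\lambda)}(u_1u_2)^{\ell(\mu)}t^{|\lambda|+|\mu|}\,\langle\vec u|\,Q_\lambda(b^{(-)}_{n};t^{-1})\,Q_\mu(b^{(+)}_{n};t^{-1}),$$ where, for $n>0$, $$b^{(+)}_n=b^{(1)}_n+b^{(2)}_n,\quad b^{(+)}_{-n}=b^{(2)}_{-n},\quad b^{(-)}_n=b^{(1)}_n,\quad b^{(-)}_{-n}=-b^{(1)}_{-n}+b^{(2)}_{-n}.$$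 -/

import Mathlib

open Filter Topology
open scoped LaurentSeries RatFunc

noncomputable section

namespace CrystalPBW

section Fock

variable (𝕜 : Type*) [Field 𝕜]

/-- The Fock module `𝓕_u` of two families of bosons, realised as polynomials in the creation
operators: the variable `(i, n)` is the `n`-th creation operator of the family `i` (the families
`1, 2` have the indices `0, 1`), and the constant `1` is the highest weight vector `|u⟩`.  The
highest weight enters through `U₁, U₂`, which act on `𝓕_u` as the scalars `u₁, u₂`. -/
abbrev Fock : Type _ := MvPolynomial (Fin 2 × ℕ+) 𝕜

/-- Operators on the Fock module. -/
abbrev Op : Type _ := Module.End 𝕜 (Fock 𝕜)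

/-- The highest weight vector `|u⟩`. -/
def ket : Fock 𝕜 := 1

/-- The dual highest weight vector `⟨u|`, with `⟨u|u⟩ = 1` and `⟨u| a_{-n} = 0` for `n > 0`.  The
right action of an operator `A` on a functional `φ` of the dual module is `φ ∘ₗ A`. -/
def bra : Module.Dual 𝕜 (Fock 𝕜) := MvPolynomial.lcoeff 𝕜 0

variable {𝕜}

/-- The creation operator `a^{(i)}_{-n}` (and `b^{(i)}_{-n}`), `n > 0`. -/
def create (i : Fin 2) (n : ℕ+) : Op 𝕜 :=
  LinearMap.mulLeft 𝕜 (MvPolynomial.X (i, n) : Fock 𝕜)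

/-- The annihilation operator `a^{(i)}_n`, `n > 0`, of the bosons with
`[a^{(i)}_n, a^{(j)}_m] = n (1 - q^|n|) / (1 - t^|n|) δ_{i,j} δ_{n+m,0}`. -/
def annihA (q t : 𝕜) (i : Fin 2) (n : ℕ+) : Op 𝕜 :=
  ((n : 𝕜) * (1 - q ^ (n : ℕ)) / (1 - t ^ (n : ℕ))) •
    ((MvPolynomial.pderiv (i, n) : Derivation 𝕜 (Fock 𝕜) (Fock 𝕜)) : Fock 𝕜 →ₗ[𝕜] Fock 𝕜)

/-- The annihilation operator `b^{(i)}_n`, `n > 0`, of the crystallized bosons with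
`[b^{(i)}_n, b^{(j)}_m] = n / (1 - t^|n|) δ_{i,j} δ_{n+m,0}`. -/
def annihB (t : 𝕜) (i : Fin 2) (n : ℕ+) : Op 𝕜 :=
  ((n : 𝕜) / (1 - t ^ (n : ℕ))) •
    ((MvPolynomial.pderiv (i, n) : Derivation 𝕜 (Fock 𝕜) (Fock 𝕜)) : Fock 𝕜 →ₗ[𝕜] Fock 𝕜)

end Fock

section FormalSeries

variable {𝕜 : Type*} [Field 𝕜]

/-- The sum of a pointwise finite family of operators: `(∑ k, T k) v = ∑ k, T k v`.  (The value is
`0` if the family is not pointwise finite.) -/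
def locSum {ι : Type*} (T : ι → Op 𝕜) : Op 𝕜 :=
  open Classical in
  if h : ∀ v, (Function.support fun k => T k v).Finite then
    { toFun := fun v => ∑ᶠ k, T k v
      map_add' := fun v w => by
        simp only [map_add]
        exact finsum_add_distrib (h v) (h w)
      map_smul' := fun c v => by
        simp only [map_smul, RingHom.id_apply]
        exact (smul_finsum c fun k => T k v).symm }
  else 0

/-- The coefficient of `z ^ k` in `exp (∑_{n ≥ 1} A_n z ^ n)`, that is
`∑_r (1 / r!) ∑_{n_1 + ⋯ + n_r = k} A_{n_1} ⋯ A_{n_r}` (sum over all compositions of `k`). -/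
def expCoeff (A : ℕ+ → Op 𝕜) (k : ℕ) : Op 𝕜 :=
  ∑ c : Composition k,
    ((c.length.factorial : 𝕜)⁻¹) • (c.blocks.map fun n => A n.toPNat').prod

/-! A formal series `V(z) = ∑_{n ∈ ℤ} V_n z ^ (-n)` of operators is given by its modes `V : ℤ → Op`. -/

/-- The modes of `exp (∑_{n ≥ 1} A_n z ^ n)`. -/
def expPos (A : ℕ+ → Op 𝕜) (n : ℤ) : Op 𝕜 :=
  if n ≤ 0 then expCoeff A (-n).toNat else 0

/-- The modes of `exp (∑_{n ≥ 1} A_n z ^ (-n))`. -/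
def expNeg (A : ℕ+ → Op 𝕜) (n : ℤ) : Op 𝕜 :=
  if 0 ≤ n then expCoeff A n.toNat else 0

/-- The modes of the product `V(z) W(z)`. -/
def mulModes (V W : ℤ → Op 𝕜) (n : ℤ) : Op 𝕜 :=
  locSum fun k : ℤ => V k * W (n - k)

/-- The modes of `V(c z)`. -/
def rescale (c : 𝕜) (V : ℤ → Op 𝕜) (n : ℤ) : Op 𝕜 :=
  c ^ (-n) • V n

/-- The Laurent series `∑_k c_k x ^ k` is the expansion at `x = 0` of a rational function that is
regular at the point `x₀` and has the value `y` there. -/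
def IsRationalValue (c : ℤ → 𝕜) (x₀ y : 𝕜) : Prop :=
  ∃ r : RatFunc 𝕜,
    (∀ k, (algebraMap (RatFunc 𝕜) (LaurentSeries 𝕜) r).coeff k = c k) ∧
    r.denom.eval x₀ ≠ 0 ∧ r.eval (RingHom.id 𝕜) x₀ = y

/-- `L` is the coefficient of `z ^ (-n)` in the product `V(p z) W(z)`.  The matrix elements of
`V(w) W(z) = ∑_n z ^ (-n) ∑_k V_k W_{n-k} (z / w) ^ k` are Laurent series in `x = z / w`
(expanded in the domain `|w| > |z|`); they are evaluated at `w = p z`, that is at `x = 1 / p`, as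
rational functions of `x`. -/
def IsShiftedProductMode (p : 𝕜) (V W : ℤ → Op 𝕜) (n : ℤ) (L : Op 𝕜) : Prop :=
  ∀ (v : Fock 𝕜) (m : (Fin 2 × ℕ+) →₀ ℕ),
    IsRationalValue (fun k => MvPolynomial.coeff m (V k (W (n - k) v))) p⁻¹
      (MvPolynomial.coeff m (L v))

/-- The modes of `V(p z) W(z)`. -/
def shiftedProduct (p : 𝕜) (V W : ℤ → Op 𝕜) (n : ℤ) : Op 𝕜 :=
  open Classical in
  if h : ∃ L, IsShiftedProductMode p V W n L then h.choose else 0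

end FormalSeries

section Generators

/-! The parameters: `s = p ^ (1/2)` with `p = q / t`, so that `q = t s ^ 2`; the limit `q → 0` with
`t` fixed is the limit `s → 0`. -/

variable {𝕜 : Type*} [Field 𝕜]

/-- The vertex operator `η^{(i)}(z)`. -/
def eta (t s : 𝕜) (i : Fin 2) : ℤ → Op 𝕜 :=
  mulModes
    (expPos fun n => ((1 - t⁻¹ ^ (n : ℕ)) / (n : 𝕜)) • create i n)
    (expNeg fun n => (-((1 - t ^ (n : ℕ)) / (n : 𝕜))) • annihA (t * s ^ 2) t i n)

/-- The vertex operator `φ^{(i)}(z)`. -/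
def varphi (t s : 𝕜) (i : Fin 2) : ℤ → Op 𝕜 :=
  expPos fun n =>
    ((1 - t⁻¹ ^ (n : ℕ)) / (n : 𝕜) * (1 - (s ^ 2)⁻¹ ^ (n : ℕ))) • create i n

/-- `Λ¹(z) = η^{(1)}(p^{1/2} z) U₁`. -/
def Lambda1 (t u₁ s : 𝕜) (n : ℤ) : Op 𝕜 :=
  u₁ • rescale s (eta t s 0) n

/-- `Λ²(z) = φ^{(1)}(p^{1/2} z) η^{(2)}(p^{-1/2} z) U₂`. -/
def Lambda2 (t u₂ s : 𝕜) (n : ℤ) : Op 𝕜 :=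
  u₂ • mulModes (rescale s (varphi t s 0)) (rescale s⁻¹ (eta t s 1)) n

/-- The generators `X^{(1)}_n`: `X^{(1)}(z) = Λ¹(z) + Λ²(z)`. -/
def X1 (t u₁ u₂ s : 𝕜) (n : ℤ) : Op 𝕜 :=
  Lambda1 t u₁ s n + Lambda2 t u₂ s n

/-- The generators `X^{(2)}_n`: `X^{(2)}(z) = X^{(1)}(p z) X^{(1)}(z)`. -/
def X2 (t u₁ u₂ s : 𝕜) (n : ℤ) : Op 𝕜 :=
  shiftedProduct (s ^ 2) (X1 t u₁ u₂ s) (X1 t u₁ u₂ s) n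

end Generators

section Crystal

variable {𝕜 : Type*} [NontriviallyNormedField 𝕜]

/-- `L` is the limit of the operators `A s` as `s → 0`, `s ≠ 0`: all matrix elements converge. -/
def IsCrystalLimit (A : 𝕜 → Op 𝕜) (L : Op 𝕜) : Prop :=
  ∀ (v : Fock 𝕜) (m : (Fin 2 × ℕ+) →₀ ℕ),
    Tendsto (fun s => MvPolynomial.coeff m (A s v)) (𝓝[≠] 0) (𝓝 (MvPolynomial.coeff m (L v)))

/-- The limit of the operators `A s` as `s → 0`, `s ≠ 0` (and `0` if there is none). -/
def crystalLimit (A : 𝕜 → Op 𝕜) : Op 𝕜 :=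
  open Classical in
  if h : ∃ L, IsCrystalLimit A L then h.choose else 0

/-- The crystallized generators `X̃^{(1)}_n = lim_{q → 0} p^{|n|/2} X^{(1)}_n`. -/
def Xt1 (t u₁ u₂ : 𝕜) (n : ℤ) : Op 𝕜 :=
  crystalLimit fun s => s ^ n.natAbs • X1 t u₁ u₂ s n

/-- The crystallized generators `X̃^{(2)}_n = lim_{q → 0} p^{n/2} X^{(2)}_n`. -/
def Xt2 (t u₁ u₂ : 𝕜) (n : ℤ) : Op 𝕜 :=
  crystalLimit fun s => s ^ n • X2 t u₁ u₂ s n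

/-- The parts `λ₁ ≥ λ₂ ≥ ⋯ ≥ λ_ℓ > 0` of a partition, in decreasing order. -/
def partList {n : ℕ} (lam : n.Partition) : List ℕ := lam.parts.sort (· ≥ ·)

/-- The length `ℓ(λ)`. -/
def len {n : ℕ} (lam : n.Partition) : ℕ := lam.parts.card

/-- The vector `|X̃_{λ,μ}⟩ = X̃^{(2)}_{-μ₁} X̃^{(2)}_{-μ₂} ⋯ X̃^{(1)}_{-λ₁} X̃^{(1)}_{-λ₂} ⋯ |u⟩`. -/
def ketX (t u₁ u₂ : 𝕜) {a b : ℕ} (lam : a.Partition) (mu : b.Partition) : Fock 𝕜 :=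
  (((partList mu).map fun k => Xt2 t u₁ u₂ (-(k : ℤ))).prod *
    ((partList lam).map fun k => Xt1 t u₁ u₂ (-(k : ℤ))).prod) (ket 𝕜)

/-- The dual vector `⟨X̃_{λ,μ}| = ⟨u| ⋯ X̃^{(1)}_{λ₂} X̃^{(1)}_{λ₁} ⋯ X̃^{(2)}_{μ₂} X̃^{(2)}_{μ₁}`. -/
def braX (t u₁ u₂ : 𝕜) {a b : ℕ} (lam : a.Partition) (mu : b.Partition) :
    Module.Dual 𝕜 (Fock 𝕜) :=
  bra 𝕜 ∘ₗ
    (((partList lam).map fun k => Xt1 t u₁ u₂ (k : ℤ)).reverse.prod *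
      ((partList mu).map fun k => Xt2 t u₁ u₂ (k : ℤ)).reverse.prod)

end Crystal

section HallLittlewood

variable {𝕜 : Type*} [Field 𝕜]

/-- `b_λ(t) = ∏_{i ≥ 1} ∏_{k=1}^{m_i(λ)} (1 - t^k)`. -/
def bCoeff (t : 𝕜) {n : ℕ} (lam : n.Partition) : 𝕜 :=
  ∏ i ∈ Finset.Icc 1 n, ∏ k ∈ Finset.Icc 1 (lam.parts.count i), (1 - t ^ k)

/-- `v_λ(t) = ∏_{i ≥ 0} ∏_{k=1}^{m_i(λ)} (1 - t^k) / (1 - t)`, where `m_0 = N - ℓ(λ)`. -/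
def vCoeff (t : 𝕜) {n : ℕ} (lam : n.Partition) (N : ℕ) : 𝕜 :=
  (∏ k ∈ Finset.Icc 1 (N - len lam), (1 - t ^ k) / (1 - t)) *
    ∏ i ∈ Finset.Icc 1 n, ∏ k ∈ Finset.Icc 1 (lam.parts.count i), (1 - t ^ k) / (1 - t)

/-- The Hall–Littlewood polynomial in `N ≥ ℓ(λ)` variables,
`(1 / v_λ(t)) ∑_{w ∈ S_N} w (x_1^{λ_1} ⋯ x_N^{λ_N} ∏_{i<j} (x_i - t x_j) / (x_i - x_j))`,
as an element of the field of rational functions. -/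
def hallLittlewoodPoly (t : 𝕜) {n : ℕ} (lam : n.Partition) (N : ℕ) :
    FractionRing (MvPolynomial (Fin N) 𝕜) :=
  let x : Fin N → FractionRing (MvPolynomial (Fin N) 𝕜) :=
    fun i => algebraMap (MvPolynomial (Fin N) 𝕜) _ (MvPolynomial.X i)
  (vCoeff t lam N)⁻¹ •
    ∑ w : Equiv.Perm (Fin N),
      (∏ i : Fin N, x (w i) ^ (partList lam).getD i 0) *
        ∏ ij : Fin N × Fin N with ij.1 < ij.2,
          (x (w ij.1) - t • x (w ij.2)) / (x (w ij.1) - x (w ij.2))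

/-- The polynomial `f` in the power sums `p_1, p_2, …` is the Hall–Littlewood function `P_λ`: for
each `N ≥ ℓ(λ)`, substituting `p_n = x_1^n + ⋯ + x_N^n` gives the Hall–Littlewood polynomial. -/
def IsHallLittlewoodP (t : 𝕜) {n : ℕ} (lam : n.Partition) (f : MvPolynomial ℕ+ 𝕜) : Prop :=
  ∀ N : ℕ, len lam ≤ N →
    algebraMap (MvPolynomial (Fin N) 𝕜) (FractionRing (MvPolynomial (Fin N) 𝕜))
        (MvPolynomial.aeval (fun k : ℕ+ => MvPolynomial.psum (Fin N) 𝕜 k) f) =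
      hallLittlewoodPoly t lam N

/-- The Hall–Littlewood function `P_λ(p_n; t)` as a polynomial in the power sums. -/
def hallLittlewoodP (t : 𝕜) {n : ℕ} (lam : n.Partition) : MvPolynomial ℕ+ 𝕜 :=
  open Classical in
  if h : ∃ f, IsHallLittlewoodP t lam f then h.choose else 0

/-- The Hall–Littlewood function `Q_λ(p_n; t) = b_λ(t) P_λ(p_n; t)`. -/
def hallLittlewoodQ (t : 𝕜) {n : ℕ} (lam : n.Partition) : MvPolynomial ℕ+ 𝕜 :=
  bCoeff t lam • hallLittlewoodP t lam

/-- The operator `f(B_1, B_2, …)` obtained from a polynomial `f` by substituting mutually commuting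
operators `B_n` for the variables (in each monomial the factors are written in increasing order of
the index). -/
def substOp (B : ℕ+ → Op 𝕜) (f : MvPolynomial ℕ+ 𝕜) : Op 𝕜 :=
  ∑ m ∈ f.support, MvPolynomial.coeff m f •
    ((m.support.sort (· ≤ ·)).map fun n => B n ^ m n).prod

/-- `b^{(+)}_n = b^{(1)}_n + b^{(2)}_n`, `n > 0`. -/
def bPlusAnnih (t : 𝕜) (n : ℕ+) : Op 𝕜 := annihB t 0 n + annihB t 1 n

/-- `b^{(+)}_{-n} = b^{(2)}_{-n}`, `n > 0`. -/
def bPlusCreate (n : ℕ+) : Op 𝕜 := create 1 n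

/-- `b^{(-)}_n = b^{(1)}_n`, `n > 0`. -/
def bMinusAnnih (t : 𝕜) (n : ℕ+) : Op 𝕜 := annihB t 0 n

/-- `b^{(-)}_{-n} = -b^{(1)}_{-n} + b^{(2)}_{-n}`, `n > 0`. -/
def bMinusCreate (n : ℕ+) : Op 𝕜 := -create 0 n + create 1 n

end HallLittlewood

end CrystalPBW

end

open CrystalPBW

/-! Every operator involved is a mode of one kind of object, `vertexMode α γ n`: multiplication by
the exponential of creation operators with exponents `α`, after the translation `shift γ` to which
the exponential of derivatives amounts (`diffOp_expC_lin`). Rescaling `z` and normal ordering only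
change `(α, γ)`.

Quadratic current: by Wick's rule (`isShiftedProductMode_vertexMode`) a product of two vertex
operators is the normally ordered product times a rational function of `z/w`, to be evaluated at
`1/p`. For Λ¹Λ¹, Λ²Λ² and Λ¹Λ² this function has the factor `1 - (q/t) z/w`, which vanishes there
because `q/t = p`; Λ²Λ¹ has no contraction. So `X2` is a single vertex operator (`X2_eq`).

Limit: Λ¹ and Λ² are rescalings, by `s` and `s⁻¹`, of vertex operators whose exponents converge as
`s → 0`, so their `n`-th modes carry `s^(-n)` and `s^n`. The factor `s^|n|` then keeps only Λ¹ for
`n > 0` and only Λ² for `n < 0`; in `X2` the factor `s^n` cancels the rescaling exactly.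

Hall–Littlewood functions: `Q_λ = H_{λ₁} H_{λ₂} ⋯ 1` for Jing's operators `H_r`
(`hallLittlewoodQ_eq`). In variables `x_1, …, x_N`, replacing `p_n` by `p_n - x_j^n` deletes `x_j`,
and by partial fractions the coefficient of `z^k`, `k ≥ 1`, in `∏ (1 - τ x_i z) / (1 - x_i z)` is `∑
c_j x_j^k`. Hence `H_r f` is the sum of `c_j x_j^r f(x without x_j)`, which is also the recursion of
the symmetrizing sum under fixing the first value of `w`. Independence of the power sums makes the
answer unique.

Matching: a vertex operator whose `α` is proportional to a family `y_n`, and whose `γ` translates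
`y_n` suitably, acts on polynomials in the `y_n` as Jing's operator (`vertexMode_aeval_mul`). The
translation in `X̃^{(2)}` fixes `b^{(-)}_{-n}`, so the factor `Q_λ` is a passive constant there. On
dual vectors `⟨u| f(∂)` transposition exchanges `α` with `γ` and `n` with `-n`
(`constTerm_diffOp_vertexMode`), so the same lemma applies, now with scale `κ = t`, the source of
`t^(|λ|+|μ|)`. -/

noncomputable section

namespace CrystalPBW

/-! ### Exponentials of power series over a commutative algebra -/

section ExpSeries

variable (𝕜 : Type*) [Field 𝕜] {R : Type*} [CommRing R] [Algebra 𝕜 R]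

/-- The coefficient of `z ^ k` in `exp (∑_{n ≥ 1} a_n z ^ n)` in a commutative algebra. -/
def expC (a : ℕ+ → R) (k : ℕ) : R :=
  ∑ c : Composition k, ((c.length.factorial : 𝕜)⁻¹) • (c.blocks.map fun n => a n.toPNat').prod

/-- The power series `∑_{n ≥ 1} a_n z ^ n`. -/
def genSeries (a : ℕ+ → R) : PowerSeries R :=
  PowerSeries.mk fun n => if 0 < n then a n.toPNat' else 0

/-- The power series `exp (∑_{n ≥ 1} a_n z ^ n)`. -/
def expSeries (a : ℕ+ → R) : PowerSeries R := PowerSeries.mk (expC 𝕜 a)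

variable {𝕜}

lemma genSeries_coeff_pos (a : ℕ+ → R) {n : ℕ} (hn : 0 < n) :
    PowerSeries.coeff n (genSeries a) = a n.toPNat' := by
  rw [genSeries, PowerSeries.coeff_mk, if_pos hn]

/-- Split off the first block: this is the induction step for expanding powers of `genSeries`. -/
lemma sum_composition_length_eq {M : Type*} [AddCommMonoid M] (k r : ℕ) (F : List ℕ → M) :
    ∑ c : Composition k with c.length = r + 1, F c.blocks =
      ∑ p ∈ Finset.HasAntidiagonal.antidiagonal k, if 0 < p.1 then
        ∑ c : Composition p.2 with c.length = r, F (p.1 :: c.blocks) else 0 := by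
  rw [← Finset.sum_filter, Finset.sum_sigma']
  symm
  refine Finset.sum_bij'
    (fun (x : (p : ℕ × ℕ) × Composition p.2) hx =>
      (⟨x.1.1 :: x.2.blocks, by
        intro i hi
        have h1 := (Finset.mem_filter.1 (Finset.mem_sigma.1 hx).1).2
        rcases List.mem_cons.1 hi with h | h
        · exact h ▸ h1
        · exact x.2.blocks_pos h, by
        have h1 := Finset.HasAntidiagonal.mem_antidiagonal.1 (Finset.mem_filter.1 (Finset.mem_sigma.1 hx).1).1
        simpa [x.2.blocks_sum] using h1⟩ : Composition k))
    (fun c hc => ⟨(c.blocks.headI, c.blocks.tail.sum), ⟨c.blocks.tail,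
      fun h => c.blocks_pos (List.mem_of_mem_tail h), rfl⟩⟩) ?_ ?_ ?_ ?_ ?_
  · intro x hx
    have h2 := (Finset.mem_filter.1 (Finset.mem_sigma.1 hx).2).2
    simp only [Finset.mem_filter, Finset.mem_univ, true_and, Composition.length,
      List.length_cons] at h2 ⊢
    omega
  · intro c hc
    have h2 := (Finset.mem_filter.1 hc).2
    obtain ⟨l, hl, hs⟩ := c
    cases l with
    | nil => simp [Composition.length] at h2
    | cons i l =>
      simp [Composition.length] at h2 hl hs ⊢
      exact ⟨⟨hs, hl.1⟩, h2⟩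
  · rintro ⟨⟨i, j⟩, l, hl, hs⟩ hx
    simp only at hs
    subst hs
    simp
  · intro c hc
    have h2 := (Finset.mem_filter.1 hc).2
    obtain ⟨l, hl, hs⟩ := c
    cases l with
    | nil => simp [Composition.length] at h2
    | cons i l => rfl
  · intro x hx
    rfl

lemma sum_composition_length_eq_coeff_pow (a : ℕ+ → R) (r k : ℕ) :
    ∑ c : Composition k with c.length = r, (c.blocks.map fun n => a n.toPNat').prod =
      PowerSeries.coeff k (genSeries a ^ r) := by
  induction r generalizing k with
  | zero =>
    rw [pow_zero, PowerSeries.coeff_one]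
    split_ifs with hk
    · subst hk
      rw [Finset.filter_true_of_mem]
      · have h : (Finset.univ : Finset (Composition 0)) = {⟨[], by simp, rfl⟩} := by
          refine Finset.eq_singleton_iff_unique_mem.2 ⟨Finset.mem_univ _, fun c _ => ?_⟩
          exact Composition.ext (List.length_eq_zero_iff.1 (Nat.le_zero.1 c.length_le))
        rw [h, Finset.sum_singleton]
        rfl
      · intro c _
        exact Nat.le_zero.1 c.length_le
    · rw [Finset.filter_false_of_mem]
      · simp
      · intro c _ h
        have := c.blocks_sum
        rw [List.length_eq_zero_iff.1 h] at this
        exact hk this.symm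
  | succ r ih =>
    rw [sum_composition_length_eq k r fun l => (l.map fun n => a n.toPNat').prod, pow_succ',
      PowerSeries.coeff_mul]
    refine Finset.sum_congr rfl fun p _ => ?_
    split_ifs with h
    · rw [← ih, genSeries_coeff_pos a h, Finset.mul_sum]
      simp
    · have : p.1 = 0 := by omega
      simp [genSeries, this]

/-- A composition of `k` has at most `k` blocks, so the exponential series may be cut at any `M ≥
k`. The freedom in `M` lets coefficients of different degrees share one truncation. -/
lemma expC_eq_sum_coeff_pow (a : ℕ+ → R) {k M : ℕ} (h : k ≤ M) :
    expC 𝕜 a k = ∑ r ∈ Finset.range (M + 1), ((r.factorial : 𝕜)⁻¹) •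
      PowerSeries.coeff k (genSeries a ^ r) := by
  have h1 : expC 𝕜 a k = ∑ r ∈ Finset.range (M + 1), ∑ c : Composition k with c.length = r,
      ((c.length.factorial : 𝕜)⁻¹) • (c.blocks.map fun n => a n.toPNat').prod := by
    rw [expC, Finset.sum_fiberwise_of_maps_to]
    intro c _
    have := c.length_le
    simp
    omega
  rw [h1]
  refine Finset.sum_congr rfl fun r _ => ?_
  rw [← sum_composition_length_eq_coeff_pow, Finset.smul_sum]
  refine Finset.sum_congr rfl fun c hc => ?_
  rw [(Finset.mem_filter.1 hc).2]

lemma expC_zero (a : ℕ+ → R) : expC 𝕜 a 0 = 1 := by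
  rw [expC_eq_sum_coeff_pow a le_rfl]
  simp

variable [CharZero 𝕜]

/-- Termwise differentiation of `∑ A^r / r!`, carried out on a truncation long enough for the
coefficient at hand. -/
lemma derivative_expSeries (a : ℕ+ → R) :
    PowerSeries.derivative R (expSeries 𝕜 a) =
      expSeries 𝕜 a * PowerSeries.derivative R (genSeries a) := by
  ext k
  -- The derivative reads off coefficient `k + 1`, so powers up to `r = k + 1` are needed here, but
  -- only up to `r = k` in `h2`.
  have h1 : PowerSeries.coeff k (PowerSeries.derivative R (expSeries 𝕜 a)) =
      PowerSeries.coeff k (PowerSeries.derivative R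
        (∑ r ∈ Finset.range (k + 2), ((r.factorial : 𝕜)⁻¹) • genSeries a ^ r)) := by
    rw [PowerSeries.coeff_derivative, PowerSeries.coeff_derivative, expSeries,
      PowerSeries.coeff_mk, expC_eq_sum_coeff_pow a le_rfl, map_sum]
    rfl
  have h2 : PowerSeries.coeff k (expSeries 𝕜 a * PowerSeries.derivative R (genSeries a)) =
      PowerSeries.coeff k ((∑ r ∈ Finset.range (k + 1), ((r.factorial : 𝕜)⁻¹) • genSeries a ^ r) *
        PowerSeries.derivative R (genSeries a)) := by
    rw [PowerSeries.coeff_mul, PowerSeries.coeff_mul]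
    refine Finset.sum_congr rfl fun p hp => ?_
    have := Finset.HasAntidiagonal.mem_antidiagonal.1 hp
    rw [expSeries, PowerSeries.coeff_mk, expC_eq_sum_coeff_pow a (M := k) (by omega), map_sum]
    rfl
  rw [h1, h2, Finset.sum_range_succ']
  congr 1
  simp only [← algebraMap_smul R (_ : 𝕜), map_add, map_sum, Finset.sum_mul, Derivation.map_smul]
  simp only [pow_zero, PowerSeries.derivative_one, smul_zero, add_zero]
  refine Finset.sum_congr rfl fun r _ => ?_
  rw [PowerSeries.derivative_pow, smul_mul_assoc, mul_assoc, Nat.add_sub_cancel,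
    ← nsmul_eq_mul, smul_comm, ← Nat.cast_smul_eq_nsmul R, smul_smul]
  congr 1
  rw [← map_natCast (algebraMap 𝕜 R), ← map_mul]
  congr 1
  rw [Nat.factorial_succ]
  have : ((r + 1 : ℕ) : 𝕜) ≠ 0 := by exact_mod_cast Nat.succ_ne_zero r
  have : ((r.factorial : ℕ) : 𝕜) ≠ 0 := by exact_mod_cast r.factorial_ne_zero
  push_cast at *
  field_simp

variable (𝕜)

-- Uniqueness for the linear equation `F' = F A`: coefficient `k + 1` is determined by the earlier
-- ones, as `k + 1` is invertible in `𝕜`.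
include 𝕜 in
lemma eq_of_derivative_eq_mul {F G A : PowerSeries R}
    (h0 : PowerSeries.constantCoeff F = PowerSeries.constantCoeff G)
    (hF : PowerSeries.derivative R F = F * A)
    (hG : PowerSeries.derivative R G = G * A) : F = G := by
  ext k
  induction k using Nat.strong_induction_on with
  | _ k ih =>
  cases k with
  | zero => simpa using h0
  | succ k =>
    have h1 : ((k + 1 : ℕ) : 𝕜) • PowerSeries.coeff (k + 1) F =
        ((k + 1 : ℕ) : 𝕜) • PowerSeries.coeff (k + 1) G := by
      have hF' := congrArg (PowerSeries.coeff k) hF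
      have hG' := congrArg (PowerSeries.coeff k) hG
      rw [PowerSeries.coeff_derivative, PowerSeries.coeff_mul] at hF' hG'
      rw [Nat.cast_smul_eq_nsmul, Nat.cast_smul_eq_nsmul, nsmul_eq_mul, nsmul_eq_mul, mul_comm,
        mul_comm _ (PowerSeries.coeff (k + 1) G)]
      push_cast
      rw [hF', hG']
      refine Finset.sum_congr rfl fun p hp => ?_
      have := Finset.HasAntidiagonal.mem_antidiagonal.1 hp
      rw [ih p.1 (by omega)]
    exact smul_right_injective R (r := ((k + 1 : ℕ) : 𝕜)) (by exact_mod_cast Nat.succ_ne_zero k) h1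

variable {𝕜}

omit [CharZero 𝕜] in
lemma constantCoeff_expSeries (a : ℕ+ → R) :
    PowerSeries.constantCoeff (expSeries 𝕜 a) = 1 := by
  rw [← PowerSeries.coeff_zero_eq_constantCoeff_apply, expSeries, PowerSeries.coeff_mk, expC_zero]

/-- The working characterization of the exponential: constant term and logarithmic derivative. The
closed forms below are verified through it. -/
lemma eq_expSeries {a : ℕ+ → R} {F : PowerSeries R} (h0 : PowerSeries.constantCoeff F = 1)
    (hF : PowerSeries.derivative R F = F * PowerSeries.derivative R (genSeries a)) :
    F = expSeries 𝕜 a :=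
  eq_of_derivative_eq_mul 𝕜 (h0.trans (constantCoeff_expSeries a).symm) hF (derivative_expSeries a)

lemma genSeries_add (a b : ℕ+ → R) : genSeries (a + b) = genSeries a + genSeries b := by
  ext n
  by_cases h : 0 < n <;> simp [genSeries, h]

lemma expSeries_add (a b : ℕ+ → R) :
    expSeries 𝕜 (a + b) = expSeries 𝕜 a * expSeries 𝕜 b := by
  symm
  apply eq_expSeries
  · simp [constantCoeff_expSeries]
  · rw [Derivation.leibniz, derivative_expSeries, derivative_expSeries, genSeries_add, map_add]
    simp only [smul_eq_mul]
    ring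

lemma expSeries_zero : expSeries 𝕜 (0 : ℕ+ → R) = 1 := by
  symm
  apply eq_expSeries
  · simp
  · have : genSeries (0 : ℕ+ → R) = 0 := by ext n; simp [genSeries]
    simp [this]

lemma expSeries_sum {ι : Type*} (s : Finset ι) (a : ι → ℕ+ → R) :
    expSeries 𝕜 (∑ i ∈ s, a i) = ∏ i ∈ s, expSeries 𝕜 (a i) := by
  classical
  induction s using Finset.induction_on with
  | empty => simp [expSeries_zero]
  | insert i s hi ih => rw [Finset.sum_insert hi, Finset.prod_insert hi, expSeries_add, ih]

lemma expC_add (a b : ℕ+ → R) (k : ℕ) :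
    expC 𝕜 (a + b) k = ∑ p ∈ Finset.HasAntidiagonal.antidiagonal k, expC 𝕜 a p.1 * expC 𝕜 b p.2 := by
  have := congrArg (PowerSeries.coeff k) (expSeries_add (𝕜 := 𝕜) a b)
  simpa [expSeries, PowerSeries.coeff_mul] using this

lemma succ_mul_expC (a : ℕ+ → R) (k : ℕ) :
    ((k : R) + 1) * expC 𝕜 a (k + 1) =
      ∑ p ∈ Finset.HasAntidiagonal.antidiagonal k, expC 𝕜 a p.1 * (((p.2 : R) + 1) * a (p.2 + 1).toPNat') := by
  have := congrArg (PowerSeries.coeff k) (derivative_expSeries (𝕜 := 𝕜) a)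
  rw [PowerSeries.coeff_derivative, PowerSeries.coeff_mul, expSeries, PowerSeries.coeff_mk,
    mul_comm] at this
  rw [this]
  refine Finset.sum_congr rfl fun p _ => ?_
  rw [PowerSeries.coeff_derivative, PowerSeries.coeff_mk, genSeries_coeff_pos _ (Nat.succ_pos _),
    mul_comm (a _)]

/-- The exponent is the logarithm series of `1 - c x z`. -/
lemma expSeries_neg_pow_div (c : 𝕜) (x : R) :
    expSeries 𝕜 (fun n : ℕ+ => -((n : 𝕜)⁻¹ • (algebraMap 𝕜 R c * x) ^ (n : ℕ))) =
      1 - PowerSeries.C (algebraMap 𝕜 R c * x) * PowerSeries.X := by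
  generalize algebraMap 𝕜 R c * x = y
  symm
  apply eq_expSeries
  · simp
  · have h : PowerSeries.derivative R (genSeries (fun n : ℕ+ => -((n : 𝕜)⁻¹ • y ^ (n : ℕ)))) =
        PowerSeries.mk fun n => -y ^ (n + 1) := by
      ext n
      rw [PowerSeries.coeff_derivative, genSeries_coeff_pos _ (Nat.succ_pos _),
        PowerSeries.coeff_mk]
      have h2 : ((n : 𝕜) + 1) ≠ 0 := by exact_mod_cast Nat.succ_ne_zero n
      have h3 : (n : R) + 1 = algebraMap 𝕜 R (n + 1) := by simp
      have h4 : ((n + 1).toPNat' : ℕ) = n + 1 := rfl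
      rw [h4, h3, neg_mul, smul_mul_assoc, ← Algebra.commutes, ← Algebra.smul_def, smul_smul]
      push_cast
      rw [inv_mul_cancel₀ h2, one_smul]
    have hd : PowerSeries.derivative R (1 - PowerSeries.C y * PowerSeries.X) =
        -PowerSeries.C y := by
      rw [map_sub, Derivation.leibniz, PowerSeries.derivative_one, PowerSeries.derivative_C,
        PowerSeries.derivative_X]
      simp
    rw [h, hd]
    ext n
    rw [sub_mul, one_mul, map_sub, mul_assoc (PowerSeries.C y),
      PowerSeries.coeff_C_mul, map_neg, PowerSeries.coeff_C]
    cases n with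
    | zero => simp
    | succ n =>
      rw [mul_comm PowerSeries.X, PowerSeries.coeff_succ_mul_X]
      simp [pow_succ]
      ring

-- Homogeneity: the blocks of a composition of `k` sum to `k`.
omit [CharZero 𝕜] in
lemma expC_pow_mul (x : R) (a : ℕ+ → R) (k : ℕ) :
    expC 𝕜 (fun n : ℕ+ => x ^ (n : ℕ) * a n) k = x ^ k * expC 𝕜 a k := by
  have hl : ∀ l : List ℕ, (∀ i ∈ l, 0 < i) →
      (l.map fun n => x ^ ((n.toPNat' : ℕ+) : ℕ) * a n.toPNat').prod =
        x ^ l.sum * (l.map fun n => a n.toPNat').prod := by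
    intro l hl
    induction l with
    | nil => simp
    | cons i l ih =>
      rw [List.map_cons, List.prod_cons, ih fun j hj => hl j (List.mem_cons_of_mem _ hj)]
      have : ((i.toPNat' : ℕ+) : ℕ) = i := by simp [hl i List.mem_cons_self]
      rw [this, List.sum_cons, List.map_cons, List.prod_cons, pow_add, mul_mul_mul_comm]
  rw [expC, expC, Finset.mul_sum]
  refine Finset.sum_congr rfl fun c _ => ?_
  rw [hl _ fun i hi => c.blocks_pos hi, c.blocks_sum, mul_smul_comm]

omit [CharZero 𝕜] in
lemma map_expC {S : Type*} [CommRing S] [Algebra 𝕜 S] (φ : R →ₐ[𝕜] S) (a : ℕ+ → R) (k : ℕ) :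
    φ (expC 𝕜 a k) = expC 𝕜 (fun n => φ (a n)) k := by
  simp only [expC, map_sum, map_smul, map_list_prod, List.map_map]
  rfl

end ExpSeries

/-! ### Differential operators with constant coefficients -/

section DiffOp

variable {𝕜 : Type*} [Field 𝕜] {σ : Type*}

/-- The commutator of two derivations is a derivation, and this one kills the variables. -/
lemma pderiv_comm (i j : σ) (f : MvPolynomial σ 𝕜) :
    MvPolynomial.pderiv i (MvPolynomial.pderiv j f) =
      MvPolynomial.pderiv j (MvPolynomial.pderiv i f) := by
  classical
  have h : ⁅(MvPolynomial.pderiv i : Derivation 𝕜 (MvPolynomial σ 𝕜) (MvPolynomial σ 𝕜)),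
      (MvPolynomial.pderiv j : Derivation 𝕜 (MvPolynomial σ 𝕜) (MvPolynomial σ 𝕜))⁆ = 0 := by
    refine MvPolynomial.derivation_ext fun k => ?_
    rw [Derivation.commutator_apply]
    simp only [MvPolynomial.pderiv_X, Pi.single_apply, Derivation.coe_zero, Pi.zero_apply]
    split_ifs <;> simp
  have := congrArg (fun D : Derivation 𝕜 (MvPolynomial σ 𝕜) (MvPolynomial σ 𝕜) => D f) h
  rw [Derivation.commutator_apply] at this
  exact sub_eq_zero.1 this

variable (𝕜 σ) in
/-- The differential operators `∂ / ∂ x_i`. -/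
def pderivSet : Set (Module.End 𝕜 (MvPolynomial σ 𝕜)) :=
  Set.range fun i => (MvPolynomial.pderiv i : Derivation 𝕜 (MvPolynomial σ 𝕜) (MvPolynomial σ 𝕜))

lemma isMulCommutative_adjoin_pderivSet :
    IsMulCommutative (Algebra.adjoin 𝕜 (pderivSet 𝕜 σ)) := by
  refine Algebra.isMulCommutative_adjoin 𝕜 ?_
  rintro _ ⟨i, rfl⟩ _ ⟨j, rfl⟩
  exact LinearMap.ext fun f => pderiv_comm i j f

open scoped IsMulCommutative in
/-- The differential operator `f(∂)` with constant coefficients. -/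
def diffOp : MvPolynomial σ 𝕜 →ₐ[𝕜] Module.End 𝕜 (MvPolynomial σ 𝕜) :=
  haveI := isMulCommutative_adjoin_pderivSet (𝕜 := 𝕜) (σ := σ)
  (Algebra.adjoin 𝕜 (pderivSet 𝕜 σ)).val.comp
    (MvPolynomial.aeval fun i =>
      (⟨_, Algebra.subset_adjoin ⟨i, rfl⟩⟩ : Algebra.adjoin 𝕜 (pderivSet 𝕜 σ)))

lemma diffOp_X (i : σ) (f : MvPolynomial σ 𝕜) :
    diffOp (MvPolynomial.X i) f = MvPolynomial.pderiv i f := by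
  simp [diffOp]

lemma diffOp_mul_apply (f g h : MvPolynomial σ 𝕜) :
    diffOp (f * g) h = diffOp f (diffOp g h) := by
  rw [map_mul]
  rfl

lemma diffOp_C (c : 𝕜) (f : MvPolynomial σ 𝕜) : diffOp (MvPolynomial.C c) f = c • f := by
  rw [← MvPolynomial.algebraMap_eq, AlgHom.commutes]
  rfl

/-- The constant term of a polynomial. -/
def constTerm : Module.Dual 𝕜 (MvPolynomial σ 𝕜) := MvPolynomial.lcoeff 𝕜 0

/-- The commutation rule of the Weyl algebra: commuting with `x_i` differentiates the symbol. -/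
lemma diffOp_mul_X (f g : MvPolynomial σ 𝕜) (i : σ) :
    diffOp f (MvPolynomial.X i * g) =
      MvPolynomial.X i * diffOp f g + diffOp (MvPolynomial.pderiv i f) g := by
  classical
  induction f using MvPolynomial.induction_on generalizing g with
  | C c => simp
  | add p q hp hq => simp only [map_add, LinearMap.add_apply, hp, hq]; ring
  | mul_X p j hp =>
    rw [diffOp_mul_apply, diffOp_X, Derivation.leibniz, MvPolynomial.pderiv_X, map_add,
      smul_eq_mul, hp, diffOp_mul_apply, diffOp_X, Derivation.leibniz, MvPolynomial.pderiv_X,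
      smul_eq_mul, smul_eq_mul, smul_eq_mul, map_add, LinearMap.add_apply, mul_comm _ (MvPolynomial.pderiv i p),
      diffOp_mul_apply _ (MvPolynomial.X j), diffOp_X]
    rw [Pi.single_comm]
    by_cases h : j = i
    · subst h; simp; ring
    · simp [h]

/-- Right action of a multiplication operator on the dual vectors `⟨u| f(∂)`. -/
lemma constTerm_diffOp_mul (f g h : MvPolynomial σ 𝕜) :
    constTerm (diffOp f (g * h)) = constTerm (diffOp (diffOp g f) h) := by
  induction g using MvPolynomial.induction_on generalizing f h with
  | C c =>
    rw [diffOp_C, map_smul, LinearMap.smul_apply, map_smul, MvPolynomial.C_mul', map_smul, map_smul]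
  | add p q hp hq => simp only [add_mul, map_add, LinearMap.add_apply, hp, hq]
  | mul_X p j hp =>
    rw [mul_assoc, hp, diffOp_mul_X, diffOp_mul_apply, diffOp_X, map_add]
    -- `⟨u|` kills the image of a creation operator, so only the derivative of the symbol remains.
    have h1 : constTerm (MvPolynomial.X j * diffOp (diffOp p f) h) = 0 := by
      classical
      simp only [constTerm, MvPolynomial.lcoeff_apply]
      rw [MvPolynomial.coeff_X_mul', if_neg (by simp)]
    have h2 : MvPolynomial.pderiv j (diffOp p f) = diffOp p (MvPolynomial.pderiv j f) := by
      rw [← diffOp_X, ← diffOp_X, ← diffOp_mul_apply, ← diffOp_mul_apply, mul_comm]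
    rw [h1, zero_add, h2]

end DiffOp

/-! ### Exponentials of annihilation operators as translations -/

section Shift

variable {𝕜 : Type*} [Field 𝕜]

/-- The linear combination `∑_i α^{(i)}_n a^{(i)}_{-n}` of creation operators. -/
def lin (α : Fin 2 × ℕ+ → 𝕜) (n : ℕ+) : Fock 𝕜 := ∑ i, α (i, n) • MvPolynomial.X (i, n)

/-- The substitution `a^{(i)}_{-n} ↦ a^{(i)}_{-n} + γ^{(i)}_n y ^ n`. -/
def shift (γ : Fin 2 × ℕ+ → 𝕜) : Fock 𝕜 →ₐ[𝕜] Polynomial (Fock 𝕜) :=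
  MvPolynomial.aeval fun i =>
    Polynomial.C (MvPolynomial.X i) + γ i • Polynomial.X ^ (i.2 : ℕ)

lemma shift_X (γ : Fin 2 × ℕ+ → 𝕜) (i : Fin 2 × ℕ+) :
    shift γ (MvPolynomial.X i) =
      Polynomial.C (MvPolynomial.X i) + γ i • Polynomial.X ^ (i.2 : ℕ) := by
  simp [shift]

lemma shift_lin (γ α : Fin 2 × ℕ+ → 𝕜) (n : ℕ+) :
    shift γ (lin α n) = Polynomial.C (lin α n) +
      (∑ i, γ (i, n) * α (i, n)) • Polynomial.X ^ (n : ℕ) := by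
  simp only [lin, map_sum, map_smul, shift_X, smul_add, Finset.sum_add_distrib, Finset.sum_smul,
    smul_smul]
  congr 1
  · refine Finset.sum_congr rfl fun i _ => ?_
    rw [← Polynomial.smul_C]
  · refine Finset.sum_congr rfl fun i _ => ?_
    rw [mul_comm]

lemma diffOp_lin_mul_X (γ : Fin 2 × ℕ+ → 𝕜) (n : ℕ+) (f : Fock 𝕜) (i : Fin 2 × ℕ+) :
    diffOp (lin γ n) (f * MvPolynomial.X i) = diffOp (lin γ n) f * MvPolynomial.X i +
      if n = i.2 then γ i • f else 0 := by
  classical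
  obtain ⟨i, m⟩ := i
  simp only [lin, map_sum, map_smul, LinearMap.sum_apply, LinearMap.smul_apply, diffOp_X,
    Derivation.leibniz, MvPolynomial.pderiv_X, Finset.sum_mul, smul_add, Finset.sum_add_distrib]
  rw [add_comm]
  congr 1
  · refine Finset.sum_congr rfl fun j _ => ?_
    rw [smul_eq_mul, mul_comm, smul_mul_assoc]
  · simp only [Pi.single_apply, Prod.mk.injEq]
    by_cases h : n = m
    · subst h
      simp
    · simp [h, Ne.symm h]

/-- Chain rule for `y ↦ f(a + γ y^n)`, with `m = n - 1`. Only finitely many modes occur in `f`, so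
all long enough sums agree. -/
lemma exists_derivative_shift (γ : Fin 2 × ℕ+ → 𝕜) (f : Fock 𝕜) :
    ∃ M₀, ∀ M ≥ M₀, Polynomial.derivative (shift γ f) = ∑ m ∈ Finset.range M,
      ((m : Polynomial (Fock 𝕜)) + 1) * Polynomial.X ^ m *
        shift γ (diffOp (lin γ (m + 1).toPNat') f) := by
  induction f using MvPolynomial.induction_on with
  | C c =>
    refine ⟨0, fun M _ => ?_⟩
    have h : ∀ n, diffOp (lin γ n) (MvPolynomial.C c : Fock 𝕜) = 0 := by
      intro n
      simp [lin, diffOp_X]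
    simp only [h, map_zero, mul_zero, Finset.sum_const_zero]
    rw [← MvPolynomial.algebraMap_eq, AlgHom.commutes, IsScalarTower.algebraMap_apply 𝕜 (Fock 𝕜)]
    exact Polynomial.derivative_C
  | add p q hp hq =>
    obtain ⟨A, hA⟩ := hp
    obtain ⟨B, hB⟩ := hq
    refine ⟨max A B, fun M hM => ?_⟩
    simp only [map_add, hA M (le_trans (le_max_left _ _) hM), hB M (le_trans (le_max_right _ _) hM),
      mul_add, Finset.sum_add_distrib]
  | mul_X p i hp =>
    obtain ⟨A, hA⟩ := hp
    refine ⟨max A i.2, fun M hM => ?_⟩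
    have hn : (i.2 : ℕ) - 1 ∈ Finset.range M := by
      have := le_trans (le_max_right A _) hM
      have := i.2.pos
      simp; omega
    have h1 : ∀ m : ℕ, (if (m + 1).toPNat' = i.2 then γ i • p else 0) =
        if m = (i.2 : ℕ) - 1 then γ i • p else 0 := by
      intro m
      have : (m + 1).toPNat' = i.2 ↔ m = (i.2 : ℕ) - 1 := by
        rw [← PNat.coe_inj]
        have := i.2.pos
        have h4 : ((m + 1).toPNat' : ℕ) = m + 1 := rfl
        rw [h4]; omega
      simp only [this]
    have h2 : ∀ m : ℕ, shift γ (if m = (i.2 : ℕ) - 1 then γ i • p else 0) =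
        if m = (i.2 : ℕ) - 1 then γ i • shift γ p else 0 := by
      intro m
      split_ifs <;> simp
    have h3 : (((i.2 : ℕ) - 1 : ℕ) : Polynomial (Fock 𝕜)) + 1 =
        ((i.2 : ℕ) : Polynomial (Fock 𝕜)) := by
      have := i.2.pos
      rw [← Nat.cast_succ]
      congr 1
      omega
    have h4 : Polynomial.derivative (shift γ (MvPolynomial.X i)) =
        γ i • (((i.2 : ℕ) : Polynomial (Fock 𝕜)) * Polynomial.X ^ ((i.2 : ℕ) - 1)) := by
      rw [shift_X, Polynomial.derivative_add, Polynomial.derivative_C, Polynomial.derivative_smul,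
        Polynomial.derivative_X_pow, zero_add]
      simp
    simp only [diffOp_lin_mul_X, h1, map_add, mul_add, Finset.sum_add_distrib, h2, mul_ite, mul_zero]
    rw [Finset.sum_ite_eq', if_pos hn, h3, map_mul, Polynomial.derivative_mul, h4,
      hA M (le_trans (le_max_left _ _) hM), Finset.sum_mul]
    simp only [map_mul, mul_assoc, mul_smul_comm]
    rw [mul_left_comm, mul_comm (shift γ p)]

variable [CharZero 𝕜]

/-- Taylor's formula. Both sides satisfy the recursion in `k` that comes from `d/dy`:
`succ_mul_expC` on the left, `exists_derivative_shift` on the right. -/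
lemma diffOp_expC_lin (γ : Fin 2 × ℕ+ → 𝕜) (k : ℕ) (f : Fock 𝕜) :
    diffOp (expC 𝕜 (lin γ) k) f = (shift γ f).coeff k := by
  induction k using Nat.strong_induction_on generalizing f with
  | _ k ih =>
  cases k with
  | zero =>
    rw [expC_zero, map_one, Module.End.one_apply]
    induction f using MvPolynomial.induction_on with
    | C c =>
      rw [← MvPolynomial.algebraMap_eq, AlgHom.commutes,
        IsScalarTower.algebraMap_apply 𝕜 (Fock 𝕜)]
      exact Polynomial.coeff_C_zero.symm
    | add p q hp hq => rw [map_add, Polynomial.coeff_add, ← hp, ← hq]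
    | mul_X p i hp =>
      rw [map_mul, Polynomial.mul_coeff_zero, ← hp, shift_X]
      simp [Polynomial.coeff_X_pow, i.2.ne_zero.symm]
  | succ k =>
    obtain ⟨M₀, h⟩ := exists_derivative_shift γ f
    -- The sum must reach past `m = k`, so that it contains all the terms of degree at most `k` in
    -- `y`; later ones do not contribute.
    have h1 := congrArg (fun P => Polynomial.coeff P k) (h (max M₀ (k + 1)) (le_max_left _ _))
    simp only [Polynomial.coeff_derivative, Polynomial.finsetSum_coeff] at h1
    have h2 := congrArg (fun T => diffOp T f) (succ_mul_expC (𝕜 := 𝕜) (lin γ) k)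
    simp only [map_sum, LinearMap.sum_apply] at h2
    have h3 : ∑ p ∈ Finset.HasAntidiagonal.antidiagonal k, diffOp (expC 𝕜 (lin γ) p.1 *
        (((p.2 : Fock 𝕜) + 1) * lin γ (p.2 + 1).toPNat')) f =
        (shift γ f).coeff (k + 1) * ((k : Fock 𝕜) + 1) := by
      rw [h1, Finset.Nat.sum_antidiagonal_eq_sum_range_succ_mk, ← Finset.sum_range_reflect]
      symm
      rw [← Finset.sum_subset (s₁ := Finset.range (k + 1))]
      · refine Finset.sum_congr rfl fun m hm => ?_
        have hm' := Finset.mem_range.1 hm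
        have e1 : k + 1 - 1 - m = k - m := by omega
        have e2 : k - (k - m) = m := by omega
        have e3 : ((m : Polynomial (Fock 𝕜)) + 1) = Polynomial.C ((m : Fock 𝕜) + 1) := by simp
        have e4 : ((m : Fock 𝕜) + 1) = MvPolynomial.C ((m : 𝕜) + 1) := by simp
        simp only [e1, e2]
        rw [e3, mul_assoc, Polynomial.coeff_C_mul, Polynomial.coeff_X_pow_mul', if_pos (by omega),
          diffOp_mul_apply, diffOp_mul_apply, e4, diffOp_C, map_smul, ih _ (by omega),
          MvPolynomial.C_mul']
      · intro m hm
        simp at hm ⊢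
        omega
      · intro m _ hm
        have e3 : ((m : Polynomial (Fock 𝕜)) + 1) = Polynomial.C ((m : Fock 𝕜) + 1) := by simp
        rw [e3, mul_assoc, Polynomial.coeff_C_mul, Polynomial.coeff_X_pow_mul', if_neg, mul_zero]
        simpa using hm
    rw [h3] at h2
    have e4 : ((k : Fock 𝕜) + 1) = MvPolynomial.C ((k : 𝕜) + 1) := by simp
    rw [e4, diffOp_mul_apply, diffOp_C, mul_comm, MvPolynomial.C_mul'] at h2
    exact smul_right_injective (Fock 𝕜) (r := (k : 𝕜) + 1)
      (by exact_mod_cast Nat.succ_ne_zero k) h2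

end Shift

/-! ### Exponential coefficients with integer index -/

section ExpZ

variable (𝕜 : Type*) [Field 𝕜] {R : Type*} [CommRing R] [Algebra 𝕜 R]

/-- The coefficient of `z ^ k` in `exp (∑_{n ≥ 1} a_n z ^ n)` for an integer `k`. -/
def expZ (a : ℕ+ → R) (k : ℤ) : R := if 0 ≤ k then expC 𝕜 a k.toNat else 0

variable {𝕜}

lemma expZ_natCast (a : ℕ+ → R) (k : ℕ) : expZ 𝕜 a (k : ℤ) = expC 𝕜 a k := by
  simp [expZ]

lemma expZ_of_neg (a : ℕ+ → R) {k : ℤ} (hk : k < 0) : expZ 𝕜 a k = 0 :=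
  if_neg (by omega)

lemma finite_support_expZ_mul (a b : ℕ+ → R) (N : ℤ) :
    (Function.support fun i : ℤ => expZ 𝕜 a i * expZ 𝕜 b (N - i)).Finite := by
  refine (Set.finite_Icc 0 N).subset fun i hi => ?_
  by_contra h
  apply hi
  simp only [Set.mem_Icc, not_and_or, not_le] at h
  rcases h with h | h
  · simp only [expZ_of_neg a h, zero_mul]
  · simp only [expZ_of_neg b (show N - i < 0 by omega), mul_zero]

lemma expZ_add [CharZero 𝕜] (a b : ℕ+ → R) (N : ℤ) :
    expZ 𝕜 (a + b) N = ∑ᶠ i : ℤ, expZ 𝕜 a i * expZ 𝕜 b (N - i) := by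
  rcases lt_or_ge N 0 with h | h
  · rw [expZ_of_neg _ h, ← finsum_zero (α := ℤ)]
    refine finsum_congr fun i => ?_
    rcases lt_or_ge i 0 with h' | h'
    · rw [expZ_of_neg _ h', zero_mul]
    · rw [expZ_of_neg b (show N - i < 0 by omega), mul_zero]
  · obtain ⟨N, rfl⟩ := Int.eq_ofNat_of_zero_le h
    have hs : (Function.support fun i : ℤ => expZ 𝕜 a i * expZ 𝕜 b (N - i)) ⊆
        ((Finset.range (N + 1)).image (Nat.cast : ℕ → ℤ) : Finset ℤ) := by
      intro i hi
      simp only [Finset.coe_image, Set.mem_image, Finset.coe_range, Set.mem_Iio]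
      by_contra hc
      apply hi
      rcases lt_or_ge i 0 with h' | h'
      · simp only [expZ_of_neg a h', zero_mul]
      · rcases le_or_gt i N with h2 | h2
        · exact absurd ⟨i.toNat, by omega, by omega⟩ hc
        · simp only [expZ_of_neg b (show (N : ℤ) - i < 0 by omega), mul_zero]
    rw [expZ_natCast, expC_add, Finset.Nat.sum_antidiagonal_eq_sum_range_succ_mk,
      finsum_eq_finsetSum_of_support_subset _ hs, Finset.sum_image (by simp)]
    refine Finset.sum_congr rfl fun i hi => ?_
    have : ((N : ℤ) - i) = ((N - i : ℕ) : ℤ) := by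
      have := Finset.mem_range.1 hi
      omega
    rw [this, expZ_natCast, expZ_natCast]

lemma expZ_pow_smul (r : 𝕜) (a : ℕ+ → R) (k : ℤ) :
    expZ 𝕜 (fun n : ℕ+ => r ^ (n : ℕ) • a n) k = r ^ k • expZ 𝕜 a k := by
  rcases lt_or_ge k 0 with h | h
  · rw [expZ_of_neg _ h, expZ_of_neg _ h, smul_zero]
  · obtain ⟨k, rfl⟩ := Int.eq_ofNat_of_zero_le h
    simp only [Algebra.smul_def, expZ_natCast]
    have := expC_pow_mul (𝕜 := 𝕜) (algebraMap 𝕜 R r) a k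
    simpa using this

end ExpZ

/-! ### Modes of vertex operators -/

section VertexMode

variable {𝕜 : Type*} [Field 𝕜]

/-- Reduces operator exponentials to commutative ones: creation operators lie in the image of
`Algebra.lmul`, annihilation operators in that of `diffOp`. -/
lemma expCoeff_algHom {R : Type*} [CommRing R] [Algebra 𝕜 R] (φ : R →ₐ[𝕜] Op 𝕜) (a : ℕ+ → R)
    (k : ℕ) : expCoeff (fun n => φ (a n)) k = φ (expC 𝕜 a k) := by
  simp only [expC, map_sum, map_smul, map_list_prod, List.map_map]
  rfl

/-- The linear functional `y ^ j ↦ h_{j - n}`, where `∑ h_k z ^ k = exp (∑ a_n z ^ n)`. -/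
def modeOf (a : ℕ+ → Fock 𝕜) (n : ℤ) : Polynomial (Fock 𝕜) →ₗ[𝕜] Fock 𝕜 :=
  Polynomial.lsum fun j => LinearMap.mulLeft 𝕜 (expZ 𝕜 a (j - n))

lemma modeOf_eq_sum_range (a : ℕ+ → Fock 𝕜) (n : ℤ) (P : Polynomial (Fock 𝕜)) {J : ℕ}
    (hJ : P.natDegree < J) :
    modeOf a n P = ∑ j ∈ Finset.range J, expZ 𝕜 a (j - n) * P.coeff j :=
  Polynomial.sum_over_range' P (by simp) _ hJ

/-- The polynomial variable plays the role of `z⁻¹`, hence the drop of the mode index by `l`. -/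
lemma modeOf_X_pow_mul_C_mul (a : ℕ+ → Fock 𝕜) (n : ℤ) (l : ℕ) (h : Fock 𝕜)
    (P : Polynomial (Fock 𝕜)) :
    modeOf a n (Polynomial.X ^ l * Polynomial.C h * P) = h * modeOf a (n - l) P := by
  induction P using Polynomial.induction_on' with
  | add p q hp hq => rw [mul_add, map_add, hp, hq, map_add, mul_add]
  | monomial e c =>
    have : Polynomial.X ^ l * Polynomial.C h * Polynomial.monomial e c =
        Polynomial.monomial (e + l) (h * c) := by
      rw [mul_assoc, Polynomial.C_mul_monomial, mul_comm, Polynomial.monomial_mul_X_pow]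
    rw [this]
    have hm : ∀ (n : ℤ) (j : ℕ) (c : Fock 𝕜), modeOf a n (Polynomial.monomial j c) =
        expZ 𝕜 a (j - n) * c := fun n j c => Polynomial.sum_monomial_index _ _ (by simp)
    rw [hm, hm]
    have : (((e + l : ℕ) : ℤ) - n) = (e - (n - l)) := by push_cast; ring
    rw [this]
    ring

/-- The modes of the vertex operator
`exp (∑ α^{(i)}_n z ^ n a^{(i)}_{-n}) exp (∑ γ^{(i)}_n z ^ (-n) ∂ / ∂ a^{(i)}_{-n})`. -/
def vertexMode (α γ : Fin 2 × ℕ+ → 𝕜) (n : ℤ) : Op 𝕜 :=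
  modeOf (lin α) n ∘ₗ (shift γ).toLinearMap

lemma vertexMode_apply (α γ : Fin 2 × ℕ+ → 𝕜) (n : ℤ) (v : Fock 𝕜) :
    vertexMode α γ n v = modeOf (lin α) n (shift γ v) := rfl

/-- The family `c ^ n α^{(i)}_n`. -/
def grade (c : 𝕜) (α : Fin 2 × ℕ+ → 𝕜) : Fin 2 × ℕ+ → 𝕜 := fun i => c ^ (i.2 : ℕ) * α i

lemma lin_grade (c : 𝕜) (α : Fin 2 × ℕ+ → 𝕜) :
    lin (grade c α) = fun n : ℕ+ => c ^ (n : ℕ) • lin α n := by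
  ext1 n
  simp only [lin, grade, Finset.smul_sum, smul_smul]

lemma lin_add (α β : Fin 2 × ℕ+ → 𝕜) : lin (α + β) = lin α + lin β := by
  ext1 n
  simp only [lin, Pi.add_apply, add_smul, Finset.sum_add_distrib]

lemma coeff_shift_grade (c : 𝕜) (γ : Fin 2 × ℕ+ → 𝕜) (f : Fock 𝕜) (j : ℕ) :
    (shift (grade c γ) f).coeff j = c ^ j • (shift γ f).coeff j := by
  induction f using MvPolynomial.induction_on generalizing j with
  | C a =>
    rw [← MvPolynomial.algebraMap_eq, AlgHom.commutes, AlgHom.commutes,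
        IsScalarTower.algebraMap_apply 𝕜 (Fock 𝕜), Polynomial.algebraMap_eq, Polynomial.coeff_C]
    split_ifs with h <;> simp [h]
  | add p q hp hq => simp only [map_add, Polynomial.coeff_add, hp, hq, smul_add]
  | mul_X p i hp =>
    simp only [map_mul, shift_X, mul_add, Polynomial.coeff_add, Polynomial.coeff_mul_C,
      mul_smul_comm, Polynomial.coeff_smul, Polynomial.coeff_mul_X_pow', hp, smul_add,
      smul_mul_assoc, grade]
    congr 1
    split_ifs with h
    · rw [smul_smul, smul_smul, mul_right_comm, ← pow_add, Nat.add_sub_cancel' h]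
    · simp

/-- A term with `z^(j-n)` from creation and `z^(-j)` from annihilation acquires `r^(j-n) r^(-j) =
r^(-n)`. -/
lemma rescale_vertexMode {r : 𝕜} (hr : r ≠ 0) (α γ : Fin 2 × ℕ+ → 𝕜) :
    rescale r (vertexMode α γ) = vertexMode (grade r α) (grade r⁻¹ γ) := by
  funext n
  refine LinearMap.ext fun v => ?_
  set J := max (shift γ v).natDegree (shift (grade r⁻¹ γ) v).natDegree + 1
  rw [rescale, LinearMap.smul_apply, vertexMode_apply, vertexMode_apply,
    modeOf_eq_sum_range _ _ _ (J := J) (Nat.lt_succ_of_le (le_max_left _ _)),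
    modeOf_eq_sum_range _ _ _ (J := J) (Nat.lt_succ_of_le (le_max_right _ _)), Finset.smul_sum]
  refine Finset.sum_congr rfl fun j _ => ?_
  rw [coeff_shift_grade, lin_grade, expZ_pow_smul, smul_mul_smul_comm]
  congr 1
  rw [zpow_sub₀ hr, zpow_natCast, zpow_neg, inv_pow]
  have := pow_ne_zero j hr
  field_simp

lemma locSum_apply {ι : Type*} {T : ι → Op 𝕜}
    (h : ∀ v, (Function.support fun k => T k v).Finite) (v : Fock 𝕜) :
    locSum T v = ∑ᶠ k, T k v := by
  rw [locSum, dif_pos h]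
  rfl

lemma expPos_mulLeft (a : ℕ+ → Fock 𝕜) (n : ℤ) :
    expPos (fun n => LinearMap.mulLeft 𝕜 (a n)) n = LinearMap.mulLeft 𝕜 (expZ 𝕜 a (-n)) := by
  rw [expPos, expZ]
  split_ifs with h h' h'
  · exact expCoeff_algHom (Algebra.lmul 𝕜 (Fock 𝕜)) a _
  · omega
  · omega
  · exact LinearMap.ext fun v => by simp

variable [CharZero 𝕜]

lemma expNeg_diffOp (γ : Fin 2 × ℕ+ → 𝕜) (n : ℤ) (v : Fock 𝕜) :
    expNeg (fun n => diffOp (lin γ n)) n v = if 0 ≤ n then (shift γ v).coeff n.toNat else 0 := by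
  rw [expNeg]
  split_ifs with h
  · rw [← diffOp_expC_lin, ← expCoeff_algHom]
  · rfl

lemma finsum_int_eq_sum_range {M : Type*} [AddCommMonoid M] (F : ℤ → M) (J : ℕ)
    (h1 : ∀ i < 0, F i = 0) (h2 : ∀ j : ℕ, J ≤ j → F j = 0) :
    (Function.support F).Finite ∧ ∑ᶠ i, F i = ∑ j ∈ Finset.range J, F j := by
  have hs : Function.support F ⊆ ((Finset.range J).image (Nat.cast : ℕ → ℤ) : Finset ℤ) := by
    intro i hi
    rcases lt_or_ge i 0 with h | h
    · exact absurd (h1 i h) hi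
    · obtain ⟨i, rfl⟩ := Int.eq_ofNat_of_zero_le h
      rcases lt_or_ge i J with h' | h'
      · simpa using h'
      · exact absurd (h2 i h') hi
  refine ⟨(Finset.finite_toSet _).subset hs, ?_⟩
  rw [finsum_eq_finsetSum_of_support_subset _ hs, Finset.sum_image (by simp)]

/-- The sum over modes is finite on each vector because `shift γ v` is a polynomial in `z⁻¹`. -/
lemma mulModes_expPos_expNeg (α γ : Fin 2 × ℕ+ → 𝕜) :
    mulModes (expPos fun n => LinearMap.mulLeft 𝕜 (lin α n)) (expNeg fun n => diffOp (lin γ n)) =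
      vertexMode α γ := by
  funext n
  have key : ∀ v : Fock 𝕜, (Function.support fun k : ℤ =>
      (expPos (fun n => LinearMap.mulLeft 𝕜 (lin α n)) k *
        expNeg (fun n => diffOp (lin γ n)) (n - k)) v).Finite ∧
      ∑ᶠ k : ℤ, (expPos (fun n => LinearMap.mulLeft 𝕜 (lin α n)) k *
        expNeg (fun n => diffOp (lin γ n)) (n - k)) v = vertexMode α γ n v := by
    intro v
    have h := finsum_int_eq_sum_range (fun j : ℤ => expZ 𝕜 (lin α) (j - n) *
      if 0 ≤ j then (shift γ v).coeff j.toNat else 0) ((shift γ v).natDegree + 1)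
      (fun i hi => by simp [not_le.2 hi])
      (fun j hj => by simp [Polynomial.coeff_eq_zero_of_natDegree_lt (Nat.lt_of_succ_le hj)])
    have e : (fun k : ℤ => (expPos (fun n => LinearMap.mulLeft 𝕜 (lin α n)) k *
        expNeg (fun n => diffOp (lin γ n)) (n - k)) v) =
        (fun j : ℤ => expZ 𝕜 (lin α) (j - n) *
          if 0 ≤ j then (shift γ v).coeff j.toNat else 0) ∘ (Equiv.subLeft n) := by
      funext k
      rw [Module.End.mul_apply, expNeg_diffOp, expPos_mulLeft]
      simp
    rw [e]
    refine ⟨h.1.preimage (Equiv.injective _).injOn, ?_⟩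
    rw [vertexMode_apply, modeOf_eq_sum_range _ _ _ (Nat.lt_succ_self _)]
    refine (finsum_comp_equiv (Equiv.subLeft n)).trans (h.2.trans ?_)
    simp
  refine LinearMap.ext fun v => ?_
  rw [mulModes, locSum_apply fun v => (key v).1]
  exact (key v).2

/-- Additivity of the exponential inside a mode. It gives both the product with `φ^{(1)}` and the
merging of creation parts in normal ordering. -/
lemma finite_support_expZ_mul_vertexMode (a : ℕ+ → Fock 𝕜) (α γ : Fin 2 × ℕ+ → 𝕜) (n : ℤ)
    (v : Fock 𝕜) :
    (Function.support fun k : ℤ => expZ 𝕜 a k * vertexMode α γ (n + k) v).Finite ∧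
    ∑ᶠ k : ℤ, expZ 𝕜 a k * vertexMode α γ (n + k) v = modeOf (a + lin α) n (shift γ v) := by
  have e : (fun k : ℤ => expZ 𝕜 a k * vertexMode α γ (n + k) v) =
      fun k => ∑ j ∈ Finset.range ((shift γ v).natDegree + 1),
        (expZ 𝕜 a k * expZ 𝕜 (lin α) ((j - n) - k)) * (shift γ v).coeff j := by
    funext k
    rw [vertexMode_apply, modeOf_eq_sum_range _ _ _ (Nat.lt_succ_self _), Finset.mul_sum]
    refine Finset.sum_congr rfl fun j _ => ?_
    rw [mul_assoc, sub_sub]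
  have hf : ∀ j ∈ Finset.range ((shift γ v).natDegree + 1), (Function.support fun k : ℤ =>
      (expZ 𝕜 a k * expZ 𝕜 (lin α) ((j - n) - k)) * (shift γ v).coeff j).Finite :=
    fun j _ => (finite_support_expZ_mul a (lin α) (j - n)).subset
      (Function.support_mul_subset_left _ _)
  rw [e]
  constructor
  · refine (Set.Finite.biUnion (Finset.finite_toSet (Finset.range _)) hf).subset ?_
    intro k hk
    obtain ⟨j, hj, h⟩ := Finset.exists_ne_zero_of_sum_ne_zero hk
    exact Set.mem_biUnion hj h
  · rw [finsum_sum_comm _ _ hf, modeOf_eq_sum_range _ _ _ (Nat.lt_succ_self _)]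
    refine Finset.sum_congr rfl fun j _ => ?_
    rw [expZ_add, finsum_mul]

lemma mulModes_expPos_vertexMode (β α γ : Fin 2 × ℕ+ → 𝕜) :
    mulModes (expPos fun n => LinearMap.mulLeft 𝕜 (lin β n)) (vertexMode α γ) =
      vertexMode (β + α) γ := by
  funext n
  have key : ∀ v : Fock 𝕜, (Function.support fun k : ℤ =>
      (expPos (fun n => LinearMap.mulLeft 𝕜 (lin β n)) k * vertexMode α γ (n - k)) v).Finite ∧
      ∑ᶠ k : ℤ, (expPos (fun n => LinearMap.mulLeft 𝕜 (lin β n)) k *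
        vertexMode α γ (n - k)) v = vertexMode (β + α) γ n v := by
    intro v
    have h := finite_support_expZ_mul_vertexMode (lin β) α γ n v
    have e : (fun k : ℤ => (expPos (fun n => LinearMap.mulLeft 𝕜 (lin β n)) k *
        vertexMode α γ (n - k)) v) =
        (fun k : ℤ => expZ 𝕜 (lin β) k * vertexMode α γ (n + k) v) ∘ (Equiv.neg ℤ) := by
      funext k
      rw [Module.End.mul_apply, expPos_mulLeft]
      simp [sub_eq_add_neg]
    rw [e]
    refine ⟨h.1.preimage (Equiv.injective _).injOn, ?_⟩
    refine (finsum_comp_equiv (Equiv.neg ℤ)).trans (h.2.trans ?_)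
    rw [vertexMode_apply, lin_add]
  refine LinearMap.ext fun v => ?_
  rw [mulModes, locSum_apply fun v => (key v).1]
  exact (key v).2

end VertexMode

/-! ### Values of rational functions given by Laurent expansions -/

section RationalValue

variable {𝕜 : Type*} [Field 𝕜]

lemma IsRationalValue.add {c d : ℤ → 𝕜} {x y z : 𝕜} (hc : IsRationalValue c x y)
    (hd : IsRationalValue d x z) : IsRationalValue (fun k => c k + d k) x (y + z) := by
  obtain ⟨r, hr, hr0, hry⟩ := hc
  obtain ⟨s, hs, hs0, hsz⟩ := hd
  refine ⟨r + s, fun k => by rw [map_add, HahnSeries.coeff_add, hr, hs], fun h => ?_, ?_⟩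
  · have := Polynomial.eval_eq_zero_of_dvd_of_eval_eq_zero (RatFunc.denom_add_dvd r s) h
    rw [Polynomial.eval_mul] at this
    exact (mul_ne_zero hr0 hs0) this
  · rw [RatFunc.eval_add _ _ hr0 hs0, hry, hsz]

/-- The fraction need not be reduced: the reduced denominator divides `Q`, so it is also nonzero at
`x`. -/
lemma isRationalValue_div {c : ℤ → 𝕜} {x : 𝕜} {P Q : Polynomial 𝕜} (hQ : Q.eval x ≠ 0)
    (hc : ∀ k, (algebraMap (RatFunc 𝕜) (LaurentSeries 𝕜)
      (algebraMap _ _ P / algebraMap _ _ Q)).coeff k = c k) :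
    IsRationalValue c x (P.eval x / Q.eval x) := by
  have hQ0 : Q ≠ 0 := by rintro rfl; simp at hQ
  have hd : (algebraMap (Polynomial 𝕜) (RatFunc 𝕜) P / algebraMap _ _ Q).denom.eval x ≠ 0 :=
    fun h => hQ (Polynomial.eval_eq_zero_of_dvd_of_eval_eq_zero (RatFunc.denom_div_dvd P Q) h)
  refine ⟨_, hc, hd, ?_⟩
  have h := congrArg (Polynomial.eval x) ((RatFunc.num_mul_eq_mul_denom_iff hQ0
    (x := algebraMap (Polynomial 𝕜) (RatFunc 𝕜) P / algebraMap _ _ Q)).2 rfl)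
  rw [Polynomial.eval_mul, Polynomial.eval_mul] at h
  rw [RatFunc.eval, Polynomial.eval₂_id, Polynomial.eval₂_id, div_eq_div_iff hd hQ, h]

lemma algebraMap_laurentSeries (P : Polynomial 𝕜) :
    algebraMap (Polynomial 𝕜) (LaurentSeries 𝕜) P =
      HahnSeries.ofPowerSeries ℤ 𝕜 (P : PowerSeries 𝕜) := by
  rw [IsScalarTower.algebraMap_apply (Polynomial 𝕜) (RatFunc 𝕜)]
  exact (RatFunc.coe_coe P).symm

lemma isRationalValue_zero (x : 𝕜) : IsRationalValue (fun _ => (0 : 𝕜)) x 0 :=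
  ⟨0, by simp, by simp, by simp⟩

lemma IsRationalValue.const_mul {c : ℤ → 𝕜} {x y : 𝕜} (a : 𝕜) (hc : IsRationalValue c x y) :
    IsRationalValue (fun k => a * c k) x (a * y) := by
  obtain ⟨r, hr, hr0, hry⟩ := hc
  have e : algebraMap (Polynomial 𝕜) (RatFunc 𝕜) (Polynomial.C a * r.num) /
      algebraMap _ _ r.denom = algebraMap _ _ (Polynomial.C a) * r := by
    conv_rhs => rw [← RatFunc.num_div_denom r]
    rw [map_mul, mul_div_assoc]
  have h := isRationalValue_div (c := fun k => a * c k) (P := Polynomial.C a * r.num)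
    (Q := r.denom) (x := x) hr0 fun k => by
      rw [e, map_mul, ← IsScalarTower.algebraMap_apply (Polynomial 𝕜) (RatFunc 𝕜)]
      have : algebraMap (Polynomial 𝕜) (LaurentSeries 𝕜) (Polynomial.C a) = HahnSeries.C a := by
        rw [algebraMap_laurentSeries, Polynomial.coe_C, PowerSeries.coe_C]
      rw [this, HahnSeries.C_mul_eq_smul, HahnSeries.coeff_smul, hr, smul_eq_mul]
  rwa [Polynomial.eval_mul, Polynomial.eval_C, mul_div_assoc, ← Polynomial.eval₂_id (p := r.num),
    ← Polynomial.eval₂_id (p := r.denom), ← RatFunc.eval, hry] at h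

lemma IsRationalValue.sum {ι : Type*} (s : Finset ι) {c : ι → ℤ → 𝕜} {x : 𝕜} {y : ι → 𝕜}
    (h : ∀ i ∈ s, IsRationalValue (c i) x (y i)) :
    IsRationalValue (fun k => ∑ i ∈ s, c i k) x (∑ i ∈ s, y i) := by
  classical
  induction s using Finset.induction_on with
  | empty => simpa using isRationalValue_zero x
  | insert i s hi ih =>
    simp only [Finset.sum_insert hi]
    exact (h i (Finset.mem_insert_self _ _)).add
      (ih fun j hj => h j (Finset.mem_insert_of_mem hj))

/-- A rational function is determined by its Laurent expansion. -/
lemma IsRationalValue.unique {c : ℤ → 𝕜} {x y z : 𝕜} (h : IsRationalValue c x y)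
    (h' : IsRationalValue c x z) : y = z := by
  obtain ⟨r, hr, -, rfl⟩ := h
  obtain ⟨s, hs, -, rfl⟩ := h'
  have : r = s := (algebraMap (RatFunc 𝕜) (LaurentSeries 𝕜)).injective
    (HahnSeries.ext (funext fun k => (hr k).trans (hs k).symm))
  rw [this]

/-- The series is that of `x^i A / B`; for negative `i` the power goes into the denominator, which
is harmless since `x ≠ 0`. -/
lemma isRationalValue_expZ {g : ℕ+ → 𝕜} {A B : Polynomial 𝕜}
    (hAB : expSeries 𝕜 g * (B : PowerSeries 𝕜) = A) {x : 𝕜} (hx : x ≠ 0) (hB : B.eval x ≠ 0)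
    (i : ℤ) :
    IsRationalValue (fun k => expZ 𝕜 g (k - i)) x (A.eval x / B.eval x * x ^ i) := by
  have hB0 : B ≠ 0 := by rintro rfl; simp at hB
  have hv : A.eval x / B.eval x * x ^ i = (A * Polynomial.X ^ i.toNat).eval x /
      (B * Polynomial.X ^ (-i).toNat).eval x := by
    rw [Polynomial.eval_mul, Polynomial.eval_mul, Polynomial.eval_pow, Polynomial.eval_pow,
      Polynomial.eval_X, mul_div_mul_comm]
    congr 1
    rw [← zpow_natCast, ← zpow_natCast, ← zpow_sub₀ hx]
    congr 1
    omega
  rw [hv]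
  apply isRationalValue_div
  · rw [Polynomial.eval_mul, Polynomial.eval_pow, Polynomial.eval_X]
    exact mul_ne_zero hB (pow_ne_zero _ hx)
  · have e : algebraMap (RatFunc 𝕜) (LaurentSeries 𝕜)
        (algebraMap _ _ (A * Polynomial.X ^ i.toNat) /
          algebraMap _ _ (B * Polynomial.X ^ (-i).toNat)) =
        HahnSeries.ofPowerSeries ℤ 𝕜 (expSeries 𝕜 g) * HahnSeries.single i 1 := by
      have hne : algebraMap (Polynomial 𝕜) (LaurentSeries 𝕜) (B * Polynomial.X ^ (-i).toNat) ≠ 0 := by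
        rw [Ne, FaithfulSMul.algebraMap_eq_zero_iff]
        exact mul_ne_zero hB0 (pow_ne_zero _ Polynomial.X_ne_zero)
      rw [RatFunc.algebraMap_apply_div, div_eq_iff hne, algebraMap_laurentSeries,
        algebraMap_laurentSeries]
      push_cast
      rw [← hAB]
      simp only [map_mul, HahnSeries.ofPowerSeries_X]
      rw [← RatFunc.single_one_eq_pow, ← RatFunc.single_one_eq_pow]
      have : (HahnSeries.single i (1 : 𝕜)) * HahnSeries.single (((-i).toNat : ℕ) : ℤ) 1 =
          HahnSeries.single ((i.toNat : ℕ) : ℤ) 1 := by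
        rw [HahnSeries.single_mul_single, one_mul,
          show i + (((-i).toNat : ℕ) : ℤ) = ((i.toNat : ℕ) : ℤ) by omega]
      rw [← this]
      ring
    intro k
    rw [e, HahnSeries.coeff_mul_single, mul_one, expZ, PowerSeries.coeff_coe]
    rcases lt_or_ge (k - i) 0 with h | h
    · rw [if_pos h, if_neg (not_le.2 h)]
    · rw [if_neg (not_lt.2 h), if_pos h, expSeries, PowerSeries.coeff_mk]
      congr 1
      omega

/-- `ν` is a Laurent polynomial, so the product with it is a finite combination of shifts of `A /
B`. -/
lemma isRationalValue_conv_expZ {g : ℕ+ → 𝕜} {A B : Polynomial 𝕜}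
    (hAB : expSeries 𝕜 g * (B : PowerSeries 𝕜) = A) {x : 𝕜} (hx : x ≠ 0) (hB : B.eval x ≠ 0)
    {ν : ℤ → 𝕜} (hν : (Function.support ν).Finite) :
    IsRationalValue (fun k => ∑ᶠ l, expZ 𝕜 g l * ν (k - l)) x
      (A.eval x / B.eval x * ∑ᶠ k, ν k * x ^ k) := by
  have h1 : ∀ k, ∑ᶠ l, expZ 𝕜 g l * ν (k - l) = ∑ i ∈ hν.toFinset, ν i * expZ 𝕜 g (k - i) := by
    intro k
    rw [← finsum_comp_equiv (Equiv.subLeft k)]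
    rw [← finsum_eq_finsetSum_of_support_subset (s := hν.toFinset)]
    · refine finsum_congr fun i => ?_
      simp [mul_comm]
    · simp
  have h2 : ∑ᶠ k, ν k * x ^ k = ∑ i ∈ hν.toFinset, ν i * x ^ i :=
    finsum_eq_finsetSum_of_support_subset _ (by simp)
  simp only [h1, h2, Finset.mul_sum]
  refine IsRationalValue.sum _ fun i _ => ?_
  rw [mul_left_comm]
  exact (isRationalValue_expZ hAB hx hB i).const_mul _

lemma IsShiftedProductMode.add_left {p : 𝕜} {V V' W : ℤ → Op 𝕜} {n : ℤ} {L L' : Op 𝕜}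
    (h : IsShiftedProductMode p V W n L) (h' : IsShiftedProductMode p V' W n L') :
    IsShiftedProductMode p (V + V') W n (L + L') := fun v m => by
  simpa using (h v m).add (h' v m)

lemma IsShiftedProductMode.add_right {p : 𝕜} {V W W' : ℤ → Op 𝕜} {n : ℤ} {L L' : Op 𝕜}
    (h : IsShiftedProductMode p V W n L) (h' : IsShiftedProductMode p V W' n L') :
    IsShiftedProductMode p V (W + W') n (L + L') := fun v m => by
  simpa using (h v m).add (h' v m)

lemma IsShiftedProductMode.smul_smul {p : 𝕜} {V W : ℤ → Op 𝕜} {n : ℤ} {L : Op 𝕜}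
    (h : IsShiftedProductMode p V W n L) (a b : 𝕜) :
    IsShiftedProductMode p (a • V) (b • W) n ((a * b) • L) := fun v m => by
  have := ((h v m).const_mul b).const_mul a
  simpa [mul_assoc, mul_left_comm] using this

lemma IsShiftedProductMode.eq {p : 𝕜} {V W : ℤ → Op 𝕜} {n : ℤ} {L L' : Op 𝕜}
    (h : IsShiftedProductMode p V W n L) (h' : IsShiftedProductMode p V W n L') : L = L' :=
  LinearMap.ext fun v => MvPolynomial.ext _ _ fun m => (h v m).unique (h' v m)

/-- By uniqueness of rational values, exhibiting one candidate determines the chosen mode. -/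
lemma IsShiftedProductMode.shiftedProduct_eq {p : 𝕜} {V W : ℤ → Op 𝕜} {n : ℤ} {L : Op 𝕜}
    (h : IsShiftedProductMode p V W n L) : shiftedProduct p V W n = L := by
  have hL : ∃ L, IsShiftedProductMode p V W n L := ⟨L, h⟩
  rw [shiftedProduct, dif_pos hL]
  exact hL.choose_spec.eq h

end RationalValue

/-! ### Wick's rule and evaluation at `w = p z` -/

section NormalOrdering

variable {𝕜 : Type*} [Field 𝕜] [CharZero 𝕜]

/-- The exponents of the contraction of two vertex operators. -/
def contraction (γ α : Fin 2 × ℕ+ → 𝕜) (n : ℕ+) : 𝕜 := ∑ i, γ (i, n) * α (i, n)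

/-- Translating a linear form adds a scalar multiple of `y^n`; exponentiated, this is the
contraction factor times the original exponential. -/
lemma shift_expC_lin (γ α : Fin 2 × ℕ+ → 𝕜) (r : ℕ) :
    shift γ (expC 𝕜 (lin α) r) = ∑ p ∈ Finset.HasAntidiagonal.antidiagonal r,
      Polynomial.X ^ p.1 * Polynomial.C (expC 𝕜 (contraction γ α) p.1 • expC 𝕜 (lin α) p.2) := by
  have h1 : (fun n : ℕ+ => shift γ (lin α n)) =
      (fun n : ℕ+ => (Polynomial.X : Polynomial (Fock 𝕜)) ^ (n : ℕ) *
        algebraMap 𝕜 (Polynomial (Fock 𝕜)) (contraction γ α n)) +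
      fun n => Polynomial.CAlgHom (R := 𝕜) (lin α n) := by
    funext n
    rw [shift_lin, Pi.add_apply, add_comm, Algebra.smul_def, mul_comm]
    rfl
  rw [map_expC, h1, expC_add]
  refine Finset.sum_congr rfl fun p _ => ?_
  rw [expC_pow_mul, ← map_expC, mul_assoc]
  congr 1
  have h2 := map_expC (𝕜 := 𝕜) (Algebra.ofId 𝕜 (Polynomial (Fock 𝕜))) (contraction γ α) p.1
  rw [show (fun n => algebraMap 𝕜 (Polynomial (Fock 𝕜)) (contraction γ α n)) =
    fun n => Algebra.ofId 𝕜 (Polynomial (Fock 𝕜)) (contraction γ α n) from rfl, ← h2]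
  rw [Algebra.ofId_apply, ← Algebra.smul_def, ← Polynomial.smul_C]
  rfl

/-- Moving the creation exponential of the right factor to the left of the vertex operator costs
exactly the contraction. -/
lemma vertexMode_expZ_mul (α γ β : Fin 2 × ℕ+ → 𝕜) (k r : ℤ) (u : Fock 𝕜) :
    (Function.support fun l : ℤ => expZ 𝕜 (contraction γ β) l •
      (expZ 𝕜 (lin β) (r - l) * vertexMode α γ (k - l) u)).Finite ∧
    vertexMode α γ k (expZ 𝕜 (lin β) r * u) =
      ∑ᶠ l : ℤ, expZ 𝕜 (contraction γ β) l •
        (expZ 𝕜 (lin β) (r - l) * vertexMode α γ (k - l) u) := by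
  have h := finsum_int_eq_sum_range (fun l : ℤ => expZ 𝕜 (contraction γ β) l •
    (expZ 𝕜 (lin β) (r - l) * vertexMode α γ (k - l) u)) (r.toNat + 1)
    (fun i hi => by simp [expZ_of_neg _ hi])
    (fun j hj => by simp [expZ_of_neg _ (show r - (j : ℤ) < 0 by omega)])
  refine ⟨h.1, ?_⟩
  rw [h.2]
  rcases lt_or_ge r 0 with hr | hr
  · rw [expZ_of_neg _ hr, zero_mul, map_zero, Finset.sum_eq_zero]
    intro j _
    rw [expZ_of_neg (lin β) (by omega), zero_mul, smul_zero]
  · obtain ⟨r, rfl⟩ := Int.eq_ofNat_of_zero_le hr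
    rw [expZ_natCast, vertexMode_apply, map_mul, shift_expC_lin, Finset.sum_mul, map_sum,
      Finset.Nat.sum_antidiagonal_eq_sum_range_succ_mk, Int.toNat_natCast]
    refine Finset.sum_congr rfl fun l hl => ?_
    have hl' := Finset.mem_range.1 hl
    rw [modeOf_X_pow_mul_C_mul, expZ_natCast, smul_mul_assoc, vertexMode_apply]
    have : ((r : ℤ) - l) = ((r - l : ℕ) : ℤ) := by omega
    rw [this, expZ_natCast]

omit [CharZero 𝕜] in
-- Two translations along the same `y` compose to the translation by the sum. It is stated on
-- coefficients since the first one produces a polynomial in `y`.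
lemma sum_X_pow_mul_shift (γ γ' : Fin 2 × ℕ+ → 𝕜) (v : Fock 𝕜) {J : ℕ}
    (hJ : (shift γ' v).natDegree < J) :
    ∑ j ∈ Finset.range J, Polynomial.X ^ j * shift γ ((shift γ' v).coeff j) =
      shift (γ + γ') v := by
  have h : ∀ P : Polynomial (Fock 𝕜), P.natDegree < J →
      P.eval₂ (shift γ).toRingHom Polynomial.X =
        ∑ j ∈ Finset.range J, Polynomial.X ^ j * shift γ (P.coeff j) := by
    intro P hP
    rw [Polynomial.eval₂_eq_sum_range' _ hP]
    exact Finset.sum_congr rfl fun j _ => mul_comm _ _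
  rw [← h _ hJ]
  clear h hJ
  induction v using MvPolynomial.induction_on with
  | C c =>
    rw [← MvPolynomial.algebraMap_eq, AlgHom.commutes, AlgHom.commutes,
      IsScalarTower.algebraMap_apply 𝕜 (Fock 𝕜), Polynomial.algebraMap_eq, Polynomial.eval₂_C]
    exact (shift γ).commutes c
  | add p q hp hq => rw [map_add, Polynomial.eval₂_add, hp, hq, map_add]
  | mul_X p i hp =>
    rw [map_mul, Polynomial.eval₂_mul, hp, map_mul, shift_X, shift_X, Polynomial.eval₂_add,
      Polynomial.eval₂_C, Algebra.smul_def, Polynomial.eval₂_mul, Polynomial.eval₂_pow,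
      Polynomial.eval₂_X, IsScalarTower.algebraMap_apply 𝕜 (Fock 𝕜), Polynomial.algebraMap_eq,
      Polynomial.eval₂_C]
    congr 1
    have h1 : (shift γ).toRingHom (MvPolynomial.X i) = _ := shift_X γ i
    have h2 : (shift γ).toRingHom (algebraMap 𝕜 (Fock 𝕜) (γ' i)) = _ := (shift γ).commutes (γ' i)
    rw [h1, h2, ← Algebra.smul_def, Pi.add_apply, add_smul, add_assoc]

/-- Matrix elements of the normally ordered product are Laurent polynomials in `z/w`, hence can be
evaluated anywhere; only the contraction `A / B` needs its denominator to be nonzero at `1/p`. -/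
lemma isShiftedProductMode_vertexMode {p : 𝕜} (hp : p ≠ 0) {α γ α' γ' : Fin 2 × ℕ+ → 𝕜}
    {A B : Polynomial 𝕜} (hAB : expSeries 𝕜 (contraction γ α') * (B : PowerSeries 𝕜) = A)
    (hB : B.eval p⁻¹ ≠ 0) (n : ℤ) :
    IsShiftedProductMode p (vertexMode α γ) (vertexMode α' γ') n
      ((A.eval p⁻¹ / B.eval p⁻¹) • vertexMode (grade p α + α') (grade p⁻¹ γ + γ') n) := by
  intro v m
  set J := (shift γ' v).natDegree + 1 with hJ
  set c : ℕ → Fock 𝕜 := fun j => (shift γ' v).coeff j with hc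
  -- Coefficient of `(z/w)^k` in the normally ordered product, for the part of `v` from which the
  -- right factor's annihilation part has taken `z^(-j)`.
  set ν : ℕ → ℤ → 𝕜 := fun j k => MvPolynomial.coeff m
    (expZ 𝕜 (lin α') (k + (j - n)) * vertexMode α γ k (c j)) with hν
  have hVW : ∀ k, MvPolynomial.coeff m (vertexMode α γ k (vertexMode α' γ' (n - k) v)) =
      ∑ j ∈ Finset.range J, ∑ᶠ l, expZ 𝕜 (contraction γ α') l * ν j (k - l) := by
    intro k
    rw [vertexMode_apply α', modeOf_eq_sum_range _ _ _ (Nat.lt_succ_self _), map_sum,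
      ← MvPolynomial.lcoeff_apply, map_sum]
    refine Finset.sum_congr rfl fun j _ => ?_
    have h := vertexMode_expZ_mul α γ α' k (j - (n - k)) (c j)
    rw [h.2]
    refine ((MvPolynomial.lcoeff 𝕜 m).toAddMonoidHom.map_finsum h.1).trans ?_
    refine finsum_congr fun l => ?_
    simp only [LinearMap.toAddMonoidHom_coe, map_smul, smul_eq_mul, hν, MvPolynomial.lcoeff_apply]
    rw [show ((j : ℤ) - (n - k) - l) = k - l + (j - n) by ring]
  -- The weights `p^(-k)` turn `V(w)` into `V(p z)`, and the sum over `k` merges the two creation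
  -- exponentials.
  have key : ∀ j : ℕ, (Function.support fun k : ℤ => p⁻¹ ^ k •
      (expZ 𝕜 (lin α') (k + (j - n)) * vertexMode α γ k (c j))).Finite ∧
      ∑ᶠ k : ℤ, p⁻¹ ^ k • (expZ 𝕜 (lin α') (k + (j - n)) * vertexMode α γ k (c j)) =
        modeOf (lin α' + lin (grade p α)) (n - j) (shift (grade p⁻¹ γ) (c j)) := by
    intro j
    have h := finite_support_expZ_mul_vertexMode (lin α') (grade p α) (grade p⁻¹ γ) (n - j) (c j)
    have e : (fun k : ℤ => p⁻¹ ^ k •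
        (expZ 𝕜 (lin α') (k + (j - n)) * vertexMode α γ k (c j))) =
        (fun k : ℤ => expZ 𝕜 (lin α') k *
          vertexMode (grade p α) (grade p⁻¹ γ) (n - j + k) (c j)) ∘ (Equiv.addRight (j - n : ℤ)) := by
      funext k
      have h3 : n - (j : ℤ) + (k + (j - n)) = k := by ring
      simp only [Function.comp_apply, Equiv.coe_addRight, h3, ← rescale_vertexMode hp]
      rw [rescale, LinearMap.smul_apply, mul_smul_comm, inv_zpow, zpow_neg]
    rw [e]
    exact ⟨h.1.preimage (Equiv.injective _).injOn,
      (finsum_comp_equiv (Equiv.addRight (j - n : ℤ))).trans h.2⟩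
  have hνf : ∀ j, (Function.support (ν j)).Finite := fun j => by
    refine (key j).1.subset fun k hk h => hk ?_
    have := (smul_eq_zero.1 h).resolve_left (zpow_ne_zero _ (inv_ne_zero hp))
    simp [hν, this]
  have hval : ∀ j, ∑ᶠ k, ν j k * p⁻¹ ^ k = MvPolynomial.coeff m
      (modeOf (lin α' + lin (grade p α)) (n - j) (shift (grade p⁻¹ γ) (c j))) := by
    intro j
    rw [← (key j).2, ← MvPolynomial.lcoeff_apply]
    refine Eq.trans ?_ ((MvPolynomial.lcoeff 𝕜 m).toAddMonoidHom.map_finsum (key j).1).symm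
    refine finsum_congr fun k => ?_
    simp [hν, mul_comm]
  have hmain := IsRationalValue.sum (Finset.range J) fun j _ =>
    isRationalValue_conv_expZ hAB (inv_ne_zero hp) hB (hνf j)
  simp only [hVW]
  convert hmain using 1
  rw [← Finset.mul_sum, LinearMap.smul_apply, MvPolynomial.coeff_smul, smul_eq_mul]
  congr 1
  simp only [hval]
  rw [vertexMode_apply, ← sum_X_pow_mul_shift _ γ' v (Nat.lt_succ_self _), map_sum,
    ← MvPolynomial.lcoeff_apply, map_sum]
  refine Finset.sum_congr rfl fun j _ => ?_
  have := modeOf_X_pow_mul_C_mul (lin (grade p α + α')) n j 1 (shift (grade p⁻¹ γ) (c j))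
  rw [map_one, mul_one, one_mul] at this
  rw [this, MvPolynomial.lcoeff_apply, lin_add, add_comm (lin α')]

end NormalOrdering

/-! ### The generators as explicit vertex operators -/

section Explicit

variable {𝕜 : Type*} [Field 𝕜]

/-- The exponents `(1 - t^{-n}) / n` of the creation part of `η^{(i)}(z)`. -/
def creationExp (t : 𝕜) (i : Fin 2) : Fin 2 × ℕ+ → 𝕜 :=
  fun k => if k.1 = i then (1 - t⁻¹ ^ (k.2 : ℕ)) / ((k.2 : ℕ) : 𝕜) else 0

/-- The exponents `-(1 - q^n)` of the annihilation part of `η^{(i)}(z)`. -/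
def annihExp (q : 𝕜) (i : Fin 2) : Fin 2 × ℕ+ → 𝕜 :=
  fun k => if k.1 = i then -(1 - q ^ (k.2 : ℕ)) else 0

lemma smul_create_eq (c : ℕ+ → 𝕜) (i : Fin 2) (n : ℕ+) :
    c n • create i n = LinearMap.mulLeft 𝕜 (lin (fun k => if k.1 = i then c k.2 else 0) n) := by
  refine LinearMap.ext fun v => ?_
  simp [lin, create]

lemma diffOp_lin_ite (c : ℕ+ → 𝕜) (i : Fin 2) (n : ℕ+) :
    diffOp (lin (fun k => if k.1 = i then c k.2 else 0) n) = c n •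
      ((MvPolynomial.pderiv (i, n) : Derivation 𝕜 (Fock 𝕜) (Fock 𝕜)) : Fock 𝕜 →ₗ[𝕜] Fock 𝕜) := by
  refine LinearMap.ext fun v => ?_
  simp [lin, diffOp_X]

lemma rescale_expPos (r : 𝕜) (β : Fin 2 × ℕ+ → 𝕜) :
    rescale r (expPos fun n => LinearMap.mulLeft 𝕜 (lin β n)) =
      expPos fun n => LinearMap.mulLeft 𝕜 (lin (grade r β) n) := by
  funext n
  rw [rescale, expPos_mulLeft, expPos_mulLeft, lin_grade, expZ_pow_smul]
  exact LinearMap.ext fun v => by simp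

lemma grade_grade (a b : 𝕜) (α : Fin 2 × ℕ+ → 𝕜) : grade a (grade b α) = grade (a * b) α := by
  funext i
  simp only [grade, mul_pow, mul_assoc]

lemma grade_add (a : 𝕜) (α β : Fin 2 × ℕ+ → 𝕜) : grade a (α + β) = grade a α + grade a β := by
  funext i
  simp only [grade, Pi.add_apply, mul_add]

lemma grade_sub (a : 𝕜) (α β : Fin 2 × ℕ+ → 𝕜) : grade a (α - β) = grade a α - grade a β := by
  funext i
  simp only [grade, Pi.sub_apply, mul_sub]

variable [CharZero 𝕜]

lemma eta_eq {t : 𝕜} (ht : ∀ n : ℕ, 0 < n → t ^ n ≠ 1) (s : 𝕜) (i : Fin 2) :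
    eta t s i = vertexMode (creationExp t i) (annihExp (t * s ^ 2) i) := by
  rw [eta, ← mulModes_expPos_expNeg]
  congr 2
  · funext n
    exact smul_create_eq (fun n => (1 - t⁻¹ ^ (n : ℕ)) / ((n : ℕ) : 𝕜)) i n
  · funext n
    refine Eq.trans ?_ (diffOp_lin_ite (fun n => -(1 - (t * s ^ 2) ^ (n : ℕ))) i n).symm
    rw [annihA, smul_smul]
    congr 1
    have h1 : (n : 𝕜) ≠ 0 := by exact_mod_cast n.ne_zero
    have h2 : 1 - t ^ (n : ℕ) ≠ 0 := sub_ne_zero.2 (ht n n.pos).symm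
    field_simp

lemma Lambda1_eq {t : 𝕜} (ht : ∀ n : ℕ, 0 < n → t ^ n ≠ 1) (u s : 𝕜) :
    Lambda1 t u s = u • rescale s (vertexMode (creationExp t 0) (annihExp (t * s ^ 2) 0)) := by
  funext n
  rw [Lambda1, eta_eq ht]
  rfl

/-- Since `s^n (1 - s^(-2n)) = s^(-n) (s^(2n) - 1)`, both factors are rescalings by the same `s⁻¹`,
of exponents that stay bounded as `s → 0`. -/
lemma Lambda2_eq {t : 𝕜} (ht : ∀ n : ℕ, 0 < n → t ^ n ≠ 1) (u : 𝕜) {s : 𝕜} (hs : s ≠ 0) :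
    Lambda2 t u s = u • rescale s⁻¹ (vertexMode
      (creationExp t 1 + (grade (s ^ 2) (creationExp t 0) - creationExp t 0))
      (annihExp (t * s ^ 2) 1)) := by
  have hφ : varphi t s 0 = expPos fun n => LinearMap.mulLeft 𝕜 (lin (fun k : Fin 2 × ℕ+ =>
      if k.1 = 0 then (1 - t⁻¹ ^ (k.2 : ℕ)) / ((k.2 : ℕ) : 𝕜) * (1 - (s ^ 2)⁻¹ ^ (k.2 : ℕ))
      else 0) n) := by
    rw [varphi]
    congr 1
    funext n
    exact smul_create_eq (fun n => (1 - t⁻¹ ^ (n : ℕ)) / ((n : ℕ) : 𝕜) *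
      (1 - (s ^ 2)⁻¹ ^ (n : ℕ))) 0 n
  have hk : grade s (fun k : Fin 2 × ℕ+ =>
      if k.1 = 0 then (1 - t⁻¹ ^ (k.2 : ℕ)) / ((k.2 : ℕ) : 𝕜) * (1 - (s ^ 2)⁻¹ ^ (k.2 : ℕ))
      else 0) = grade s⁻¹ (grade (s ^ 2) (creationExp t 0) - creationExp t 0) := by
    funext k
    simp only [grade, Pi.sub_apply, creationExp]
    have := pow_ne_zero (k.2 : ℕ) hs
    split_ifs
    · have h1 : ((k.2 : ℕ) : 𝕜) ≠ 0 := by exact_mod_cast k.2.ne_zero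
      rw [inv_pow s, inv_pow (s ^ 2), ← pow_mul, mul_comm 2, pow_mul]
      field_simp
    · simp
  funext n
  rw [Lambda2, eta_eq ht, hφ, rescale_expPos, rescale_vertexMode (inv_ne_zero hs),
    mulModes_expPos_vertexMode, Pi.smul_apply, rescale_vertexMode (inv_ne_zero hs), grade_add,
    add_comm (grade s⁻¹ (creationExp t 1)), hk]

lemma expSeries_log (c : 𝕜) :
    expSeries 𝕜 (fun n : ℕ+ => -((n : 𝕜)⁻¹ * c ^ (n : ℕ))) =
      ((1 - Polynomial.C c * Polynomial.X : Polynomial 𝕜) : PowerSeries 𝕜) := by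
  have := expSeries_neg_pow_div (𝕜 := 𝕜) c (1 : 𝕜)
  simp only [Algebra.algebraMap_self, RingHom.id_apply, mul_one, smul_eq_mul] at this
  rw [this]
  simp

/-- Expanding `(1 - q^n)(1 - r^n)` gives four logarithms. For `r = t⁻¹` the numerator factor `1 - q
r x` is `1 - p x`. -/
lemma expSeries_contraction (q r : 𝕜) :
    expSeries 𝕜 (fun n : ℕ+ => -(1 - q ^ (n : ℕ)) * ((1 - r ^ (n : ℕ)) / (n : 𝕜))) *
      (((1 - Polynomial.C q * Polynomial.X) * (1 - Polynomial.C r * Polynomial.X) :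
        Polynomial 𝕜) : PowerSeries 𝕜) =
      (((1 - Polynomial.C 1 * Polynomial.X) * (1 - Polynomial.C (q * r) * Polynomial.X) :
        Polynomial 𝕜) : PowerSeries 𝕜) := by
  rw [Polynomial.coe_mul, Polynomial.coe_mul]
  simp only [← expSeries_log, ← expSeries_add]
  congr 1
  funext n
  simp only [Pi.add_apply, mul_pow, div_eq_mul_inv]
  ring

/-- The case of Λ¹Λ², where `a = 1/p` comes from `φ^{(1)}`. -/
lemma expSeries_contraction_mul (q r a : 𝕜) :
    expSeries 𝕜 (fun n : ℕ+ => -(1 - q ^ (n : ℕ)) * ((1 - r ^ (n : ℕ)) / (n : 𝕜)) *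
        (1 - a ^ (n : ℕ))) *
      (((1 - Polynomial.C q * Polynomial.X) * (1 - Polynomial.C r * Polynomial.X) *
        ((1 - Polynomial.C a * Polynomial.X) * (1 - Polynomial.C (q * r * a) * Polynomial.X)) :
        Polynomial 𝕜) : PowerSeries 𝕜) =
      (((1 - Polynomial.C 1 * Polynomial.X) * (1 - Polynomial.C (q * r) * Polynomial.X) *
        ((1 - Polynomial.C (q * a) * Polynomial.X) * (1 - Polynomial.C (r * a) * Polynomial.X)) :
        Polynomial 𝕜) : PowerSeries 𝕜) := by
  simp only [Polynomial.coe_mul]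
  simp only [← expSeries_log, ← expSeries_add]
  congr 1
  funext n
  simp only [Pi.add_apply, mul_pow, div_eq_mul_inv]
  ring

/-- Only Λ²(pz)Λ¹(z) survives. The conditions `q ≠ 1` and `p² ≠ 1` keep the contraction denominators
nonzero at `1/p`. -/
lemma X2_eq {t : 𝕜} (ht0 : t ≠ 0) (ht : ∀ n : ℕ, 0 < n → t ^ n ≠ 1) (u₁ u₂ : 𝕜) {s : 𝕜}
    (hs : s ≠ 0) (h1 : t * s ^ 2 ≠ 1) (h2 : (s ^ 2) ^ 2 ≠ 1) (n : ℤ) :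
    X2 t u₁ u₂ s n = (u₁ * u₂) • rescale s (vertexMode
      (creationExp t 1 + grade (s ^ 2) (creationExp t 0))
      (annihExp (t * s ^ 2) 1 + annihExp (t * s ^ 2) 0)) n := by
  have hp : s ^ 2 ≠ 0 := pow_ne_zero 2 hs
  have ht1 : t ≠ 1 := by simpa using ht 1 one_pos
  have hp1 : s ^ 2 ≠ 1 := fun h => h2 (by rw [h, one_pow])
  have hqr : t * s ^ 2 * t⁻¹ = s ^ 2 := by field_simp
  have hX : X1 t u₁ u₂ s = u₁ • vertexMode (grade s (creationExp t 0))
        (grade s⁻¹ (annihExp (t * s ^ 2) 0)) +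
      u₂ • vertexMode (grade s⁻¹
        (creationExp t 1 + (grade (s ^ 2) (creationExp t 0) - creationExp t 0)))
        (grade s (annihExp (t * s ^ 2) 1)) := by
    rw [← rescale_vertexMode hs, show grade s (annihExp (t * s ^ 2) 1) =
      grade (s⁻¹)⁻¹ (annihExp (t * s ^ 2) 1) by rw [inv_inv],
      ← rescale_vertexMode (inv_ne_zero hs), ← Lambda1_eq ht, ← Lambda2_eq ht _ hs]
    rfl
  set g := fun n : ℕ+ => -(1 - (t * s ^ 2) ^ (n : ℕ)) * ((1 - t⁻¹ ^ (n : ℕ)) / (n : 𝕜)) with hg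
  have c11 : contraction (grade s⁻¹ (annihExp (t * s ^ 2) 0)) (grade s (creationExp t 0)) = g := by
    funext k
    have := pow_ne_zero (k : ℕ) hs
    simp [contraction, grade, annihExp, creationExp, g]
    field_simp
  have c22 : contraction (grade s (annihExp (t * s ^ 2) 1)) (grade s⁻¹
      (creationExp t 1 + (grade (s ^ 2) (creationExp t 0) - creationExp t 0))) = g := by
    funext k
    have := pow_ne_zero (k : ℕ) hs
    simp [contraction, grade, annihExp, creationExp, g]
    field_simp
  have c12 : contraction (grade s⁻¹ (annihExp (t * s ^ 2) 0)) (grade s⁻¹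
      (creationExp t 1 + (grade (s ^ 2) (creationExp t 0) - creationExp t 0))) =
      fun n => g n * (1 - (s ^ 2)⁻¹ ^ (n : ℕ)) := by
    funext k
    have := pow_ne_zero (k : ℕ) hs
    have h01 : (0 : Fin 2) ≠ 1 := by decide
    have h10 : (1 : Fin 2) ≠ 0 := by decide
    simp only [contraction, Fin.sum_univ_two, grade, annihExp, creationExp, g, Pi.add_apply,
      Pi.sub_apply, if_true, if_neg h01, if_neg h10, mul_zero, zero_mul, add_zero, zero_add]
    rw [inv_pow s, inv_pow (s ^ 2), ← pow_mul s 2, mul_comm 2 (k : ℕ), pow_mul s]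
    field_simp
  have c21 : contraction (grade s (annihExp (t * s ^ 2) 1)) (grade s (creationExp t 0)) = 0 := by
    funext k
    have h01 : (0 : Fin 2) ≠ 1 := by decide
    have h10 : (1 : Fin 2) ≠ 0 := by decide
    simp only [contraction, Fin.sum_univ_two, grade, annihExp, creationExp,
      if_neg h01, if_neg h10, mul_zero, zero_mul, add_zero, Pi.zero_apply]
  have ev : ∀ a x : 𝕜, (1 - Polynomial.C a * Polynomial.X : Polynomial 𝕜).eval x = 1 - a * x := by
    simp
  have z11 : (1 - Polynomial.C (t * s ^ 2) * Polynomial.X : Polynomial 𝕜).eval (s ^ 2)⁻¹ ≠ 0 := by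
    rw [ev, mul_assoc, mul_inv_cancel₀ hp, mul_one]
    exact sub_ne_zero.2 ht1.symm
  have z12 : (1 - Polynomial.C t⁻¹ * Polynomial.X : Polynomial 𝕜).eval (s ^ 2)⁻¹ ≠ 0 := by
    rw [ev, ← mul_inv]
    exact sub_ne_zero.2 fun h => h1 (inv_eq_one.1 h.symm)
  have hB : ((1 - Polynomial.C (t * s ^ 2) * Polynomial.X) *
      (1 - Polynomial.C t⁻¹ * Polynomial.X) : Polynomial 𝕜).eval (s ^ 2)⁻¹ ≠ 0 := by
    rw [Polynomial.eval_mul]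
    exact mul_ne_zero z11 z12
  -- The zero that removes three of the four products: `q t⁻¹ = p`, evaluated at `1/p`.
  have z1 : (1 - Polynomial.C (t * s ^ 2 * t⁻¹) * Polynomial.X : Polynomial 𝕜).eval (s ^ 2)⁻¹ = 0 := by
    rw [hqr]
    simp [hp]
  have hA : ((1 - Polynomial.C 1 * Polynomial.X) *
      (1 - Polynomial.C (t * s ^ 2 * t⁻¹) * Polynomial.X) : Polynomial 𝕜).eval (s ^ 2)⁻¹ = 0 := by
    rw [Polynomial.eval_mul, z1, mul_zero]
  have m11 := isShiftedProductMode_vertexMode hp (α := grade s (creationExp t 0))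
    (γ' := grade s⁻¹ (annihExp (t * s ^ 2) 0))
    (by rw [c11]; exact expSeries_contraction (t * s ^ 2) t⁻¹) hB n
  have m22 := isShiftedProductMode_vertexMode hp (α := grade s⁻¹
      (creationExp t 1 + (grade (s ^ 2) (creationExp t 0) - creationExp t 0)))
    (γ' := grade s (annihExp (t * s ^ 2) 1))
    (by rw [c22]; exact expSeries_contraction (t * s ^ 2) t⁻¹) hB n
  have hB' : ((1 - Polynomial.C (t * s ^ 2) * Polynomial.X) *
      (1 - Polynomial.C t⁻¹ * Polynomial.X) * ((1 - Polynomial.C (s ^ 2)⁻¹ * Polynomial.X) *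
      (1 - Polynomial.C (t * s ^ 2 * t⁻¹ * (s ^ 2)⁻¹) * Polynomial.X)) :
      Polynomial 𝕜).eval (s ^ 2)⁻¹ ≠ 0 := by
    rw [Polynomial.eval_mul, hqr, mul_inv_cancel₀ hp]
    refine mul_ne_zero hB ?_
    rw [Polynomial.eval_mul]
    refine mul_ne_zero ?_ ?_
    · rw [ev, ← mul_inv, ← pow_two]
      exact sub_ne_zero.2 fun h => h2 (inv_eq_one.1 h.symm)
    · rw [ev, one_mul]
      exact sub_ne_zero.2 fun h => hp1 (inv_eq_one.1 h.symm)
  have m12 := isShiftedProductMode_vertexMode hp (α := grade s (creationExp t 0))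
    (γ' := grade s (annihExp (t * s ^ 2) 1))
    (by rw [c12]; exact expSeries_contraction_mul (t * s ^ 2) t⁻¹ (s ^ 2)⁻¹) hB' n
  -- Λ² annihilates only the second boson and Λ¹ creates only the first, so the contraction is `1`.
  have m21 := isShiftedProductMode_vertexMode hp (α := grade s⁻¹
      (creationExp t 1 + (grade (s ^ 2) (creationExp t 0) - creationExp t 0)))
    (γ' := grade s⁻¹ (annihExp (t * s ^ 2) 0)) (A := 1) (B := 1)
    (by rw [c21, expSeries_zero]; simp) (by simp) n
  rw [hA, zero_div, zero_smul] at m11 m22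
  rw [Polynomial.eval_mul (p := (1 - Polynomial.C 1 * Polynomial.X) * _), hA, zero_mul, zero_div,
    zero_smul] at m12
  have hL := ((m11.smul_smul u₁ u₁).add_right (m12.smul_smul u₁ u₂)).add_left
    ((m21.smul_smul u₂ u₁).add_right (m22.smul_smul u₂ u₂))
  rw [← hX] at hL
  rw [X2, hL.shiftedProduct_eq, rescale_vertexMode hs]
  simp only [smul_zero, zero_add, add_zero, Polynomial.eval_one, div_one, one_smul]
  rw [mul_comm u₂]
  -- At `p z` the term `-creationExp t 0` of Λ² acquires the scale `p s⁻¹ = s` and cancels the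
  -- creation part of Λ¹.
  have e : s ^ 2 * s⁻¹ = s := by field_simp
  have e' : (s ^ 2)⁻¹ * s = s⁻¹ := by field_simp
  have e3 : s⁻¹ * s ^ 2 = s := by field_simp
  simp only [grade_add, grade_sub, grade_grade, e, e', e3, mul_comm s (s ^ 2)]
  congr 2
  abel

end Explicit

/-! ### The limit `s → 0` -/

section Limits

variable {𝕜 : Type*} [NontriviallyNormedField 𝕜]

/-- Coefficientwise convergence of polynomials. -/
def CoeffTendsto {ι : Type*} (l : Filter ι) (F : ι → Fock 𝕜) (v : Fock 𝕜) : Prop :=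
  ∀ m, Tendsto (fun s => MvPolynomial.coeff m (F s)) l (𝓝 (MvPolynomial.coeff m v))

variable {ι : Type*} {l : Filter ι}

lemma CoeffTendsto.const (v : Fock 𝕜) : CoeffTendsto l (fun _ => v) v :=
  fun _ => tendsto_const_nhds

lemma CoeffTendsto.add {F G : ι → Fock 𝕜} {v w : Fock 𝕜} (hF : CoeffTendsto l F v)
    (hG : CoeffTendsto l G w) : CoeffTendsto l (fun s => F s + G s) (v + w) := fun m => by
  simpa using (hF m).add (hG m)

lemma CoeffTendsto.mul {F G : ι → Fock 𝕜} {v w : Fock 𝕜} (hF : CoeffTendsto l F v)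
    (hG : CoeffTendsto l G w) : CoeffTendsto l (fun s => F s * G s) (v * w) := fun m => by
  classical
  simp only [MvPolynomial.coeff_mul]
  exact tendsto_finsetSum _ fun p _ => (hF p.1).mul (hG p.2)

lemma CoeffTendsto.smul {f : ι → 𝕜} {c : 𝕜} (hf : Tendsto f l (𝓝 c)) {F : ι → Fock 𝕜} {v : Fock 𝕜}
    (hF : CoeffTendsto l F v) : CoeffTendsto l (fun s => f s • F s) (c • v) := fun m => by
  simpa using hf.mul (hF m)

lemma CoeffTendsto.sum {κ : Type*} (s : Finset κ) {F : κ → ι → Fock 𝕜} {v : κ → Fock 𝕜}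
    (h : ∀ i ∈ s, CoeffTendsto l (F i) (v i)) :
    CoeffTendsto l (fun x => ∑ i ∈ s, F i x) (∑ i ∈ s, v i) := fun m => by
  simp only [MvPolynomial.coeff_sum]
  exact tendsto_finsetSum _ fun i hi => h i hi m

lemma CoeffTendsto.list_prod {κ : Type*} (L : List κ) {F : κ → ι → Fock 𝕜} {v : κ → Fock 𝕜}
    (h : ∀ i, CoeffTendsto l (F i) (v i)) :
    CoeffTendsto l (fun x => (L.map fun i => F i x).prod) (L.map v).prod := by
  induction L with
  | nil => exact .const 1
  | cons i L ih =>
    simp only [List.map_cons, List.prod_cons]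
    exact (h i).mul ih

lemma coeffTendsto_lin {α : ι → Fin 2 × ℕ+ → 𝕜} {α₀ : Fin 2 × ℕ+ → 𝕜}
    (h : ∀ i, Tendsto (fun s => α s i) l (𝓝 (α₀ i))) (n : ℕ+) :
    CoeffTendsto l (fun s => lin (α s) n) (lin α₀ n) :=
  .sum _ fun _ _ => .smul (h _) (.const _)

lemma coeffTendsto_expZ {a : ι → ℕ+ → Fock 𝕜} {a₀ : ℕ+ → Fock 𝕜}
    (h : ∀ n, CoeffTendsto l (fun s => a s n) (a₀ n)) (k : ℤ) :
    CoeffTendsto l (fun s => expZ 𝕜 (a s) k) (expZ 𝕜 a₀ k) := by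
  simp only [expZ]
  split_ifs
  · exact .sum _ fun c _ => .smul tendsto_const_nhds (.list_prod c.blocks fun n => h n.toPNat')
  · exact .const 0

lemma coeffTendsto_coeff_shift {γ : ι → Fin 2 × ℕ+ → 𝕜} {γ₀ : Fin 2 × ℕ+ → 𝕜}
    (h : ∀ i, Tendsto (fun s => γ s i) l (𝓝 (γ₀ i))) (v : Fock 𝕜) (j : ℕ) :
    CoeffTendsto l (fun s => (shift (γ s) v).coeff j) ((shift γ₀ v).coeff j) := by
  induction v using MvPolynomial.induction_on generalizing j with
  | C c =>
    simp only [← MvPolynomial.algebraMap_eq, AlgHom.commutes]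
    exact .const _
  | add p q hp hq =>
    simp only [map_add, Polynomial.coeff_add]
    exact (hp j).add (hq j)
  | mul_X p i hp =>
    simp only [map_mul, shift_X, mul_add, Polynomial.coeff_add, Polynomial.coeff_mul_C,
      mul_smul_comm, Polynomial.coeff_smul, Polynomial.coeff_mul_X_pow']
    refine ((hp j).mul (.const _)).add (.smul (h i) ?_)
    split_ifs
    · exact hp _
    · exact .const 0

/-- A degree bound uniform in `γ`, so that a mode is a sum over one fixed finite range along the
whole limit. -/
lemma exists_natDegree_shift_lt (v : Fock 𝕜) : ∃ J, ∀ γ, (shift γ v).natDegree < J := by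
  induction v using MvPolynomial.induction_on with
  | C c =>
    refine ⟨1, fun γ => ?_⟩
    rw [← MvPolynomial.algebraMap_eq, AlgHom.commutes, IsScalarTower.algebraMap_apply 𝕜 (Fock 𝕜),
      Polynomial.algebraMap_eq, Polynomial.natDegree_C]
    exact one_pos
  | add p q hp hq =>
    obtain ⟨A, hA⟩ := hp
    obtain ⟨B, hB⟩ := hq
    refine ⟨max A B, fun γ => ?_⟩
    rw [map_add]
    exact (Polynomial.natDegree_add_le _ _).trans_lt
      (max_lt_max (hA γ) (hB γ))
  | mul_X p i hp =>
    obtain ⟨A, hA⟩ := hp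
    refine ⟨A + i.2, fun γ => ?_⟩
    rw [map_mul, shift_X]
    refine Polynomial.natDegree_mul_le.trans_lt (add_lt_add_of_lt_of_le (hA γ) ?_)
    refine (Polynomial.natDegree_add_le _ _).trans (max_le (by simp) ?_)
    exact (Polynomial.natDegree_smul_le _ _).trans (by simp)

lemma coeffTendsto_vertexMode {α γ : ι → Fin 2 × ℕ+ → 𝕜} {α₀ γ₀ : Fin 2 × ℕ+ → 𝕜}
    (hα : ∀ i, Tendsto (fun s => α s i) l (𝓝 (α₀ i)))
    (hγ : ∀ i, Tendsto (fun s => γ s i) l (𝓝 (γ₀ i))) (n : ℤ) (v : Fock 𝕜) :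
    CoeffTendsto l (fun s => vertexMode (α s) (γ s) n v) (vertexMode α₀ γ₀ n v) := by
  obtain ⟨J, hJ⟩ := exists_natDegree_shift_lt v
  simp only [vertexMode_apply, modeOf_eq_sum_range _ _ _ (hJ _)]
  exact .sum _ fun j _ => (coeffTendsto_expZ (coeffTendsto_lin hα) _).mul
    (coeffTendsto_coeff_shift hγ v j)

lemma isCrystalLimit_vertexMode {f : 𝕜 → 𝕜} {c : 𝕜} (hf : Tendsto f (𝓝[≠] 0) (𝓝 c))
    {α γ : 𝕜 → Fin 2 × ℕ+ → 𝕜} {α₀ γ₀ : Fin 2 × ℕ+ → 𝕜}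
    (hα : ∀ i, Tendsto (fun s => α s i) (𝓝[≠] 0) (𝓝 (α₀ i)))
    (hγ : ∀ i, Tendsto (fun s => γ s i) (𝓝[≠] 0) (𝓝 (γ₀ i))) (n : ℤ) :
    IsCrystalLimit (fun s => f s • vertexMode (α s) (γ s) n) (c • vertexMode α₀ γ₀ n) :=
  fun v => (coeffTendsto_vertexMode hα hγ n v).smul hf

lemma IsCrystalLimit.add {A B : 𝕜 → Op 𝕜} {L M : Op 𝕜} (hA : IsCrystalLimit A L)
    (hB : IsCrystalLimit B M) : IsCrystalLimit (fun s => A s + B s) (L + M) := fun v m => by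
  simpa using (hA v m).add (hB v m)

lemma IsCrystalLimit.congr' {A B : 𝕜 → Op 𝕜} {L : Op 𝕜} (hA : IsCrystalLimit A L)
    (h : A =ᶠ[𝓝[≠] 0] B) : IsCrystalLimit B L := fun v m =>
  (hA v m).congr' (h.mono fun s hs => by simp only [hs])

lemma IsCrystalLimit.eq {A : 𝕜 → Op 𝕜} {L M : Op 𝕜} (h : IsCrystalLimit A L)
    (h' : IsCrystalLimit A M) : L = M :=
  LinearMap.ext fun v => MvPolynomial.ext _ _ fun m => tendsto_nhds_unique (h v m) (h' v m)

lemma IsCrystalLimit.crystalLimit_eq {A : 𝕜 → Op 𝕜} {L : Op 𝕜} (h : IsCrystalLimit A L) :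
    crystalLimit A = L := by
  have hL : ∃ L, IsCrystalLimit A L := ⟨L, h⟩
  rw [crystalLimit, dif_pos hL]
  exact hL.choose_spec.eq h

lemma tendsto_of_continuous {f : 𝕜 → 𝕜} (hf : Continuous f) {c : 𝕜} (h : f 0 = c) :
    Tendsto f (𝓝[≠] 0) (𝓝 c) :=
  h ▸ hf.continuousAt.tendsto.mono_left nhdsWithin_le_nhds

lemma tendsto_annihExp (t : 𝕜) (i : Fin 2) (k : Fin 2 × ℕ+) :
    Tendsto (fun s => annihExp (t * s ^ 2) i k) (𝓝[≠] 0) (𝓝 (annihExp 0 i k)) := by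
  simp only [annihExp]
  split_ifs
  · exact tendsto_of_continuous (by fun_prop) (by simp)
  · exact tendsto_const_nhds

lemma tendsto_grade_sq (α : Fin 2 × ℕ+ → 𝕜) (k : Fin 2 × ℕ+) :
    Tendsto (fun s : 𝕜 => grade (s ^ 2) α k) (𝓝[≠] 0) (𝓝 0) :=
  tendsto_of_continuous (by unfold grade; fun_prop) (by simp [grade])

/-- The exponent `|n| + n` is `0` for `n ≤ 0` and `2n` for `n > 0`: this is what selects half of the
modes. -/
lemma tendsto_pow_natAbs_mul_zpow (n : ℤ) :
    Tendsto (fun s : 𝕜 => s ^ n.natAbs * s ^ n) (𝓝[≠] 0) (𝓝 (if n ≤ 0 then 1 else 0)) := by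
  rcases le_or_gt n 0 with h | h
  · rw [if_pos h]
    refine tendsto_const_nhds.congr' (eventually_mem_nhdsWithin.mono fun s hs => ?_)
    have : s ≠ 0 := hs
    change 1 = s ^ n.natAbs * s ^ n
    rw [← zpow_natCast, ← zpow_add₀ this, show ((n.natAbs : ℤ) + n) = 0 by omega, zpow_zero]
  · rw [if_neg (not_le.2 h)]
    obtain ⟨k, rfl⟩ := Int.eq_ofNat_of_zero_le h.le
    have hk : k ≠ 0 := by omega
    refine tendsto_of_continuous (by simp only [zpow_natCast]; fun_prop) ?_
    simp [hk]

variable [CharZero 𝕜]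

/-- The explicit form of `X̃^{(1)}_n`. -/
def crystalX1 (t u₁ u₂ : 𝕜) (n : ℤ) : Op 𝕜 :=
  (u₁ * if -n ≤ 0 then 1 else 0) • vertexMode (creationExp t 0) (annihExp 0 0) n +
    (u₂ * if n ≤ 0 then 1 else 0) •
      vertexMode (creationExp t 1 - creationExp t 0) (annihExp 0 1) n

/-- The explicit form of `X̃^{(2)}_n`. -/
def crystalX2 (t u₁ u₂ : 𝕜) (n : ℤ) : Op 𝕜 :=
  (u₁ * u₂) • vertexMode (creationExp t 1) (annihExp 0 1 + annihExp 0 0) n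

lemma isCrystalLimit_X1 {t : 𝕜} (ht : ∀ n : ℕ, 0 < n → t ^ n ≠ 1) (u₁ u₂ : 𝕜) (n : ℤ) :
    IsCrystalLimit (fun s => s ^ n.natAbs • X1 t u₁ u₂ s n) (crystalX1 t u₁ u₂ n) := by
  -- Λ¹ is rescaled by `s` and so carries `s^(-n)`; Λ² carries `s^n`. At `n = 0` both survive.
  have h1 : Tendsto (fun s : 𝕜 => u₁ * (s ^ n.natAbs * s ^ (-n))) (𝓝[≠] 0)
      (𝓝 (u₁ * if -n ≤ 0 then 1 else 0)) := by
    have := tendsto_pow_natAbs_mul_zpow (𝕜 := 𝕜) (-n)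
    rw [Int.natAbs_neg] at this
    exact this.const_mul u₁
  have h2 := (tendsto_pow_natAbs_mul_zpow (𝕜 := 𝕜) n).const_mul u₂
  refine ((isCrystalLimit_vertexMode h1 (fun i => tendsto_const_nhds (x := creationExp t 0 i))
    (tendsto_annihExp t 0) n).add (isCrystalLimit_vertexMode h2
    (α := fun s => creationExp t 1 + (grade (s ^ 2) (creationExp t 0) - creationExp t 0))
    (α₀ := creationExp t 1 - creationExp t 0) (fun i => ?_) (tendsto_annihExp t 1) n)).congr' ?_
  · have := (((tendsto_grade_sq (creationExp t 0) i).sub_const (creationExp t 0 i)).const_add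
      (creationExp t 1 i))
    simpa [sub_eq_add_neg] using this
  · refine eventually_mem_nhdsWithin.mono fun s hs => ?_
    have hs : s ≠ 0 := hs
    simp only [X1, Lambda1_eq ht, Lambda2_eq ht _ hs, Pi.smul_apply, rescale, smul_add, smul_smul,
      inv_zpow, zpow_neg, inv_inv]
    congr 2 <;> ring

lemma isCrystalLimit_X2 {t : 𝕜} (ht0 : t ≠ 0) (ht : ∀ n : ℕ, 0 < n → t ^ n ≠ 1) (u₁ u₂ : 𝕜)
    (n : ℤ) : IsCrystalLimit (fun s => s ^ n • X2 t u₁ u₂ s n) (crystalX2 t u₁ u₂ n) := by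
  refine ((isCrystalLimit_vertexMode (tendsto_const_nhds (x := u₁ * u₂))
    (α := fun s => creationExp t 1 + grade (s ^ 2) (creationExp t 0))
    (α₀ := creationExp t 1) (fun i => ?_)
    (γ := fun s => annihExp (t * s ^ 2) 1 + annihExp (t * s ^ 2) 0)
    (fun i => (tendsto_annihExp t 1 i).add (tendsto_annihExp t 0 i)) n)).congr' ?_
  · simpa using (tendsto_grade_sq (creationExp t 0) i).const_add (creationExp t 1 i)
  -- The explicit form of `X2` requires `q ≠ 1` and `p² ≠ 1`, which hold for `s` near `0`.
  · have e1 : ∀ᶠ s : 𝕜 in 𝓝[≠] 0, t * s ^ 2 ≠ 1 :=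
      (tendsto_of_continuous (f := fun s : 𝕜 => t * s ^ 2) (c := 0) (by fun_prop)
        (by simp)).eventually_ne zero_ne_one
    have e2 : ∀ᶠ s : 𝕜 in 𝓝[≠] 0, (s ^ 2) ^ 2 ≠ 1 :=
      (tendsto_of_continuous (f := fun s : 𝕜 => (s ^ 2) ^ 2) (c := 0) (by fun_prop)
        (by simp)).eventually_ne zero_ne_one
    filter_upwards [e1, e2, eventually_mem_nhdsWithin] with s h1 h2 hs
    have hs : s ≠ 0 := hs
    simp only [X2_eq ht0 ht u₁ u₂ hs h1 h2, rescale]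
    rw [smul_comm (s ^ n), smul_smul (s ^ n), ← zpow_add₀ hs, add_neg_cancel, zpow_zero, one_smul]

lemma Xt1_eq {t : 𝕜} (ht : ∀ n : ℕ, 0 < n → t ^ n ≠ 1) (u₁ u₂ : 𝕜) :
    Xt1 t u₁ u₂ = crystalX1 t u₁ u₂ :=
  funext fun n => (isCrystalLimit_X1 ht u₁ u₂ n).crystalLimit_eq

lemma Xt2_eq {t : 𝕜} (ht0 : t ≠ 0) (ht : ∀ n : ℕ, 0 < n → t ^ n ≠ 1) (u₁ u₂ : 𝕜) :
    Xt2 t u₁ u₂ = crystalX2 t u₁ u₂ :=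
  funext fun n => (isCrystalLimit_X2 ht0 ht u₁ u₂ n).crystalLimit_eq

end Limits

/-! ### Partial fractions of `∏ (1 - τ x_i z) / (1 - x_i z)` -/

section Interpolation

variable {L ι : Type*} [Field L] [Fintype ι] [DecidableEq ι]

/-- The coefficient `(1 - τ) ∏_{i ≠ j} (x_j - τ x_i) / (x_j - x_i)`. -/
def residueCoeff (τ : L) (x : ι → L) (j : ι) : L :=
  (1 - τ) * ∏ i ∈ {j}ᶜ, (x j - τ * x i) / (x j - x i)

omit [Fintype ι] [DecidableEq ι] in
lemma natDegree_prod_one_sub_le (s : Finset ι) (y : ι → L) :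
    (∏ i ∈ s, (1 - Polynomial.C (y i) * Polynomial.X)).natDegree ≤ s.card := by
  refine (Polynomial.natDegree_prod_le _ _).trans ?_
  rw [Finset.card_eq_sum_ones]
  refine Finset.sum_le_sum fun i _ => ?_
  compute_degree

/-- The partial fraction expansion with denominators cleared: two polynomials of degree at most `N`
with equal coefficients of `z^N` and equal values at the `N` points `1/x_j`. -/
lemma prod_one_sub_eq (τ : L) {x : ι → L} (hx : Function.Injective x) (hx0 : ∀ i, x i ≠ 0) :
    ∏ i, (1 - Polynomial.C (τ * x i) * Polynomial.X) =
      Polynomial.C (τ ^ Fintype.card ι) * ∏ i, (1 - Polynomial.C (x i) * Polynomial.X) +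
      ∑ j, Polynomial.C (residueCoeff τ x j) *
        ∏ i ∈ {j}ᶜ, (1 - Polynomial.C (x i) * Polynomial.X) := by
  refine Polynomial.eq_of_degree_sub_lt_of_eval_index_eq (s := Finset.univ) (v := fun i => (x i)⁻¹)
    (fun i _ j _ h => hx (inv_injective h)) ?_ ?_
  -- The summands over `j` have degree below `N`, and the leading coefficients agree: `∏ (-τ x_i) =
  -- τ^N ∏ (-x_i)`.
  · rw [Polynomial.degree_lt_iff_coeff_zero]
    intro m hm
    rw [Finset.card_univ] at hm
    have h3 : ∀ j, (∏ i ∈ {j}ᶜ, (1 - Polynomial.C (x i) * Polynomial.X)).coeff m = 0 := fun j => by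
      refine Polynomial.coeff_eq_zero_of_natDegree_lt
        ((natDegree_prod_one_sub_le _ _).trans_lt (lt_of_lt_of_le ?_ hm))
      rw [Finset.card_compl, Finset.card_singleton]
      have : 0 < Fintype.card ι := Fintype.card_pos_iff.2 ⟨j⟩
      omega
    simp only [Polynomial.coeff_sub, Polynomial.coeff_add, Polynomial.finsetSum_coeff,
      Polynomial.coeff_C_mul, h3, mul_zero, Finset.sum_const_zero, add_zero]
    rcases hm.lt_or_eq with h | h
    · rw [Polynomial.coeff_eq_zero_of_natDegree_lt
          ((natDegree_prod_one_sub_le Finset.univ fun i => τ * x i).trans_lt h),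
        Polynomial.coeff_eq_zero_of_natDegree_lt
          ((natDegree_prod_one_sub_le Finset.univ x).trans_lt h), mul_zero, sub_zero]
    · have hc : ∀ y : ι → L, (∏ i, (1 - Polynomial.C (y i) * Polynomial.X)).coeff m =
          ∏ i, -y i := fun y => by
        have h1 := Polynomial.coeff_prod_of_natDegree_le (Finset.univ : Finset ι)
          (fun i => 1 - Polynomial.C (y i) * Polynomial.X) 1 (fun i _ => by compute_degree)
        rw [mul_one, Finset.card_univ, h] at h1
        rw [h1]
        exact Finset.prod_congr rfl fun i _ => by simp [Polynomial.coeff_one]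
      rw [hc, hc, ← Finset.card_univ, ← Finset.prod_const, ← Finset.prod_mul_distrib, sub_eq_zero]
      exact Finset.prod_congr rfl fun i _ => by ring
  -- At `z = 1/x_j` every term containing the factor `1 - x_j z` vanishes, leaving the `j`-th
  -- summand.
  · intro j _
    have hev : ∀ (s : Finset ι) (y : ι → L) (z : L),
        (∏ i ∈ s, (1 - Polynomial.C (y i) * Polynomial.X)).eval z = ∏ i ∈ s, (1 - y i * z) := by
      intro s y z
      rw [Polynomial.eval_prod]
      exact Finset.prod_congr rfl fun i _ => by simp
    have hz : ∀ s : Finset ι, j ∈ s → ∏ i ∈ s, (1 - x i * (x j)⁻¹) = 0 := fun s hs =>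
      Finset.prod_eq_zero hs (by rw [mul_inv_cancel₀ (hx0 j), sub_self])
    simp only [Polynomial.eval_add, Polynomial.eval_mul, Polynomial.eval_C,
      Polynomial.eval_finsetSum, hev]
    rw [hz _ (Finset.mem_univ j), mul_zero, zero_add, Finset.sum_eq_single j,
      Fintype.prod_eq_mul_prod_compl j, residueCoeff, mul_assoc, mul_assoc,
      mul_inv_cancel₀ (hx0 j), mul_one, ← Finset.prod_mul_distrib]
    · congr 1
      refine Finset.prod_congr rfl fun i hi => ?_
      have h1 : x j - x i ≠ 0 := sub_ne_zero.2 fun h => by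
        rw [hx h] at hi
        simp at hi
      have := hx0 j
      field_simp
    · intro k _ hk
      rw [hz _ (by simpa using hk.symm), mul_zero]
    · intro h
      exact absurd (Finset.mem_univ j) h

lemma sum_residueCoeff (τ : L) {x : ι → L} (hx : Function.Injective x) (hx0 : ∀ i, x i ≠ 0) :
    ∑ j, residueCoeff τ x j = 1 - τ ^ Fintype.card ι := by
  have := congrArg (Polynomial.eval 0) (prod_one_sub_eq τ hx hx0)
  simp [Polynomial.eval_prod, Polynomial.eval_finsetSum] at this
  rw [eq_sub_iff_add_eq', ← this]

variable {𝕜 : Type*} [Field 𝕜] [CharZero 𝕜] [Algebra 𝕜 L]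

/-- The exponential equals the product just expanded, and each `1 / (1 - x_j z)` is a geometric
series. The hypothesis `k ≠ 0` discards the constant `τ^N`. -/
lemma expC_sum_pow (τ : 𝕜) {x : ι → L} (hx : Function.Injective x) (hx0 : ∀ i, x i ≠ 0) {k : ℕ}
    (hk : k ≠ 0) :
    expC 𝕜 (fun n : ℕ+ => ((1 - τ ^ (n : ℕ)) / ((n : ℕ) : 𝕜)) • ∑ j, x j ^ (n : ℕ)) k =
      ∑ j, residueCoeff (algebraMap 𝕜 L τ) x j * x j ^ k := by
  set τ' := algebraMap 𝕜 L τ with hτ'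
  set a : ℕ+ → L := fun n : ℕ+ => ((1 - τ ^ (n : ℕ)) / ((n : ℕ) : 𝕜)) • ∑ j, x j ^ (n : ℕ) with ha
  have hgeom : ∀ y : L, (1 - PowerSeries.C y * PowerSeries.X) *
      (PowerSeries.mk fun k => y ^ k) = 1 := fun y => by
    ext n
    rw [sub_mul, one_mul, map_sub, mul_assoc, PowerSeries.coeff_C_mul]
    cases n with
    | zero => simp
    | succ n =>
      rw [mul_comm PowerSeries.X, PowerSeries.coeff_succ_mul_X]
      simp [pow_succ', PowerSeries.coeff_one]
  have hne : ∏ i, (1 - PowerSeries.C (x i) * PowerSeries.X) ≠ 0 :=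
    Finset.prod_ne_zero_iff.2 fun i _ h => by
      have := hgeom (x i)
      rw [h, zero_mul] at this
      exact zero_ne_one this
  have h1 : expSeries 𝕜 a * ∏ i, (1 - PowerSeries.C (x i) * PowerSeries.X) =
      ∏ i, (1 - PowerSeries.C (τ' * x i) * PowerSeries.X) := by
    have e1 : ∀ i, (1 - PowerSeries.C (x i) * PowerSeries.X) = expSeries 𝕜 (fun n : ℕ+ =>
        -((n : 𝕜)⁻¹ • (algebraMap 𝕜 L 1 * x i) ^ (n : ℕ))) := fun i => by
      rw [expSeries_neg_pow_div, map_one, one_mul]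
    have e2 : ∀ i, (1 - PowerSeries.C (τ' * x i) * PowerSeries.X) = expSeries 𝕜 (fun n : ℕ+ =>
        -((n : 𝕜)⁻¹ • (τ' * x i) ^ (n : ℕ))) := fun i => by
      rw [hτ', expSeries_neg_pow_div]
    simp only [e1, e2, ← expSeries_sum, ← expSeries_add]
    congr 1
    funext n
    simp only [Pi.add_apply, Finset.sum_apply, ha, Finset.smul_sum, ← Finset.sum_add_distrib]
    refine Finset.sum_congr rfl fun i _ => ?_
    rw [mul_pow, mul_pow, map_one, one_pow, one_mul, ← map_pow, ← Algebra.smul_def, smul_smul,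
      ← sub_eq_add_neg, ← sub_smul, ← neg_smul]
    congr 1
    ring
  have h2 : expSeries 𝕜 a = PowerSeries.C (τ' ^ Fintype.card ι) +
      ∑ j, PowerSeries.C (residueCoeff τ' x j) * PowerSeries.mk fun k => x j ^ k := by
    refine mul_right_cancel₀ hne ?_
    rw [h1, add_mul, Finset.sum_mul]
    have := congrArg (fun P : Polynomial L => (P : PowerSeries L)) (prod_one_sub_eq τ' hx hx0)
    simp only [← Polynomial.coeToPowerSeries.ringHom_apply, map_add, map_mul, map_sum, map_prod,
      map_sub, map_one] at this
    simp only [Polynomial.coeToPowerSeries.ringHom_apply, Polynomial.coe_C, Polynomial.coe_X] at this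
    simp only [map_mul]
    rw [this]
    congr 1
    refine Finset.sum_congr rfl fun j _ => ?_
    rw [Fintype.prod_eq_mul_prod_compl j, mul_assoc, ← mul_assoc (PowerSeries.mk _),
      mul_comm (PowerSeries.mk _), hgeom, one_mul]
  have h3 := congrArg (PowerSeries.coeff k) h2
  rw [map_add, PowerSeries.coeff_C, if_neg hk, zero_add] at h3
  simpa [expSeries] using h3

end Interpolation

/-! ### Recursion for the Hall–Littlewood symmetrization -/

section Symmetrizer

variable {L : Type*} [Field L]

/-- `∑_{w ∈ S_N} w (x^λ ∏_{i<j} (x_i - τ x_j) / (x_i - x_j))`. -/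
def symmetrizer (τ : L) {N : ℕ} (x : Fin N → L) (lam : ℕ → ℕ) : L :=
  ∑ w : Equiv.Perm (Fin N), (∏ i : Fin N, x (w i) ^ lam i) *
    ∏ ij : Fin N × Fin N with ij.1 < ij.2, (x (w ij.1) - τ * x (w ij.2)) / (x (w ij.1) - x (w ij.2))

/-- The permutation with first value `j` and the others given by `σ`. -/
def consPerm {N : ℕ} (p : Fin (N + 1) × Equiv.Perm (Fin N)) : Equiv.Perm (Fin (N + 1)) :=
  Equiv.ofBijective (Fin.cons p.1 (p.1.succAbove ∘ p.2) : Fin (N + 1) → Fin (N + 1))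
    (Finite.injective_iff_bijective.1 (Fin.cons_injective_iff.2
      ⟨by rintro ⟨i, hi⟩; exact Fin.succAbove_ne _ _ hi,
        Fin.succAbove_right_injective.comp p.2.injective⟩))

lemma consPerm_zero {N : ℕ} (p : Fin (N + 1) × Equiv.Perm (Fin N)) : consPerm p 0 = p.1 := rfl

lemma consPerm_succ {N : ℕ} (p : Fin (N + 1) × Equiv.Perm (Fin N)) (i : Fin N) :
    consPerm p i.succ = p.1.succAbove (p.2 i) := rfl

lemma consPerm_bijective (N : ℕ) : Function.Bijective (consPerm (N := N)) := by
  rw [Fintype.bijective_iff_injective_and_card]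
  constructor
  · rintro ⟨j, σ⟩ ⟨k, ρ⟩ h
    have h0 : j = k := by
      have := congrArg (fun w : Equiv.Perm _ => w 0) h
      simpa [consPerm_zero] using this
    subst h0
    have : σ = ρ := Equiv.ext fun i => by
      have := congrArg (fun w : Equiv.Perm _ => w i.succ) h
      simpa [consPerm_succ] using this
    rw [this]
  · simp [Fintype.card_perm, Nat.factorial_succ]

lemma prod_lt_succ {M : Type*} [CommMonoid M] {N : ℕ} (F : Fin (N + 1) → Fin (N + 1) → M) :
    ∏ ij : Fin (N + 1) × Fin (N + 1) with ij.1 < ij.2, F ij.1 ij.2 =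
      (∏ i : Fin N, F 0 i.succ) *
        ∏ ij : Fin N × Fin N with ij.1 < ij.2, F ij.1.succ ij.2.succ := by
  simp only [Finset.prod_filter, Fintype.prod_prod_type, Fin.prod_univ_succ, Fin.succ_lt_succ_iff]
  simp

lemma prod_compl_singleton {M : Type*} [CommMonoid M] {N : ℕ} (j : Fin (N + 1))
    (f : Fin (N + 1) → M) : ∏ i ∈ {j}ᶜ, f i = ∏ i : Fin N, f (j.succAbove i) := by
  rw [← Fin.image_succAbove_univ, Finset.prod_image fun a _ b _ h =>
    Fin.succAbove_right_injective h]

/-- Group the permutations by `w 0 = j`. The pairs containing `0` give `∏_{i ≠ j} (x_j - τ x_i) /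
(x_j - x_i)`, whatever the rest of `w`. -/
lemma symmetrizer_succ (τ : L) {N : ℕ} (x : Fin (N + 1) → L) (lam : ℕ → ℕ) :
    (1 - τ) * symmetrizer τ x lam = ∑ j, residueCoeff τ x j * x j ^ lam 0 *
      symmetrizer τ (x ∘ j.succAbove) fun i => lam (i + 1) := by
  rw [symmetrizer, ← (consPerm_bijective N).sum_comp, Fintype.sum_prod_type, Finset.mul_sum]
  refine Finset.sum_congr rfl fun j _ => ?_
  rw [symmetrizer, Finset.mul_sum, Finset.mul_sum]
  refine Finset.sum_congr rfl fun σ _ => ?_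
  rw [prod_lt_succ fun i k => (x (consPerm (j, σ) i) - τ * x (consPerm (j, σ) k)) /
    (x (consPerm (j, σ) i) - x (consPerm (j, σ) k)), Fin.prod_univ_succ, residueCoeff,
    prod_compl_singleton]
  simp only [consPerm_zero, consPerm_succ, Function.comp_apply, Fin.val_zero, Fin.val_succ]
  rw [Equiv.prod_comp σ fun i => (x j - τ * x (j.succAbove i)) / (x j - x (j.succAbove i))]
  ring

/-- The base case, where only zero parts are left; it accounts for the factor of `v_λ` with `i = 0`.
-/
lemma symmetrizer_zero {τ : L} (hτ : τ ≠ 1) {N : ℕ} {x : Fin N → L} (hx : Function.Injective x)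
    (hx0 : ∀ i, x i ≠ 0) :
    symmetrizer τ x (fun _ => 0) = ∏ k ∈ Finset.Icc 1 N, (1 - τ ^ k) / (1 - τ) := by
  induction N with
  | zero => simp [symmetrizer]
  | succ N ih =>
    have h1 : 1 - τ ≠ 0 := sub_ne_zero.2 hτ.symm
    refine mul_left_cancel₀ h1 ?_
    rw [symmetrizer_succ, Finset.prod_Icc_succ_top (by omega)]
    have h2 : ∀ j : Fin (N + 1), symmetrizer τ (x ∘ j.succAbove) (fun _ => 0) =
        ∏ k ∈ Finset.Icc 1 N, (1 - τ ^ k) / (1 - τ) := fun j =>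
      ih (hx.comp Fin.succAbove_right_injective) fun i => hx0 _
    simp only [h2, pow_zero, mul_one]
    rw [← Finset.sum_mul, sum_residueCoeff τ hx hx0, Fintype.card_fin]
    field_simp

end Symmetrizer

/-! ### Jing's vertex operators -/

section Jing

variable {𝕜 : Type*} [Field 𝕜]

/-- The substitution `p_n ↦ p_n - y ^ n`. -/
def powerShift : MvPolynomial ℕ+ 𝕜 →ₐ[𝕜] Polynomial (MvPolynomial ℕ+ 𝕜) :=
  MvPolynomial.aeval fun n => Polynomial.C (MvPolynomial.X n) - Polynomial.X ^ (n : ℕ)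

lemma powerShift_X (n : ℕ+) : powerShift (MvPolynomial.X n : MvPolynomial ℕ+ 𝕜) =
    Polynomial.C (MvPolynomial.X n) - Polynomial.X ^ (n : ℕ) := by
  simp [powerShift]

/-- The exponents `(1 - τ^n) / n p_n`. -/
def jingExp (τ : 𝕜) (n : ℕ+) : MvPolynomial ℕ+ 𝕜 :=
  ((1 - τ ^ (n : ℕ)) / ((n : ℕ) : 𝕜)) • MvPolynomial.X n

/-- The coefficient of `z ^ r` in Jing's vertex operator
`exp (∑ (1 - τ^n) / n p_n z ^ n) exp (-∑ z ^ (-n) ∂ / ∂ p_n)`. -/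
def jing (τ : 𝕜) (r : ℕ) (f : MvPolynomial ℕ+ 𝕜) : MvPolynomial ℕ+ 𝕜 :=
  (powerShift f).sum fun j c => expC 𝕜 (jingExp τ) (r + j) * c

/-- `H_{l_1} H_{l_2} ⋯ 1` for Jing's operators `H_r`. -/
def jingList (τ : 𝕜) (l : List ℕ) : MvPolynomial ℕ+ 𝕜 := l.foldr (jing τ) 1

variable {L : Type*} [Field L] [Algebra 𝕜 L]

variable (𝕜) in
/-- The evaluation `p_n ↦ ∑_i x_i ^ n`. -/
def evalPsum {N : ℕ} (x : Fin N → L) : MvPolynomial ℕ+ 𝕜 →ₐ[𝕜] L :=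
  MvPolynomial.aeval fun n => ∑ i, x i ^ (n : ℕ)

/-- Subtracting `x_j^n` from each power sum deletes the variable `x_j`. -/
lemma eval₂_powerShift {N : ℕ} (x : Fin (N + 1) → L) (j : Fin (N + 1)) (f : MvPolynomial ℕ+ 𝕜) :
    (powerShift f).eval₂ (evalPsum 𝕜 x).toRingHom (x j) = evalPsum 𝕜 (x ∘ j.succAbove) f := by
  induction f using MvPolynomial.induction_on with
  | C c =>
    rw [← MvPolynomial.algebraMap_eq, AlgHom.commutes, AlgHom.commutes,
      IsScalarTower.algebraMap_apply 𝕜 (MvPolynomial ℕ+ 𝕜), Polynomial.algebraMap_eq,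
      Polynomial.eval₂_C]
    exact (evalPsum 𝕜 x).commutes c
  | add p q hp hq => rw [map_add, Polynomial.eval₂_add, hp, hq, map_add]
  | mul_X p n hp =>
    rw [map_mul, Polynomial.eval₂_mul, hp, map_mul, powerShift_X, Polynomial.eval₂_sub,
      Polynomial.eval₂_C, Polynomial.eval₂_pow, Polynomial.eval₂_X]
    congr 1
    have h : (evalPsum 𝕜 x).toRingHom (MvPolynomial.X n) = ∑ i, x i ^ (n : ℕ) := by
      change evalPsum 𝕜 x _ = _
      simp [evalPsum]
    rw [h, Fin.sum_univ_succAbove _ j]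
    simp [evalPsum]

variable [CharZero 𝕜]

/-- The coefficient of index `r + i` is `∑ c_j x_j^(r+i)`, valid for every `i` because `r ≠ 0`; the
powers `x_j^i` then evaluate `powerShift f` at `x_j`. -/
lemma evalPsum_jing (τ : 𝕜) {N : ℕ} {x : Fin (N + 1) → L} (hx : Function.Injective x)
    (hx0 : ∀ i, x i ≠ 0) {r : ℕ} (hr : r ≠ 0) (f : MvPolynomial ℕ+ 𝕜) :
    evalPsum 𝕜 x (jing τ r f) = ∑ j, residueCoeff (algebraMap 𝕜 L τ) x j * x j ^ r *
      evalPsum 𝕜 (x ∘ j.succAbove) f := by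
  have hh : ∀ k, k ≠ 0 → evalPsum 𝕜 x (expC 𝕜 (jingExp τ) k) =
      ∑ j, residueCoeff (algebraMap 𝕜 L τ) x j * x j ^ k := fun k hk => by
    rw [map_expC, ← expC_sum_pow τ hx hx0 hk]
    congr 1
    funext n
    simp [jingExp, evalPsum]
  rw [jing, Polynomial.sum_over_range _ (by simp), map_sum]
  simp only [map_mul]
  have h1 : ∀ i, evalPsum 𝕜 x (expC 𝕜 (jingExp τ) (r + i)) *
      evalPsum 𝕜 x ((powerShift f).coeff i) = ∑ j, residueCoeff (algebraMap 𝕜 L τ) x j * x j ^ r *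
        (evalPsum 𝕜 x ((powerShift f).coeff i) * x j ^ i) := fun i => by
    rw [hh _ (by omega), Finset.sum_mul]
    refine Finset.sum_congr rfl fun j _ => ?_
    ring
  simp only [h1]
  rw [Finset.sum_comm]
  refine Finset.sum_congr rfl fun j _ => ?_
  rw [← Finset.mul_sum, ← eval₂_powerShift, Polynomial.eval₂_eq_sum_range]
  rfl

/-- `evalPsum_jing` and `symmetrizer_succ` are the same recursion, up to one factor `1 - τ` per
part. The product over `k` comes from the `N - ℓ` zero parts. -/
lemma evalPsum_jingList {τ : 𝕜} (hτ : τ ≠ 1) {l : List ℕ} (hl : ∀ r ∈ l, r ≠ 0) {N : ℕ}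
    (hN : l.length ≤ N) {x : Fin N → L} (hx : Function.Injective x) (hx0 : ∀ i, x i ≠ 0) :
    evalPsum 𝕜 x (jingList τ l) *
      ∏ k ∈ Finset.Icc 1 (N - l.length), (1 - algebraMap 𝕜 L τ ^ k) / (1 - algebraMap 𝕜 L τ) =
      (1 - algebraMap 𝕜 L τ) ^ l.length * symmetrizer (algebraMap 𝕜 L τ) x fun i => l.getD i 0 := by
  induction l generalizing N with
  | nil =>
    have h1 : algebraMap 𝕜 L τ ≠ 1 := fun h => hτ ((algebraMap 𝕜 L).injective (by rw [h, map_one]))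
    have := symmetrizer_zero h1 hx hx0
    simp [jingList, this]
  | cons r l ih =>
    obtain ⟨N, rfl⟩ : ∃ M, N = M + 1 := ⟨N - 1, by simp at hN; omega⟩
    have h1 : jingList τ (r :: l) = jing τ r (jingList τ l) := rfl
    rw [h1, evalPsum_jing τ hx hx0 (hl r List.mem_cons_self), List.length_cons,
      Nat.add_sub_add_right, pow_succ, mul_assoc, symmetrizer_succ, Finset.sum_mul, Finset.mul_sum]
    refine Finset.sum_congr rfl fun j _ => ?_
    rw [mul_assoc, ih (fun s hs => hl s (List.mem_cons_of_mem _ hs)) (by simpa using hN)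
      (hx.comp Fin.succAbove_right_injective) fun i => hx0 _]
    simp only [List.getD_cons_zero, List.getD_cons_succ]
    ring

end Jing

/-! ### Algebraic independence of the power sums -/

section PsumIndependence

variable {𝕜 : Type*} [Field 𝕜] [CharZero 𝕜]

/-- The kernels of the iterates stabilize; lifting a kernel element through `f^n` puts the lift into
`ker f^(n+1) = ker f^n`. -/
lemma injective_of_surjective_ringHom {R : Type*} [CommRing R] [IsNoetherianRing R] (f : R →+* R)
    (hf : Function.Surjective f) : Function.Injective f := by
  have hker : ∀ n x, x ∈ RingHom.ker (f ^ n) ↔ f^[n] x = 0 := fun n x => by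
    rw [RingHom.mem_ker, RingHom.coe_pow]
  have hmono : Monotone fun n => RingHom.ker (f ^ n) := monotone_nat_of_le_succ fun n x hx => by
    rw [hker] at hx ⊢
    rw [Function.iterate_succ_apply', hx, map_zero]
  obtain ⟨n, hn⟩ := monotone_stabilizes_iff_noetherian.2 ‹IsNoetherianRing R› ⟨_, hmono⟩
  rw [injective_iff_map_eq_zero]
  intro x hx
  obtain ⟨y, rfl⟩ := hf.iterate n x
  have h1 : y ∈ RingHom.ker (f ^ (n + 1)) := by
    rw [hker, Function.iterate_succ_apply', hx]
  have h2 : RingHom.ker (f ^ n) = RingHom.ker (f ^ (n + 1)) := hn (n + 1) n.le_succ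
  rwa [← h2, hker] at h1

/-- Newton's identities, solved for `e_k` by dividing by `k`. -/
lemma esymm_mem_range_psum {N : ℕ} {S : Subalgebra 𝕜 (MvPolynomial (Fin N) 𝕜)}
    (hS : ∀ i : Fin N, MvPolynomial.psum (Fin N) 𝕜 (i + 1) ∈ S) (k : ℕ) (hk : k ≤ N) :
    MvPolynomial.esymm (Fin N) 𝕜 k ∈ S := by
  induction k using Nat.strong_induction_on with
  | _ k ih =>
  rcases Nat.eq_zero_or_pos k with rfl | hpos
  · rw [MvPolynomial.esymm_zero]
    exact S.one_mem
  · have h := MvPolynomial.mul_esymm_eq_sum (Fin N) 𝕜 k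
    have h1 : (k : MvPolynomial (Fin N) 𝕜) * MvPolynomial.esymm (Fin N) 𝕜 k ∈ S := by
      rw [h]
      refine S.mul_mem (S.pow_mem (S.neg_mem S.one_mem) _) (S.sum_mem fun a ha => ?_)
      rw [Finset.mem_filter, Finset.HasAntidiagonal.mem_antidiagonal] at ha
      refine S.mul_mem (S.mul_mem (S.pow_mem (S.neg_mem S.one_mem) _) (ih _ ha.2 (by omega))) ?_
      have := hS ⟨a.2 - 1, by omega⟩
      rwa [show a.2 - 1 + 1 = a.2 by omega] at this
    have hk0 : (k : 𝕜) ≠ 0 := by exact_mod_cast hpos.ne'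
    have h2 := S.smul_mem h1 (k : 𝕜)⁻¹
    rw [← nsmul_eq_mul, ← Nat.cast_smul_eq_nsmul 𝕜, smul_smul, inv_mul_cancel₀ hk0, one_smul] at h2
    exact h2

/-- The symmetric polynomials are a polynomial ring in `e_1, …, e_N` and are generated by `p_1, …,
p_N`. So `e_i ↦ p_i` gives a surjective endomorphism of a Noetherian ring, which is injective. -/
lemma aeval_psum_injective (N : ℕ) : Function.Injective (MvPolynomial.aeval
    (fun i : Fin N => MvPolynomial.psum (Fin N) 𝕜 (i + 1)) :
      MvPolynomial (Fin N) 𝕜 →ₐ[𝕜] MvPolynomial (Fin N) 𝕜) := by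
  set P : MvPolynomial (Fin N) 𝕜 →ₐ[𝕜] MvPolynomial.symmetricSubalgebra (Fin N) 𝕜 :=
    MvPolynomial.aeval fun i : Fin N => (⟨MvPolynomial.psum (Fin N) 𝕜 (i + 1),
      MvPolynomial.psum_isSymmetric _ _ _⟩ : MvPolynomial.symmetricSubalgebra (Fin N) 𝕜) with hP
  set E := MvPolynomial.esymmAlgEquiv (Fin N) 𝕜 (n := N) (Fintype.card_fin N) with hE
  have hPS : ∀ i : Fin N, MvPolynomial.psum (Fin N) 𝕜 (i + 1) ∈
      ((MvPolynomial.symmetricSubalgebra (Fin N) 𝕜).val.comp P).range := fun i =>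
    ⟨MvPolynomial.X i, by simp [hP]⟩
  have hsurj : Function.Surjective P := fun y => by
    obtain ⟨q, hq⟩ := E.surjective y
    rw [← hq]
    clear hq
    suffices h : ((E q : MvPolynomial (Fin N) 𝕜)) ∈
        ((MvPolynomial.symmetricSubalgebra (Fin N) 𝕜).val.comp P).range by
      obtain ⟨z, hz⟩ := h
      exact ⟨z, Subtype.ext hz⟩
    induction q using MvPolynomial.induction_on with
    | C c =>
      rw [← MvPolynomial.algebraMap_eq, AlgEquiv.commutes]
      exact Subalgebra.algebraMap_mem _ c
    | add p q hp hq =>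
      rw [map_add]
      exact Subalgebra.add_mem _ hp hq
    | mul_X p i hp =>
      rw [map_mul]
      refine Subalgebra.mul_mem _ hp ?_
      have : E (MvPolynomial.X i) = ⟨MvPolynomial.esymm (Fin N) 𝕜 (i + 1),
          MvPolynomial.esymm_isSymmetric _ _ _⟩ := by
        rw [← MvPolynomial.esymmAlgEquiv_symm_apply 𝕜 (Fintype.card_fin N) i]
        exact E.apply_symm_apply _
      rw [this]
      exact esymm_mem_range_psum hPS (i + 1) i.isLt
  have hinj : Function.Injective P := by
    have h := injective_of_surjective_ringHom (E.symm.toAlgHom.comp P).toRingHom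
      (E.symm.surjective.comp hsurj)
    exact Function.Injective.of_comp (f := E.symm) h
  have hcomp : (MvPolynomial.aeval (fun i : Fin N => MvPolynomial.psum (Fin N) 𝕜 (i + 1)) :
      MvPolynomial (Fin N) 𝕜 →ₐ[𝕜] MvPolynomial (Fin N) 𝕜) =
      (MvPolynomial.symmetricSubalgebra (Fin N) 𝕜).val.comp P :=
    MvPolynomial.algHom_ext fun i => by simp [hP]
  rw [hcomp]
  exact Subtype.val_injective.comp hinj

/-- Take `N` at least every index occurring in `f`, so that only independent power sums appear. -/
lemma eq_zero_of_aeval_psum_eq_zero {f : MvPolynomial ℕ+ 𝕜} {N₀ : ℕ}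
    (h : ∀ N, N₀ ≤ N → MvPolynomial.aeval (fun k : ℕ+ => MvPolynomial.psum (Fin N) 𝕜 k) f = 0) :
    f = 0 := by
  set N := max N₀ (f.vars.sup fun k => (k : ℕ)) with hN
  obtain ⟨q, hq⟩ := MvPolynomial.exists_rename_eq_of_vars_subset_range f
    (fun i : Fin N => Nat.succPNat i) (fun i j h => Fin.ext (Nat.succPNat_injective h)) (by
      intro k hk
      have h1 : (k : ℕ) ≤ N := (Finset.le_sup (f := fun k : ℕ+ => (k : ℕ)) hk).trans
        (le_max_right _ _)
      have := k.pos
      exact ⟨⟨k - 1, by omega⟩, PNat.eq (by simp [Nat.succPNat]; omega)⟩)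
  have h1 := h N (le_max_left _ _)
  rw [← hq, MvPolynomial.aeval_rename] at h1
  have h2 := (injective_iff_map_eq_zero _).1 (aeval_psum_injective (𝕜 := 𝕜) N) q h1
  rw [← hq, h2, map_zero]

end PsumIndependence

/-! ### `Q_λ` as a product of Jing's operators -/

section HallLittlewoodQ

variable {𝕜 : Type*} [Field 𝕜]

lemma length_partList {n : ℕ} (lam : n.Partition) : (partList lam).length = len lam := by
  simp [partList, len]

lemma pos_of_mem_partList {n : ℕ} {lam : n.Partition} {r : ℕ} (h : r ∈ partList lam) : 0 < r :=
  lam.parts_pos (by simpa [partList] using h)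

lemma sum_count_parts {n : ℕ} (lam : n.Partition) :
    ∑ i ∈ Finset.Icc 1 n, lam.parts.count i = len lam := by
  rw [len]
  refine Multiset.sum_count_eq_card fun i hi => ?_
  have h1 := lam.parts_pos hi
  have h2 := Multiset.single_le_sum (fun _ _ => Nat.zero_le _) i hi
  rw [lam.parts_sum] at h2
  exact Finset.mem_Icc.2 ⟨h1, h2⟩

/-- Each positive part absorbs one `1 - τ`, which turns its share of `v_λ` into `b_λ`. This
reconciles the normalizations of `P_λ` and of `evalPsum_jingList`. -/
lemma vCoeff_mul_pow {τ : 𝕜} (hτ : ∀ k : ℕ, 0 < k → τ ^ k ≠ 1) {n : ℕ} (lam : n.Partition) (N : ℕ) :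
    vCoeff τ lam N * (1 - τ) ^ len lam = bCoeff τ lam *
      ∏ k ∈ Finset.Icc 1 (N - len lam), (1 - τ ^ k) / (1 - τ) := by
  have h1 : 1 - τ ≠ 0 := sub_ne_zero.2 (by simpa using (hτ 1 one_pos).symm)
  rw [vCoeff, bCoeff, mul_assoc, mul_comm]
  congr 1
  rw [← sum_count_parts, ← Finset.prod_pow_eq_pow_sum, ← Finset.prod_mul_distrib]
  refine Finset.prod_congr rfl fun i _ => ?_
  have : (1 - τ) ^ lam.parts.count i = ∏ k ∈ Finset.Icc 1 (lam.parts.count i), (1 - τ) := by simp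
  rw [this, ← Finset.prod_mul_distrib]
  exact Finset.prod_congr rfl fun k _ => div_mul_cancel₀ _ h1

lemma bCoeff_ne_zero {τ : 𝕜} (hτ : ∀ k : ℕ, 0 < k → τ ^ k ≠ 1) {n : ℕ} (lam : n.Partition) :
    bCoeff τ lam ≠ 0 :=
  Finset.prod_ne_zero_iff.2 fun _ _ => Finset.prod_ne_zero_iff.2 fun k hk =>
    sub_ne_zero.2 (hτ k (Finset.mem_Icc.1 hk).1).symm

variable [CharZero 𝕜]

lemma IsHallLittlewoodP.eq {τ : 𝕜} {n : ℕ} {lam : n.Partition} {f g : MvPolynomial ℕ+ 𝕜}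
    (hf : IsHallLittlewoodP τ lam f) (hg : IsHallLittlewoodP τ lam g) : f = g := by
  rw [← sub_eq_zero]
  refine eq_zero_of_aeval_psum_eq_zero (N₀ := len lam) fun N hN => ?_
  rw [map_sub, sub_eq_zero]
  exact IsFractionRing.injective (MvPolynomial (Fin N) 𝕜) (FractionRing (MvPolynomial (Fin N) 𝕜))
    ((hf N hN).trans (hg N hN).symm)

lemma isHallLittlewoodP_jingList {τ : 𝕜} (hτ : ∀ k : ℕ, 0 < k → τ ^ k ≠ 1) {n : ℕ}
    (lam : n.Partition) :
    IsHallLittlewoodP τ lam ((bCoeff τ lam)⁻¹ • jingList τ (partList lam)) := by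
  intro N hN
  set K := FractionRing (MvPolynomial (Fin N) 𝕜)
  set x : Fin N → K := fun i => algebraMap (MvPolynomial (Fin N) 𝕜) K (MvPolynomial.X i) with hx
  have hinj := IsFractionRing.injective (MvPolynomial (Fin N) 𝕜) K
  have hxi : Function.Injective x := hinj.comp MvPolynomial.X_injective
  have hx0 : ∀ i, x i ≠ 0 := fun i => by
    rw [hx, Ne, ← map_zero (algebraMap (MvPolynomial (Fin N) 𝕜) K), hinj.eq_iff]
    exact MvPolynomial.X_ne_zero i
  have h1 : ∀ f : MvPolynomial ℕ+ 𝕜, algebraMap (MvPolynomial (Fin N) 𝕜) K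
      (MvPolynomial.aeval (fun k : ℕ+ => MvPolynomial.psum (Fin N) 𝕜 k) f) = evalPsum 𝕜 x f := by
    intro f
    have : ((IsScalarTower.toAlgHom 𝕜 (MvPolynomial (Fin N) 𝕜) K).comp
        (MvPolynomial.aeval fun k : ℕ+ => MvPolynomial.psum (Fin N) 𝕜 k)) = evalPsum 𝕜 x :=
      MvPolynomial.algHom_ext fun k => by simp [evalPsum, MvPolynomial.psum, hx]
    exact congrArg (fun φ : MvPolynomial ℕ+ 𝕜 →ₐ[𝕜] K => φ f) this
  have h2 : hallLittlewoodPoly τ lam N = (vCoeff τ lam N)⁻¹ •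
      symmetrizer (algebraMap 𝕜 K τ) x fun i => (partList lam).getD i 0 := by
    simp only [hallLittlewoodPoly, symmetrizer, Algebra.smul_def]
    rfl
  have h3 := evalPsum_jingList (L := K) (τ := τ) (by simpa using hτ 1 one_pos)
    (l := partList lam) (fun r hr => (pos_of_mem_partList hr).ne')
    (by rwa [length_partList]) hxi hx0
  rw [length_partList] at h3
  have hw : ∏ k ∈ Finset.Icc 1 (N - len lam), (1 - τ ^ k) / (1 - τ) ≠ 0 :=
    Finset.prod_ne_zero_iff.2 fun k hk => div_ne_zero
      (sub_ne_zero.2 (hτ k (Finset.mem_Icc.1 hk).1).symm)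
      (sub_ne_zero.2 (by simpa using (hτ 1 one_pos).symm))
  have hb := bCoeff_ne_zero hτ lam
  have hv := vCoeff_mul_pow hτ lam N
  have ht : (1 - τ) ^ len lam ≠ 0 :=
    pow_ne_zero _ (sub_ne_zero.2 (by simpa using (hτ 1 one_pos).symm))
  set w := ∏ k ∈ Finset.Icc 1 (N - len lam), (1 - τ ^ k) / (1 - τ) with hwdef
  have hw' : ∏ k ∈ Finset.Icc 1 (N - len lam), (1 - algebraMap 𝕜 K τ ^ k) /
      (1 - algebraMap 𝕜 K τ) = algebraMap 𝕜 K w := by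
    simp [hwdef, map_prod]
  rw [hw', mul_comm, ← Algebra.smul_def, ← map_one (algebraMap 𝕜 K), ← map_sub, ← map_pow,
    ← Algebra.smul_def] at h3
  have hv0 : vCoeff τ lam N ≠ 0 := fun h => by
    rw [h, zero_mul] at hv
    exact mul_ne_zero hb hw hv.symm
  rw [h1, map_smul, h2, ← inv_smul_smul₀ hw (evalPsum 𝕜 x _), h3, smul_smul, smul_smul]
  congr 1
  field_simp
  rw [mul_comm, hv]

lemma hallLittlewoodQ_eq {τ : 𝕜} (hτ : ∀ k : ℕ, 0 < k → τ ^ k ≠ 1) {n : ℕ} (lam : n.Partition) :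
    hallLittlewoodQ τ lam = jingList τ (partList lam) := by
  have h := isHallLittlewoodP_jingList hτ lam
  have hex : ∃ f, IsHallLittlewoodP τ lam f := ⟨_, h⟩
  rw [hallLittlewoodQ, hallLittlewoodP, dif_pos hex, hex.choose_spec.eq h,
    smul_inv_smul₀ (bCoeff_ne_zero hτ lam)]

end HallLittlewoodQ

/-! ### Vertex operators acting as Jing's operators, and their transposes -/

section Substitution

variable {𝕜 : Type*} [Field 𝕜]

/-- The order of factors is immaterial, as the operators are images of elements of a commutative
algebra. -/
lemma substOp_algHom (φ : Fock 𝕜 →ₐ[𝕜] Op 𝕜) (y : ℕ+ → Fock 𝕜) (f : MvPolynomial ℕ+ 𝕜) :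
    substOp (fun n => φ (y n)) f = φ (MvPolynomial.aeval y f) := by
  rw [substOp, MvPolynomial.aeval_def, MvPolynomial.eval₂_eq, map_sum]
  refine Finset.sum_congr rfl fun m _ => ?_
  rw [← Algebra.smul_def, map_smul]
  congr 1
  simp only [← map_pow]
  have h : (fun n => φ (y n ^ m n)) = φ ∘ fun n => y n ^ m n := rfl
  rw [h, ← List.map_map, ← map_list_prod]
  congr 1
  rw [Finset.prod, ← Finset.sort_eq m.support (· ≤ ·), Multiset.map_coe, Multiset.prod_coe]

lemma shift_aeval_of_forall {γ : Fin 2 × ℕ+ → 𝕜} {y : ℕ+ → Fock 𝕜}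
    (hy : ∀ n, shift γ (y n) = Polynomial.C (y n)) (f : MvPolynomial ℕ+ 𝕜) :
    shift γ (MvPolynomial.aeval y f) = Polynomial.C (MvPolynomial.aeval y f) := by
  induction f using MvPolynomial.induction_on with
  | C c =>
    rw [← MvPolynomial.algebraMap_eq, AlgHom.commutes, AlgHom.commutes,
      IsScalarTower.algebraMap_apply 𝕜 (Fock 𝕜), Polynomial.algebraMap_eq]
  | add p q hp hq => simp only [map_add, hp, hq]
  | mul_X p n hp => rw [map_mul, map_mul, hp, MvPolynomial.aeval_X, hy, Polynomial.C_mul]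

/-- On polynomials in the `y_n` the translation is `powerShift` with its variable scaled by `c`. -/
lemma coeff_shift_aeval {γ : Fin 2 × ℕ+ → 𝕜} {y : ℕ+ → Fock 𝕜} {c : 𝕜}
    (hy : ∀ n, shift γ (y n) = Polynomial.C (y n) - c ^ (n : ℕ) • Polynomial.X ^ (n : ℕ))
    (f : MvPolynomial ℕ+ 𝕜) (j : ℕ) :
    (shift γ (MvPolynomial.aeval y f)).coeff j =
      c ^ j • MvPolynomial.aeval y ((powerShift f).coeff j) := by
  induction f using MvPolynomial.induction_on generalizing j with
  | C a =>
    rw [← MvPolynomial.algebraMap_eq, AlgHom.commutes, AlgHom.commutes, AlgHom.commutes,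
      IsScalarTower.algebraMap_apply 𝕜 (Fock 𝕜) (Polynomial (Fock 𝕜)),
      IsScalarTower.algebraMap_apply 𝕜 (MvPolynomial ℕ+ 𝕜) (Polynomial (MvPolynomial ℕ+ 𝕜)),
      Polynomial.algebraMap_eq, Polynomial.algebraMap_eq, Polynomial.coeff_C, Polynomial.coeff_C]
    split_ifs with h
    · rw [h, pow_zero, one_smul, AlgHom.commutes]
    · rw [map_zero, smul_zero]
  | add p q hp hq => simp only [map_add, Polynomial.coeff_add, hp, hq, smul_add]
  | mul_X p n hp =>
    rw [map_mul, map_mul, map_mul, MvPolynomial.aeval_X, hy, powerShift_X]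
    simp only [mul_sub, Polynomial.coeff_sub, Polynomial.coeff_mul_C, mul_smul_comm,
      Polynomial.coeff_smul, Polynomial.coeff_mul_X_pow', hp, map_sub, map_mul, smul_sub,
      MvPolynomial.aeval_X, smul_mul_assoc]
    congr 1
    split_ifs with h
    · rw [smul_smul, ← pow_add, Nat.add_sub_cancel' h]
    · simp

/-- A vertex operator acts on polynomials in a family `y_n` as Jing's vertex operator. -/
lemma vertexMode_aeval_mul {α γ : Fin 2 × ℕ+ → 𝕜} {y : ℕ+ → Fock 𝕜} {g : Fock 𝕜} {κ τ : 𝕜}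
    (hκ : κ ≠ 0)
    (hα : ∀ n, lin α n = (κ ^ (n : ℕ) * ((1 - τ ^ (n : ℕ)) / ((n : ℕ) : 𝕜))) • y n)
    (hy : ∀ n, shift γ (y n) = Polynomial.C (y n) - κ⁻¹ ^ (n : ℕ) • Polynomial.X ^ (n : ℕ))
    (hg : shift γ g = Polynomial.C g) (r : ℕ) (f : MvPolynomial ℕ+ 𝕜) :
    vertexMode α γ (-(r : ℤ)) (MvPolynomial.aeval y f * g) =
      κ ^ r • (MvPolynomial.aeval y (jing τ r f) * g) := by
  have hlin : lin α = fun n : ℕ+ => κ ^ (n : ℕ) • MvPolynomial.aeval y (jingExp τ n) := by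
    funext n
    rw [hα, jingExp, map_smul, MvPolynomial.aeval_X, smul_smul]
  set P := shift γ (MvPolynomial.aeval y f * g) with hP
  have hPc : ∀ j, P.coeff j = κ⁻¹ ^ j • (MvPolynomial.aeval y ((powerShift f).coeff j) * g) :=
    fun j => by
      rw [hP, map_mul, hg, Polynomial.coeff_mul_C, coeff_shift_aeval hy, smul_mul_assoc]
  set J := max P.natDegree (powerShift f).natDegree + 1
  rw [vertexMode_apply, modeOf_eq_sum_range _ _ _ (J := J) (Nat.lt_succ_of_le (le_max_left _ _)),
    jing, Polynomial.sum_over_range' _ (by simp) J (Nat.lt_succ_of_le (le_max_right _ _)),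
    map_sum, Finset.sum_mul, Finset.smul_sum]
  refine Finset.sum_congr rfl fun j _ => ?_
  have hjr : (j : ℤ) - -(r : ℤ) = ((r + j : ℕ) : ℤ) := by push_cast; ring
  -- The scales combine to `κ^(r+j) κ^(-j) = κ^r`, independent of `j`.
  rw [hPc, hlin, expZ_pow_smul, hjr, expZ_natCast, ← map_expC, zpow_natCast, smul_mul_smul_comm,
    map_mul, mul_assoc, pow_add, mul_assoc, ← mul_pow, mul_inv_cancel₀ hκ, one_pow, mul_one]

lemma list_prod_map_apply_eq {y : ℕ+ → Fock 𝕜} {g : Fock 𝕜} {c κ τ : 𝕜} {T : ℕ → Op 𝕜}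
    {l : List ℕ} (h : ∀ r ∈ l, ∀ f, T r (MvPolynomial.aeval y f * g) =
      (c * κ ^ r) • (MvPolynomial.aeval y (jing τ r f) * g)) :
    (l.map T).prod g = (c ^ l.length * κ ^ l.sum) • (MvPolynomial.aeval y (jingList τ l) * g) := by
  induction l with
  | nil => simp [jingList]
  | cons r l ih =>
    rw [List.map_cons, List.prod_cons, Module.End.mul_apply,
      ih fun s hs => h s (List.mem_cons_of_mem _ hs), map_smul, h r List.mem_cons_self, smul_smul,
      List.length_cons, List.sum_cons]
    congr 1
    ring

variable [CharZero 𝕜] in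
/-- The transpose of a vertex operator acting on the dual vectors `⟨u| f(∂)`. -/
lemma constTerm_diffOp_vertexMode (α γ : Fin 2 × ℕ+ → 𝕜) (n : ℤ) (f v : Fock 𝕜) :
    constTerm (diffOp f (vertexMode α γ n v)) =
      constTerm (diffOp (vertexMode γ α (-n) f) v) := by
  -- Both sides sum this one family. On the left `j` is the degree taken by the annihilation part;
  -- on the right the index is lowered by `n`, so that it becomes the degree of the creation part,
  -- now differentiating the symbol `f`.
  set F : ℤ → 𝕜 := fun j => constTerm (diffOp
    (diffOp (expZ 𝕜 (lin α) (j - n)) f * expZ 𝕜 (lin γ) j) v) with hF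
  have h1 := finsum_int_eq_sum_range F ((shift γ v).natDegree + 1)
    (fun i hi => by simp [hF, expZ_of_neg _ hi])
    (fun j hj => by
      simp only [hF]
      rw [diffOp_mul_apply, expZ_natCast, diffOp_expC_lin,
        Polynomial.coeff_eq_zero_of_natDegree_lt (Nat.lt_of_succ_le hj), map_zero, map_zero])
  have h2 := finsum_int_eq_sum_range (F ∘ Equiv.addRight n) ((shift α f).natDegree + 1)
    (fun i hi => by simp [hF, expZ_of_neg _ hi])
    (fun j hj => by
      simp only [hF, Function.comp_apply, Equiv.coe_addRight, add_sub_cancel_right]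
      rw [expZ_natCast, diffOp_expC_lin,
        Polynomial.coeff_eq_zero_of_natDegree_lt (Nat.lt_of_succ_le hj), zero_mul, map_zero,
        LinearMap.zero_apply, map_zero])
  have h3 := finsum_comp_equiv (Equiv.addRight n) (f := F)
  rw [vertexMode_apply, vertexMode_apply, modeOf_eq_sum_range _ _ _ (Nat.lt_succ_self _),
    modeOf_eq_sum_range _ _ _ (Nat.lt_succ_self _), map_sum, map_sum, map_sum,
    LinearMap.sum_apply, map_sum]
  refine Eq.trans ?_ (h1.2.symm.trans (h3.symm.trans (h2.2.trans ?_)))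
  · refine Finset.sum_congr rfl fun j _ => ?_
    rw [constTerm_diffOp_mul, ← diffOp_expC_lin, ← diffOp_mul_apply, ← expZ_natCast]
  · refine Finset.sum_congr rfl fun j _ => ?_
    simp only [hF, Function.comp_apply, Equiv.coe_addRight, add_sub_cancel_right]
    rw [expZ_natCast, diffOp_expC_lin, sub_neg_eq_add, mul_comm]

/-- Transposition reverses products, which undoes the reversed order of the factors in the dual
vectors. -/
lemma constTerm_diffOp_list_prod {T T' : ℕ → Op 𝕜} {l : List ℕ}
    (h : ∀ r ∈ l, ∀ f v, constTerm (diffOp f (T r v)) = constTerm (diffOp (T' r f) v))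
    (f v : Fock 𝕜) :
    constTerm (diffOp f ((l.map T).reverse.prod v)) =
      constTerm (diffOp ((l.map T').prod f) v) := by
  induction l generalizing v with
  | nil => rfl
  | cons r l ih =>
    rw [List.map_cons, List.reverse_cons, List.prod_append, List.prod_singleton,
      Module.End.mul_apply, ih fun s hs => h s (List.mem_cons_of_mem _ hs), h r List.mem_cons_self,
      List.map_cons, List.prod_cons, Module.End.mul_apply]

end Substitution

/-! ### Exponents at `q = 0` and lists of parts -/

section Exponents

variable {𝕜 : Type*} [Field 𝕜]

lemma lin_creationExp (t : 𝕜) (i : Fin 2) (n : ℕ+) :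
    lin (creationExp t i) n =
      ((1 - t⁻¹ ^ (n : ℕ)) / ((n : ℕ) : 𝕜)) • (MvPolynomial.X (i, n) : Fock 𝕜) := by
  simp [lin, creationExp]

lemma lin_annihExp_zero (i : Fin 2) (n : ℕ+) :
    lin (annihExp (0 : 𝕜) i) n = -(MvPolynomial.X (i, n) : Fock 𝕜) := by
  simp [lin, annihExp]

/-- In `ketX` and `braX` the list of parts is coerced to a list of integers by a monadic bind; this
restores a plain `map` over naturals. -/
lemma map_bind_pure {M : Type} {N : Type*} (e : ℕ → M) (F : M → N) (l : List ℕ) :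
    List.map F (do let a ← l; pure (e a)) = l.map fun k => F (e k) := by
  induction l with
  | nil => rfl
  | cons r l ih => exact congrArg (F (e r) :: ·) ih

lemma sum_partList {n : ℕ} (lam : n.Partition) : (partList lam).sum = n := by
  rw [← Multiset.sum_coe, partList, Multiset.sort_eq, lam.parts_sum]

end Exponents

/-! ### The crystallized vectors and dual vectors -/

section CrystalVectors

variable {𝕜 : Type*} [NontriviallyNormedField 𝕜] {t : 𝕜}

lemma crystalX1_of_neg (u₁ u₂ : 𝕜) {k : ℕ} (hk : 0 < k) :
    crystalX1 t u₁ u₂ (-(k : ℤ)) =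
      u₂ • vertexMode (creationExp t 1 - creationExp t 0) (annihExp 0 1) (-(k : ℤ)) := by
  rw [crystalX1, if_neg (by omega), if_pos (by omega), mul_zero, zero_smul, zero_add, mul_one]

lemma crystalX1_of_pos (u₁ u₂ : 𝕜) {k : ℕ} (hk : 0 < k) :
    crystalX1 t u₁ u₂ (k : ℤ) = u₁ • vertexMode (creationExp t 0) (annihExp 0 0) (k : ℤ) := by
  rw [crystalX1, if_pos (by omega), if_neg (by omega), mul_zero, zero_smul, add_zero, mul_one]

/-- Here `y_n = b^{(-)}_{-n}`, `κ = 1`, `τ = t⁻¹`: at `q = 0` the annihilation part shifts the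
second boson by `-y^n`. -/
lemma crystalX1_ket (u₁ u₂ : 𝕜) {l : List ℕ} (hl : ∀ r ∈ l, 0 < r) :
    (l.map fun k : ℕ => crystalX1 t u₁ u₂ (-(k : ℤ))).prod (ket 𝕜) = u₂ ^ l.length •
      MvPolynomial.aeval (fun n => -MvPolynomial.X (0, n) + MvPolynomial.X (1, n) : ℕ+ → Fock 𝕜)
        (jingList t⁻¹ l) := by
  have h := list_prod_map_apply_eq (g := (1 : Fock 𝕜)) (c := u₂) (κ := 1) (τ := t⁻¹)
    (T := fun k => crystalX1 t u₁ u₂ (-(k : ℤ))) (l := l)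
    (y := fun n => -MvPolynomial.X (0, n) + MvPolynomial.X (1, n)) fun r hr f => by
      rw [crystalX1_of_neg _ _ (hl r hr), LinearMap.smul_apply,
        vertexMode_aeval_mul (τ := t⁻¹) one_ne_zero _ _ (map_one _), smul_smul]
      · intro n
        simp only [lin, creationExp, Fin.sum_univ_two, Pi.sub_apply, zero_ne_one, one_ne_zero,
          if_true, if_false, zero_sub, sub_zero, one_pow, one_mul, smul_add, smul_neg, neg_smul]
      · intro n
        simp [shift_X, annihExp]
        ring
  rw [ket, h, one_pow, mul_one, mul_one]

/-- At `q = 0` both bosons are shifted by the same amount, so polynomials in their difference pass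
through unchanged, as the constant `g`. -/
lemma crystalX2_ket (u₁ u₂ : 𝕜) (l : List ℕ) (f : MvPolynomial ℕ+ 𝕜) :
    (l.map fun k : ℕ => crystalX2 t u₁ u₂ (-(k : ℤ))).prod (MvPolynomial.aeval
      (fun n => -MvPolynomial.X (0, n) + MvPolynomial.X (1, n) : ℕ+ → Fock 𝕜) f) =
      (u₁ * u₂) ^ l.length •
        (MvPolynomial.aeval (fun n => MvPolynomial.X (1, n) : ℕ+ → Fock 𝕜) (jingList t⁻¹ l) *
          MvPolynomial.aeval
            (fun n => -MvPolynomial.X (0, n) + MvPolynomial.X (1, n) : ℕ+ → Fock 𝕜) f) := by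
  have h := list_prod_map_apply_eq (c := u₁ * u₂) (κ := 1) (τ := t⁻¹) (l := l)
    (T := fun k => crystalX2 t u₁ u₂ (-(k : ℤ)))
    (g := MvPolynomial.aeval
      (fun n => -MvPolynomial.X (0, n) + MvPolynomial.X (1, n) : ℕ+ → Fock 𝕜) f)
    (y := fun n => MvPolynomial.X (1, n)) fun r _ f' => by
      rw [crystalX2, LinearMap.smul_apply,
        vertexMode_aeval_mul (τ := t⁻¹) one_ne_zero _ _ (shift_aeval_of_forall _ _), smul_smul]
      · intro n
        rw [lin_creationExp, one_pow, one_mul]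
      · intro n
        simp [shift_X, annihExp, sub_eq_add_neg]
      · intro n
        simp [shift_X, annihExp]
        ring
  rw [h, one_pow, mul_one]

variable [CharZero 𝕜]

/-- From `t^n (1 - t^(-n)) = -(1 - t^n)`: in the transposed operators this makes `κ = t` the right
scale for `b_n = n / (1 - t^n) ∂`. -/
lemma pow_mul_div_mul_div (ht0 : t ≠ 0) (ht : ∀ n : ℕ, 0 < n → t ^ n ≠ 1) (n : ℕ+) :
    t ^ (n : ℕ) * ((1 - t⁻¹ ^ (n : ℕ)) / ((n : ℕ) : 𝕜)) * (((n : ℕ) : 𝕜) / (1 - t ^ (n : ℕ))) =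
      -1 := by
  have h1 : ((n : ℕ) : 𝕜) ≠ 0 := by exact_mod_cast n.ne_zero
  have h2 : 1 - t ^ (n : ℕ) ≠ 0 := sub_ne_zero.2 (ht n n.pos).symm
  have h3 := pow_ne_zero (n : ℕ) ht0
  rw [inv_pow]
  field_simp
  ring

lemma div_mul_div_eq_neg_inv_pow (ht0 : t ≠ 0) (ht : ∀ n : ℕ, 0 < n → t ^ n ≠ 1) (n : ℕ+) :
    ((n : ℕ) : 𝕜) / (1 - t ^ (n : ℕ)) * ((1 - t⁻¹ ^ (n : ℕ)) / ((n : ℕ) : 𝕜)) =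
      -t⁻¹ ^ (n : ℕ) := by
  have h := congrArg (t⁻¹ ^ (n : ℕ) * ·) (pow_mul_div_mul_div ht0 ht n)
  have h3 : t⁻¹ ^ (n : ℕ) * t ^ (n : ℕ) = 1 := by rw [← mul_pow, inv_mul_cancel₀ ht0, one_pow]
  simp only [← mul_assoc, h3, one_mul, mul_neg, mul_one] at h
  rw [mul_comm, h]

lemma crystalX1_bra (ht0 : t ≠ 0) (ht : ∀ n : ℕ, 0 < n → t ^ n ≠ 1) (u₁ u₂ : 𝕜) {l : List ℕ}
    (hl : ∀ r ∈ l, 0 < r) (v : Fock 𝕜) :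
    constTerm ((l.map fun k : ℕ => crystalX1 t u₁ u₂ (k : ℤ)).reverse.prod v) =
      (u₁ ^ l.length * t ^ l.sum) • constTerm (diffOp (MvPolynomial.aeval
        (fun n => (((n : ℕ) : 𝕜) / (1 - t ^ (n : ℕ))) • MvPolynomial.X (0, n) : ℕ+ → Fock 𝕜)
        (jingList t⁻¹ l)) v) := by
  have h1 := constTerm_diffOp_list_prod (T := fun k => crystalX1 t u₁ u₂ (k : ℤ))
    (T' := fun k => u₁ • vertexMode (annihExp 0 0) (creationExp t 0) (-(k : ℤ))) (l := l)
    (fun r hr f v => by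
      rw [crystalX1_of_pos _ _ (hl r hr)]
      simp only [LinearMap.smul_apply, map_smul, constTerm_diffOp_vertexMode]) 1 v
  rw [map_one, Module.End.one_apply] at h1
  have h2 := list_prod_map_apply_eq (g := (1 : Fock 𝕜)) (c := u₁) (κ := t) (τ := t⁻¹)
    (T := fun k => u₁ • vertexMode (annihExp 0 0) (creationExp t 0) (-(k : ℤ))) (l := l)
    (y := fun n => (((n : ℕ) : 𝕜) / (1 - t ^ (n : ℕ))) • MvPolynomial.X (0, n)) fun r hr f => by
      rw [LinearMap.smul_apply, vertexMode_aeval_mul (τ := t⁻¹) ht0 _ _ (map_one _), smul_smul]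
      · intro n
        rw [lin_annihExp_zero, smul_smul, pow_mul_div_mul_div ht0 ht, neg_one_smul]
      · intro n
        rw [map_smul, shift_X, smul_add, ← Polynomial.smul_C, smul_smul,
          creationExp, if_pos rfl, div_mul_div_eq_neg_inv_pow ht0 ht, neg_smul,
          ← sub_eq_add_neg]
  rw [h1, h2, mul_one, map_smul, LinearMap.smul_apply, map_smul]

/-- The transposed creation part shifts only the second boson, so the symbol in the first boson left
by `crystalX1_bra` is a passive factor. -/
lemma crystalX2_bra (ht0 : t ≠ 0) (ht : ∀ n : ℕ, 0 < n → t ^ n ≠ 1) (u₁ u₂ : 𝕜) (l : List ℕ)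
    (f : MvPolynomial ℕ+ 𝕜) (v : Fock 𝕜) :
    constTerm (diffOp (MvPolynomial.aeval (fun n => (((n : ℕ) : 𝕜) / (1 - t ^ (n : ℕ))) •
      MvPolynomial.X (0, n) : ℕ+ → Fock 𝕜) f)
        ((l.map fun k : ℕ => crystalX2 t u₁ u₂ (k : ℤ)).reverse.prod v)) =
      ((u₁ * u₂) ^ l.length * t ^ l.sum) • constTerm (diffOp (MvPolynomial.aeval
        (fun n => (((n : ℕ) : 𝕜) / (1 - t ^ (n : ℕ))) •
          (MvPolynomial.X (0, n) + MvPolynomial.X (1, n)) : ℕ+ → Fock 𝕜) (jingList t⁻¹ l) *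
          MvPolynomial.aeval (fun n => (((n : ℕ) : 𝕜) / (1 - t ^ (n : ℕ))) •
            MvPolynomial.X (0, n) : ℕ+ → Fock 𝕜) f) v) := by
  have h1 := constTerm_diffOp_list_prod (T := fun k => crystalX2 t u₁ u₂ (k : ℤ))
    (T' := fun k => (u₁ * u₂) • vertexMode (annihExp 0 1 + annihExp 0 0) (creationExp t 1)
      (-(k : ℤ))) (l := l)
    (fun r hr f v => by
      simp only [crystalX2, LinearMap.smul_apply, map_smul, constTerm_diffOp_vertexMode])
    (MvPolynomial.aeval (fun n => (((n : ℕ) : 𝕜) / (1 - t ^ (n : ℕ))) •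
      MvPolynomial.X (0, n) : ℕ+ → Fock 𝕜) f) v
  have h2 := list_prod_map_apply_eq (g := (MvPolynomial.aeval (fun n => (((n : ℕ) : 𝕜) /
      (1 - t ^ (n : ℕ))) • MvPolynomial.X (0, n) : ℕ+ → Fock 𝕜) f)) (c := u₁ * u₂) (κ := t)
    (τ := t⁻¹) (T := fun k => (u₁ * u₂) • vertexMode (annihExp 0 1 + annihExp 0 0)
      (creationExp t 1) (-(k : ℤ))) (l := l)
    (y := fun n => (((n : ℕ) : 𝕜) / (1 - t ^ (n : ℕ))) •
      (MvPolynomial.X (0, n) + MvPolynomial.X (1, n))) fun r hr f => by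
      rw [LinearMap.smul_apply, vertexMode_aeval_mul (τ := t⁻¹) ht0 _ _
        (shift_aeval_of_forall _ _), smul_smul]
      · intro n
        rw [lin_add, Pi.add_apply, lin_annihExp_zero, lin_annihExp_zero, smul_smul,
          pow_mul_div_mul_div ht0 ht, neg_one_smul, neg_add_rev]
      · intro n
        rw [map_smul, map_add, shift_X, shift_X, creationExp, creationExp, if_neg (by simp),
          if_pos rfl, zero_smul, add_zero, ← add_assoc, ← Polynomial.C_add, smul_add,
          ← Polynomial.smul_C, smul_smul, div_mul_div_eq_neg_inv_pow ht0 ht, neg_smul,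
          ← sub_eq_add_neg]
      · intro n
        rw [map_smul, shift_X, creationExp, if_neg (by simp), zero_smul, add_zero,
          ← Polynomial.smul_C]
  rw [h1, h2, map_smul, LinearMap.smul_apply, map_smul]

end CrystalVectors

end CrystalPBW

end

theorem mainTheorem7 {𝕜 : Type*} [NontriviallyNormedField 𝕜] [CharZero 𝕜]
    (t u₁ u₂ : 𝕜) (ht0 : t ≠ 0) (ht : ∀ n : ℕ, 0 < n → t ^ n ≠ 1) :
    (∀ n : ℤ, IsCrystalLimit (fun s => s ^ n.natAbs • X1 t u₁ u₂ s n) (Xt1 t u₁ u₂ n)) ∧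
    (∀ n : ℤ, IsCrystalLimit (fun s => s ^ n • X2 t u₁ u₂ s n) (Xt2 t u₁ u₂ n)) ∧
    ∀ (a b : ℕ) (lam : a.Partition) (mu : b.Partition),
      ketX t u₁ u₂ lam mu =
        ((u₁ * u₂) ^ len mu * u₂ ^ len lam) •
          (substOp bPlusCreate (hallLittlewoodQ t⁻¹ mu) *
            substOp bMinusCreate (hallLittlewoodQ t⁻¹ lam)) (ket 𝕜) ∧
      braX t u₁ u₂ lam mu =
        (u₁ ^ len lam * (u₁ * u₂) ^ len mu * t ^ (a + b)) •
          (bra 𝕜 ∘ₗ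
            (substOp (bMinusAnnih t) (hallLittlewoodQ t⁻¹ lam) *
              substOp (bPlusAnnih t) (hallLittlewoodQ t⁻¹ mu))) := by
  refine ⟨fun n => Xt1_eq ht u₁ u₂ ▸ isCrystalLimit_X1 ht u₁ u₂ n,
    fun n => Xt2_eq ht0 ht u₁ u₂ ▸ isCrystalLimit_X2 ht0 ht u₁ u₂ n, fun a b lam mu => ?_⟩
  have hτ : ∀ k : ℕ, 0 < k → t⁻¹ ^ k ≠ 1 := fun k hk h => ht k hk (by
    rwa [inv_pow, inv_eq_one] at h)
  rw [hallLittlewoodQ_eq hτ, hallLittlewoodQ_eq hτ]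
  have hl : ∀ r ∈ partList lam, 0 < r := fun r hr => pos_of_mem_partList hr
  constructor
  · have e1 : (bPlusCreate : ℕ+ → Op 𝕜) = fun n =>
        Algebra.lmul 𝕜 (Fock 𝕜) (MvPolynomial.X (1, n)) := rfl
    have e2 : (bMinusCreate : ℕ+ → Op 𝕜) = fun n =>
        Algebra.lmul 𝕜 (Fock 𝕜) (-MvPolynomial.X (0, n) + MvPolynomial.X (1, n)) := by
      funext n
      rw [map_add, map_neg]
      rfl
    rw [ketX, Xt1_eq ht, Xt2_eq ht0 ht, map_bind_pure, map_bind_pure, Module.End.mul_apply, crystalX1_ket _ _ hl, map_smul,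
      crystalX2_ket, e1, e2, substOp_algHom, substOp_algHom, ← map_mul, length_partList,
      length_partList, smul_smul, mul_comm (u₂ ^ _), ket]
    simp
  · have e1 : bMinusAnnih t = fun n : ℕ+ => diffOp
        ((((n : ℕ) : 𝕜) / (1 - t ^ (n : ℕ))) • MvPolynomial.X (0, n) : Fock 𝕜) := by
      funext n
      refine LinearMap.ext fun v => ?_
      rw [map_smul, LinearMap.smul_apply, diffOp_X]
      rfl
    have e2 : bPlusAnnih t = fun n : ℕ+ => diffOp ((((n : ℕ) : 𝕜) / (1 - t ^ (n : ℕ))) •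
        (MvPolynomial.X (0, n) + MvPolynomial.X (1, n)) : Fock 𝕜) := by
      funext n
      refine LinearMap.ext fun v => ?_
      rw [map_smul, map_add, smul_add, LinearMap.add_apply, LinearMap.smul_apply,
        LinearMap.smul_apply, diffOp_X, diffOp_X]
      rfl
    refine LinearMap.ext fun v => ?_
    have hb : bra 𝕜 = constTerm := rfl
    -- Transposition leaves the symbol of `Q_μ` to the left of that of `Q_λ`; symbols commute, so
    -- the required order follows.
    rw [braX, Xt1_eq ht, Xt2_eq ht0 ht, map_bind_pure, map_bind_pure, e1, e2, substOp_algHom, substOp_algHom, hb,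
      LinearMap.comp_apply, Module.End.mul_apply, crystalX1_bra ht0 ht _ _ hl,
      crystalX2_bra ht0 ht, LinearMap.smul_apply, LinearMap.comp_apply, ← map_mul, mul_comm
      (MvPolynomial.aeval _ _), length_partList, length_partList, sum_partList, sum_partList,
      smul_smul]
    congr 1
    ring
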